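/- **Setting.** One observes $Y_1,\dots,Y_n$ i.i.d. from a probability density $f_0$ on $[0,1]$; $P_0$ denotes their law and $F_0(g)=\int_0^1 g f_0$. The functional of interest is $\psi(f)=\int_0^1 a f$, where, for $0<\gamma\le 1/2$, $$a(x)=\sum_{l=-1}^{\infty}\sum_{k} 2^{-l(1/2+\gamma)}\psi_{lk}(x),\qquad x\in[0,1],$$ with $(\psi_{lk})$ the Haar basis of $[0,1]$: $\psi_{-1,0}=1_{[0,1]}$ is the only element of level $l=-1$, and $\psi_{lk}(x)=2^{l/2}\psi(2^lx-k)$ for $l\ge 0$, $0\le k\le 2^l-1$, with $\psi=1_{[0,1/2)}-1_{[1/2,1)}$. For $k\ge1$ let $I_j=[(j-1)/k,j/k]$, $1\le j\le k$, and for integrable $h$ let $h_{[k]}=k\sum_{j=1}^k\big(\int_{I_j}h\big)1_{I_j}$. Put $\tilde\psi=a-\int_0^1 a f_0$, $V_0=\int_0^1 f_0\tilde\psi^2$, $$\hat\psi=\psi(f_0)+\frac1n\sum_{i=1}^n\tilde\psi(Y_i),\qquad \hat\psi_{[k]}=\psi(f_0)+\frac1n\sum_{i=1}^n\tilde\psi_{[k]}(Y_i).$$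 The prior $\Pi=\Pi_n$ is the law of the random histogram $f=K_n\sum_{j=1}^{K_n}\omega_j1_{I_j}$ (bins with $k=K_n$), where $K_n=2^{p_n}$, $p_n=\lfloor \log(n^{1/3})/\log 2\rfloor$, and $\omega$ has the Dirichlet distribution on the unit simplex of $\mathbb R^{K_n}$ with all weights equal to $n^{-b}$, for some fixed $b>1/6$. For $\alpha\in(0,1]$ the $\alpha$-posterior is $$\Pi_{\alpha}(B\mid Y)=\frac{\int_B\prod_{i=1}^n f(Y_i)^{\alpha}\,d\Pi(f)}{\int\prod_{i=1}^n f(Y_i)^{\alpha}\,d\Pi(f)},$$ and the case $\alpha=1$ is the usual posterior. A data-dependent distribution $Q_Y$ on $\mathbb R$ is said to converge weakly in $P_0$-probability to $Q$ if $d_{BL}(Q_Y,Q)\to0$ in $P_0$-probability as $n\to\infty$, with $d_{BL}$ the bounded Lipschitz distance. **Proposition.** Let $f_0$ be continuously differentiable on $[0,1]$ with $f_0'>\rho$ on $[0,1]$ for some constant $\rho>0$, and let $a$, $\gamma$ and the prior be as above. Then: 1. The posterior distribution (with $\alpha=1$) of $\sqrt n(\psi(f)-\hat\psi_{[K_n]})$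 converges weakly in $P_0$-probability to $\mathcal N(0,V_0)$. Moreover $$\hat\psi_{[K_n]}-\hat\psi=F_0(\tilde\psi_{[K_n]})+o_P(1/\sqrt n),$$ there is $c>0$ with $|\sqrt n\,F_0(\tilde\psi_{[K_n]})|\ge c$ for all $n\ge1$, and $|\sqrt n\,F_0(\tilde\psi_{[K_n]})|\to\infty$ if $\gamma<1/2$. In particular the posterior is biased and the Bernstein–von Mises theorem does not hold: for every centring $T_n=T_n(Y)$ with $T_n=\hat\psi+o_P(1/\sqrt n)$ (for instance $T_n=\hat\psi$), the posterior distribution of $\sqrt n(\psi(f)-T_n)$ does not converge weakly in $P_0$-probability to $\mathcal N(0,V_0)$. 2. For every $x$ with $(1-2\gamma)/3<x<2/3$ and $\alpha_n=n^{-x}$, the $\alpha_n$-posterior distribution of $\sqrt{n\alpha_n}\,(\psi(f)-\hat\psi)$ converges weakly in $P_0$-probability to $\mathcal N(0,V_0)$. -/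

import Mathlib

open Filter Topology MeasureTheory ProbabilityTheory
open scoped ENNReal NNReal

noncomputable section

namespace FracBvM

/-! ### The Haar basis and the representer -/

/-- The Haar mother wavelet: `1` on `[0,1/2)`, `-1` on `[1/2,1)`, `0` elsewhere. -/
def haarMother (x : ℝ) : ℝ :=
  (Set.Ico (0 : ℝ) (1 / 2)).indicator 1 x - (Set.Ico (1 / 2 : ℝ) 1).indicator 1 x

/-- The Haar wavelet `ψ_{l,k}(x) = 2^{l/2} ψ(2^l x - k)`, `l ≥ 0`. -/
def haar (l k : ℕ) (x : ℝ) : ℝ :=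
  (2 : ℝ) ^ ((l : ℝ) / 2) * haarMother (2 ^ l * x - k)

/-- `a(x) = ∑_{l ≥ -1} ∑_k 2^{-l(1/2+γ)} ψ_{l,k}(x)`. The first summand is the level `l = -1`,
which has the single element `ψ_{-1,0} = 1_{[0,1]}`, with coefficient `2^{1/2+γ}`. -/
def haarSeries (γ : ℝ) (x : ℝ) : ℝ :=
  (2 : ℝ) ^ (1 / 2 + γ) * (Set.Icc (0 : ℝ) 1).indicator 1 x +
    ∑' l : ℕ, ∑ k ∈ Finset.range (2 ^ l), (2 : ℝ) ^ (-(l : ℝ) * (1 / 2 + γ)) * haar l k x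

/-! ### Density estimation on `[0,1]` -/

/-- `f` is a probability density on `[0,1]`. -/
def IsDensity (f : ℝ → ℝ) : Prop :=
  (∀ x ∈ Set.Icc (0 : ℝ) 1, 0 ≤ f x) ∧ IntegrableOn f (Set.Icc 0 1) ∧
    ∫ x in Set.Icc (0 : ℝ) 1, f x = 1

/-- The law of `n` i.i.d. observations with density `f` on `[0,1]`. -/
def sampleLaw (f : ℝ → ℝ) (n : ℕ) : Measure (Fin n → ℝ) :=
  Measure.pi fun _ =>
    (volume.restrict (Set.Icc (0 : ℝ) 1)).withDensity fun x => ENNReal.ofReal (f x)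

/-- `F(g) = ∫₀¹ g f`; in particular `integ f a` is the linear functional `ψ(f) = ∫₀¹ a f`. -/
def integ (f g : ℝ → ℝ) : ℝ := ∫ x in Set.Icc (0 : ℝ) 1, g x * f x

/-! ### Histograms and the random histogram prior -/

/-- The `j`-th of the `k` regular bins of `[0,1]` (with `j` counted from `0`). -/
def bin (k : ℕ) (j : Fin k) : Set ℝ := Set.Icc ((j : ℝ) / k) (((j : ℝ) + 1) / k)

/-- The histogram `k ∑_j ω_j 1_{I_j}`. -/
def hist (k : ℕ) (ω : Fin k → ℝ) (x : ℝ) : ℝ :=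
  k * ∑ j, ω j * (bin k j).indicator 1 x

/-- The projection `h_{[k]} = k ∑_j (∫_{I_j} h) 1_{I_j}` of `h` onto histograms with `k` bins. -/
def proj (k : ℕ) (h : ℝ → ℝ) : ℝ → ℝ := hist k fun j => ∫ x in bin k j, h x

/-- The Dirichlet distribution with positive weights `δ`: the law of `G / ∑ G_i`, where the `G_i`
are independent with Gamma distribution of shape `δ_i` and rate `1`. -/
def dirichlet {k : ℕ} (δ : Fin k → ℝ) : Measure (Fin k → ℝ) :=
  (Measure.pi fun j => gammaMeasure (δ j) 1).map fun g j => g j / ∑ i, g i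

/-! ### Fractional posteriors -/

/-- The `α`-posterior for a prior `π` and a likelihood `L`:
`B ↦ ∫_B L^α dπ / ∫ L^α dπ`. -/
def fracPosterior {S : Type*} [MeasurableSpace S] (π : Measure S) (L : S → ℝ) (α : ℝ) :
    Measure S :=
  (∫⁻ s, ENNReal.ofReal (L s ^ α) ∂π)⁻¹ • π.withDensity fun s => ENNReal.ofReal (L s ^ α)

/-- The `α`-posterior distribution, given the data `y`, of `v (ψ(f) - m)`, where `ψ(f) = ∫₀¹ a f`
and the prior on `f` is that of the histogram with `k` bins and Dirichlet distributed heights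
with weights `δ`. Histograms are parametrized by their vector of bin probabilities `ω`. -/
def histPosteriorLaw (a : ℝ → ℝ) {k : ℕ} (δ : Fin k → ℝ) (α : ℝ) {n : ℕ} (y : Fin n → ℝ)
    (v m : ℝ) : Measure ℝ :=
  (fracPosterior (dirichlet δ) (fun ω => ∏ i, hist k ω (y i)) α).map
    fun ω => v * (integ (hist k ω) a - m)

/-! ### Modes of convergence -/

/-- The bounded Lipschitz distance: the supremum of `|∫ g dμ - ∫ g dν|` over the functions `g`
with `‖g‖_Lip + ‖g‖_∞ ≤ 1`. -/
def dBL (μ ν : Measure ℝ) : ℝ≥0∞ :=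
  ⨆ g ∈ {g : ℝ → ℝ | ∃ L M : ℝ≥0, L + M ≤ 1 ∧ LipschitzWith L g ∧ ∀ x, |g x| ≤ M},
    ENNReal.ofReal |∫ x, g x ∂μ - ∫ x, g x ∂ν|

/-- The data-dependent distributions `Q n` converge weakly to `ν` in `P`-probability. -/
def ConvWeaklyInProb (P : ∀ n : ℕ, Measure (Fin n → ℝ)) (Q : ∀ n : ℕ, (Fin n → ℝ) → Measure ℝ)
    (ν : Measure ℝ) : Prop :=
  ∀ ε : ℝ, 0 < ε → Tendsto (fun n => P n {y | ENNReal.ofReal ε ≤ dBL (Q n y) ν}) atTop (𝓝 0)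

/-- `X n = o_P(r n)`. -/
def IsLittleOP (P : ∀ n : ℕ, Measure (Fin n → ℝ)) (X : ∀ n : ℕ, (Fin n → ℝ) → ℝ) (r : ℕ → ℝ) :
    Prop :=
  ∀ ε : ℝ, 0 < ε → Tendsto (fun n => P n {y | ε * r n ≤ |X n y|}) atTop (𝓝 0)

/-! ### Efficient centring and its projected version -/

/-- The efficient influence function `ψ̃ = a - ∫₀¹ a f₀` of `ψ(f) = ∫₀¹ a f` at `f₀`. -/
def influence (f₀ a : ℝ → ℝ) (x : ℝ) : ℝ := a x - integ f₀ a

/-- `ψ(f₀) + n⁻¹ ∑ h(Y_i)`. With `h = ψ̃` this is `ψ̂`, with `h = ψ̃_{[k]}` it is `ψ̂_{[k]}`. -/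
def centring (f₀ a h : ℝ → ℝ) (n : ℕ) (y : Fin n → ℝ) : ℝ :=
  integ f₀ a + (∑ i, h (y i)) / n

/-- The efficient centring `ψ̂`. -/
def psiHat (f₀ a : ℝ → ℝ) (n : ℕ) (y : Fin n → ℝ) : ℝ := centring f₀ a (influence f₀ a) n y

/-- The centring `ψ̂_{[k]}`. -/
def psiHatProj (f₀ a : ℝ → ℝ) (k n : ℕ) (y : Fin n → ℝ) : ℝ :=
  centring f₀ a (proj k (influence f₀ a)) n y

/-- The limit `N(0, V₀)` with `V₀ = ∫₀¹ f₀ ψ̃²`. -/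
def limitLaw (f₀ a : ℝ → ℝ) : Measure ℝ :=
  gaussianReal 0 (integ f₀ fun x => influence f₀ a x ^ 2).toNNReal

/-- The number of bins `K_n = 2^{p_n}` with `p_n = ⌊log(n^{1/3}) / log 2⌋`. -/
def numBins (n : ℕ) : ℕ := 2 ^ ⌊Real.log ((n : ℝ) ^ (1 / 3 : ℝ)) / Real.log 2⌋₊

/-- The `α`-posterior distribution of `v (ψ(f) - m)` for the histogram prior with `K_n` bins and
all Dirichlet weights equal to `n^{-b}`. -/
def posteriorLaw (a : ℝ → ℝ) (b : ℝ) (n : ℕ) (α : ℝ) (y : Fin n → ℝ) (v m : ℝ) : Measure ℝ :=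
  histPosteriorLaw a (fun _ : Fin (numBins n) => (n : ℝ) ^ (-b)) α y v m

end FracBvM

end

noncomputable section

namespace FracBvM

/-! ### Product measures and densities -/

/-! The Dirichlet prior is conjugate even for a tempered likelihood: if `N_j` counts the
observations in bin `j`, the `α`-posterior of the bin probabilities is Dirichlet with weights
`n^{-b} + α N_j` (`fracPosterior_dirichlet`). Off the grid, `ψ(f)` is the average `∑ ω_j a_j` of the
bin means `a_j` of the representer `a`. Writing `ω = G/∑ G_i` with independent Gamma variables gives
`∑ ω_j a_j - m = ∑ (a_j - m) G_j / ∑ G_i`. The numerator has an explicit characteristic function,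
the denominator concentrates at `s = nα`, and a deterministic central limit theorem follows
(`tendsto_dBL_dirichlet`). It is made uniform over the data by contradiction
(`exists_dBL_dirichlet_lt`). The prior only adds total weight `K_n n^{-b}`, which is negligible
against `√(nα_n)` because `b > 1/6` and `x < 2/3`. Thus the posterior is asymptotically normal
around the empirical mean of the bin averages, which is `ψ̂_{[K_n]}`, with variance `V₀/(nα)`.

What remains is the gap between `ψ̂_{[K_n]}` and `ψ̂`. It is the empirical mean of `ψ̃_{[K_n]} -
ψ̃`, a function that tends to zero uniformly off the grid, so by Chebyshev only its mean
`F₀(ψ̃_{[K_n]})` matters at scale `1/√n` (`tendstoZeroInProb_expansion`). Up to a constant, `a` is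
the lacunary series `∑ 2^{-γl} s(2^l x)` of square waves. Averaging over dyadic bins of level `p`
deletes exactly the terms `l ≥ p` (`binAverage_haarSeries`). Since `f₀` increases with slopes
between `ρ > 0` and some `L`, every `-∫ s(2^l x) f₀` is positive and of order `2^{-l}`; nothing
cancels, and the bias is of exact order `K_n^{-(1+γ)} ≍ n^{-(1+γ)/3}`
(`integ_proj_influence_bounds`).

Hence `√n` times the bias is at least of order `n^{(1-2γ)/6}`: bounded away from zero for `γ ≤ 1/2`,
divergent for `γ < 1/2`. A law and its translate by an amount bounded below cannot both approach the
same limit, so the usual posterior fails at any efficient centring (`le_dBL_add_dBL_of_shift`).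
Tempering by `α_n = n^{-x}` widens the posterior to the scale `1/√(nα_n)`, at which the bias
vanishes as soon as `x > (1-2γ)/3`. -/

theorem pi_withDensity_prod {ι : Type*} [Fintype ι] {Ω : ι → Type*}
    [∀ i, MeasurableSpace (Ω i)] (μ : ∀ i, Measure (Ω i)) [∀ i, IsProbabilityMeasure (μ i)]
    (f : ∀ i, Ω i → ℝ≥0∞) (hf : ∀ i, Measurable (f i))
    [∀ i, SigmaFinite ((μ i).withDensity (f i))] :
    (Measure.pi μ).withDensity (fun x => ∏ i, f i (x i)) =
      Measure.pi fun i => (μ i).withDensity (f i) := by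
  refine (Measure.pi_eq fun s hs => ?_).symm
  rw [withDensity_apply _ (MeasurableSet.univ_pi hs),
    ← lintegral_indicator (MeasurableSet.univ_pi hs)]
  have h1 : ∀ x : ∀ i, Ω i, (Set.univ.pi s).indicator (fun x => ∏ i, f i (x i)) x =
      ∏ i, (s i).indicator (f i) (x i) := by
    intro x
    by_cases hx : x ∈ Set.univ.pi s
    · rw [Set.indicator_of_mem hx]
      exact Finset.prod_congr rfl fun i _ => (Set.indicator_of_mem (hx i trivial) _).symm
    · rw [Set.indicator_of_notMem hx]
      simp only [Set.mem_pi, Set.mem_univ, true_implies, not_forall] at hx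
      obtain ⟨i, hi⟩ := hx
      exact (Finset.prod_eq_zero (Finset.mem_univ i) (Set.indicator_of_notMem hi _)).symm
  simp_rw [h1]
  have h2 := lintegral_prod_eq_prod_lintegral_of_indepFun (μ := Measure.pi μ) Finset.univ
    (fun i x => (s i).indicator (f i) (x i))
    (iIndepFun_pi (X := fun i => (s i).indicator (f i))
      fun i => ((hf i).indicator (hs i)).aemeasurable)
    (fun i => ((hf i).indicator (hs i)).comp (measurable_pi_apply i))
  rw [h2]
  refine Finset.prod_congr rfl fun i _ => ?_
  rw [(measurePreserving_eval μ i).lintegral_comp ((hf i).indicator (hs i)),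
    lintegral_indicator (hs i), withDensity_apply _ (hs i)]

theorem pi_smul_measure {ι : Type*} [Fintype ι] {Ω : ι → Type*}
    [∀ i, MeasurableSpace (Ω i)] (μ : ∀ i, Measure (Ω i)) [∀ i, SigmaFinite (μ i)]
    (c : ι → ℝ≥0∞) [∀ i, SigmaFinite (c i • μ i)] :
    Measure.pi (fun i => c i • μ i) = (∏ i, c i) • Measure.pi μ := by
  refine Measure.pi_eq fun s _ => ?_
  simp [Measure.pi_pi, Finset.prod_mul_distrib]

/-! ### The Gamma distribution -/

/-- This tilt is the source of all Gamma computations below: `r = 1` gives the moments and the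
effect of the likelihood, `m = 0` gives the Laplace transform and the change of scale. -/
theorem gammaMeasure_withDensity {a m r : ℝ} (ha : 0 < a) (ham : 0 < a + m) (hr : 0 < r) :
    (gammaMeasure a 1).withDensity (fun x => ENNReal.ofReal (x ^ m * Real.exp ((1 - r) * x))) =
      ENNReal.ofReal (Real.Gamma (a + m) / Real.Gamma a * r ^ (-(a + m))) •
        gammaMeasure (a + m) r := by
  unfold gammaMeasure
  have hm : ∀ b s, Measurable (gammaPDF b s) := fun b s =>
    (measurable_gammaPDFReal b s).ennreal_ofReal
  rw [← withDensity_mul _ (hm _ _) (by fun_prop), ← withDensity_smul _ (hm _ _)]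
  refine withDensity_congr_ae ?_
  have h0 : ∀ᵐ x : ℝ, x ≠ 0 := by simp [ae_iff]
  filter_upwards [h0] with x hx
  have hG := Real.Gamma_pos_of_pos ha
  have hG' := Real.Gamma_pos_of_pos ham
  simp only [Pi.mul_apply, Pi.smul_apply, smul_eq_mul, gammaPDF]
  rw [← ENNReal.ofReal_mul (gammaPDFReal_nonneg ha one_pos x), ← ENNReal.ofReal_mul (by positivity)]
  congr 1
  unfold gammaPDFReal
  split_ifs with h
  · have hx : 0 < x := lt_of_le_of_ne h hx.symm
    have e1 : x ^ (a + m - 1) = x ^ (a - 1) * x ^ m := by rw [← Real.rpow_add hx]; ring_nf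
    have e2 : r ^ (-(a + m)) * r ^ (a + m) = 1 := by rw [← Real.rpow_add hr]; simp
    have e3 : Real.exp (-(r * x)) = Real.exp (-(1 * x)) * Real.exp ((1 - r) * x) := by
      rw [← Real.exp_add]; ring_nf
    rw [e1, e3, Real.one_rpow]
    field_simp
    linear_combination -e2
  · simp

theorem gammaMeasure_map_div {a r : ℝ} (hr : 0 < r) :
    (gammaMeasure a 1).map (fun x => x / r) = gammaMeasure a r := by
  ext s hs
  have hm : ∀ b s, Measurable (gammaPDF b s) := fun b s =>
    (measurable_gammaPDFReal b s).ennreal_ofReal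
  have hdiv : Measurable fun x : ℝ => x / r := by fun_prop
  rw [Measure.map_apply hdiv hs]
  unfold gammaMeasure
  rw [withDensity_apply _ hs, withDensity_apply _ (hdiv hs), ← lintegral_indicator hs,
    ← lintegral_indicator (hdiv hs)]
  have hr' : r⁻¹ ≠ 0 := by positivity
  have hmi : Measurable fun x => s.indicator (gammaPDF a r) (r⁻¹ * x) :=
    ((hm a r).indicator hs).comp (measurable_const_mul r⁻¹)
  conv_rhs => rw [← Real.smul_map_volume_mul_left hr']
  rw [lintegral_smul_measure, lintegral_map ((hm _ _).indicator hs) (measurable_const_mul r⁻¹),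
    smul_eq_mul, ← lintegral_const_mul _ hmi]
  refine lintegral_congr fun x => ?_
  have e0 : r⁻¹ * x = x / r := by rw [div_eq_inv_mul]
  rw [e0]
  by_cases hx : x / r ∈ s
  · rw [Set.indicator_of_mem hx, Set.indicator_of_mem (show x ∈ (fun x => x / r) ⁻¹' s from hx)]
    unfold gammaPDF
    rw [← ENNReal.ofReal_mul (abs_nonneg _), abs_of_pos (by positivity)]
    congr 1
    unfold gammaPDFReal
    by_cases h : 0 ≤ x
    · rw [if_pos h, if_pos (by positivity), Real.div_rpow h hr.le, Real.rpow_sub_one hr.ne']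
      rw [Real.one_rpow]
      have : r * (x / r) = 1 * x := by field_simp
      rw [this]
      field_simp
    · rw [if_neg h, if_neg]
      · simp
      · rw [not_le] at *; exact div_neg_of_neg_of_pos h hr
  · rw [Set.indicator_of_notMem hx, Set.indicator_of_notMem
      (show x ∉ (fun x => x / r) ⁻¹' s from hx), mul_zero]

theorem ae_pos_gammaMeasure (a r : ℝ) : ∀ᵐ x ∂gammaMeasure a r, 0 < x := by
  have hm : Measurable (gammaPDF a r) := (measurable_gammaPDFReal a r).ennreal_ofReal
  unfold gammaMeasure
  rw [ae_withDensity_iff hm]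
  have h0 : ∀ᵐ x : ℝ, x ≠ 0 := by simp [ae_iff]
  filter_upwards [h0] with x hx h
  by_contra hneg
  exact h (gammaPDF_of_neg (lt_of_le_of_ne (not_lt.mp hneg) hx))

theorem lintegral_rpow_mul_exp_gammaMeasure {a m r : ℝ} (ha : 0 < a) (ham : 0 < a + m)
    (hr : 0 < r) :
    ∫⁻ x, ENNReal.ofReal (x ^ m * Real.exp ((1 - r) * x)) ∂gammaMeasure a 1 =
      ENNReal.ofReal (Real.Gamma (a + m) / Real.Gamma a * r ^ (-(a + m))) := by
  have := isProbabilityMeasure_gammaMeasure ham hr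
  have h := congrArg (fun μ : Measure ℝ => μ Set.univ) (gammaMeasure_withDensity ha ham hr)
  simpa [withDensity_apply] using h

theorem integrable_rpow_mul_exp_gammaMeasure {a m r : ℝ} (ha : 0 < a) (ham : 0 < a + m)
    (hr : 0 < r) :
    Integrable (fun x => x ^ m * Real.exp ((1 - r) * x)) (gammaMeasure a 1) := by
  refine ⟨by fun_prop, ?_⟩
  rw [hasFiniteIntegral_iff_ofReal, lintegral_rpow_mul_exp_gammaMeasure ha ham hr]
  · exact ENNReal.ofReal_lt_top
  · filter_upwards [ae_pos_gammaMeasure a 1] with x hx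
    positivity

theorem integral_rpow_mul_exp_gammaMeasure {a m r : ℝ} (ha : 0 < a) (ham : 0 < a + m)
    (hr : 0 < r) :
    ∫ x, x ^ m * Real.exp ((1 - r) * x) ∂gammaMeasure a 1 =
      Real.Gamma (a + m) / Real.Gamma a * r ^ (-(a + m)) := by
  have hG := Real.Gamma_pos_of_pos ha
  have hG' := Real.Gamma_pos_of_pos ham
  rw [integral_eq_lintegral_of_nonneg_ae _ (by fun_prop),
    lintegral_rpow_mul_exp_gammaMeasure ha ham hr, ENNReal.toReal_ofReal (by positivity)]
  filter_upwards [ae_pos_gammaMeasure a 1] with x hx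
  simp only [Pi.zero_apply]
  positivity

theorem integral_id_gammaMeasure {a : ℝ} (ha : 0 < a) : ∫ x, x ∂gammaMeasure a 1 = a := by
  have h := integral_rpow_mul_exp_gammaMeasure (m := 1) ha (by positivity) one_pos
  have hG := Real.Gamma_pos_of_pos ha
  rw [Real.Gamma_add_one ha.ne'] at h
  simpa [hG.ne'] using h

theorem integral_sq_gammaMeasure {a : ℝ} (ha : 0 < a) :
    ∫ x, x ^ 2 ∂gammaMeasure a 1 = (a + 1) * a := by
  have h := integral_rpow_mul_exp_gammaMeasure (m := 2) ha (by positivity) one_pos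
  have hG := Real.Gamma_pos_of_pos ha
  have e : a + 2 = (a + 1) + 1 := by ring
  rw [e, Real.Gamma_add_one (by positivity), Real.Gamma_add_one ha.ne'] at h
  simp only [sub_self, zero_mul, Real.exp_zero, mul_one, Real.one_rpow, Real.rpow_two] at h
  rw [h]
  field_simp

theorem memLp_id_gammaMeasure {a : ℝ} (ha : 0 < a) :
    MemLp (fun x : ℝ => x) 2 (gammaMeasure a 1) := by
  rw [memLp_two_iff_integrable_sq (by fun_prop)]
  have h := integrable_rpow_mul_exp_gammaMeasure (m := 2) ha (by positivity) one_pos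
  simpa using h

theorem variance_id_gammaMeasure {a : ℝ} (ha : 0 < a) :
    Var[fun x => x; gammaMeasure a 1] = a := by
  have := isProbabilityMeasure_gammaMeasure ha one_pos
  rw [variance_eq_sub (memLp_id_gammaMeasure ha)]
  simp only [Pi.pow_apply]
  rw [integral_sq_gammaMeasure ha, integral_id_gammaMeasure ha]
  ring

theorem mgf_gammaMeasure {a u : ℝ} (ha : 0 < a) (hu : u < 1) :
    mgf id (gammaMeasure a 1) u = (1 - u) ^ (-a) := by
  have h := integral_rpow_mul_exp_gammaMeasure (m := 0) ha (by simpa) (sub_pos.mpr hu)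
  have hG := Real.Gamma_pos_of_pos ha
  simpa [mgf, hG.ne'] using h

theorem Iio_one_subset_integrableExpSet_gammaMeasure {a : ℝ} (ha : 0 < a) :
    Set.Iio 1 ⊆ integrableExpSet id (gammaMeasure a 1) := by
  intro u hu
  have h := integrable_rpow_mul_exp_gammaMeasure (m := 0) ha (by simpa) (sub_pos.mpr hu)
  simpa [integrableExpSet] using h

/-- Analytic continuation: both sides are holomorphic on the half-plane `Re z < 1` and agree on its
real points, where the real moment generating function is known. -/
theorem complexMGF_gammaMeasure {a : ℝ} (ha : 0 < a) {z : ℂ} (hz : z.re < 1) :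
    complexMGF id (gammaMeasure a 1) z = (1 - z) ^ (-(a : ℂ)) := by
  let U : Set ℂ := {z | z.re < 1}
  have hU : IsOpen U := isOpen_lt Complex.continuous_re continuous_const
  have hUc : IsPreconnected U := (convex_halfSpace_re_lt 1).isPreconnected
  have hf : AnalyticOnNhd ℂ (complexMGF id (gammaMeasure a 1)) U := by
    refine analyticOnNhd_complexMGF.mono fun w hw => ?_
    exact interior_maximal (Iio_one_subset_integrableExpSet_gammaMeasure ha) isOpen_Iio hw
  have hg : AnalyticOnNhd ℂ (fun w : ℂ => (1 - w) ^ (-(a : ℂ))) U := by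
    refine DifferentiableOn.analyticOnNhd (fun w hw => ?_) hU
    refine DifferentiableAt.differentiableWithinAt ?_
    refine DifferentiableAt.cpow_const (by fun_prop) ?_
    left
    simp only [Complex.sub_re, Complex.one_re]
    have : w.re < 1 := hw
    linarith
  refine hf.eqOn_of_preconnected_of_frequently_eq hg hUc (z₀ := 0) (by simp [U]) ?_ hz
  have h1 : ∀ x : ℝ, x < 1 → complexMGF id (gammaMeasure a 1) (x : ℂ) =
      (1 - (x : ℂ)) ^ (-(a : ℂ)) := by
    intro x hx
    rw [complexMGF_ofReal, mgf_gammaMeasure ha hx, Complex.ofReal_cpow (by linarith)]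
    push_cast
    rfl
  -- The shift by `2` keeps the points `1/(n+2)` nonzero and below `1` for every `n`, including `n =
  -- 0`.
  have h2 : Tendsto (fun n : ℕ => (((1 / ((n : ℝ) + 2) : ℝ)) : ℂ)) atTop (𝓝[≠] 0) := by
    refine tendsto_nhdsWithin_iff.mpr ⟨?_, Eventually.of_forall fun n => ?_⟩
    · have h3 : Tendsto (fun n : ℕ => 1 / ((n : ℝ) + 2)) atTop (𝓝 0) :=
        tendsto_const_nhds.div_atTop (tendsto_atTop_add_const_right _ _ tendsto_natCast_atTop_atTop)
      have := (Complex.continuous_ofReal.tendsto 0).comp h3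
      simpa only [Function.comp_def, Complex.ofReal_zero] using this
    · simp only [Set.mem_compl_iff, Set.mem_singleton_iff, Complex.ofReal_eq_zero]
      positivity
  refine h2.frequently (Frequently.of_forall fun n => h1 _ ?_)
  rw [div_lt_one (by positivity)]
  have : (0 : ℝ) ≤ n := Nat.cast_nonneg n
  linarith

theorem charFun_gammaMeasure {a : ℝ} (ha : 0 < a) (t : ℝ) :
    charFun (gammaMeasure a 1) t = (1 - t * Complex.I) ^ (-(a : ℂ)) := by
  rw [← complexMGF_id_mul_I, complexMGF_gammaMeasure ha (by simp)]

/-! ### The Dirichlet distribution and its conjugacy -/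

/-- The law of independent standard Gamma variables with shapes `δ`. -/
def gammaPi {k : ℕ} (δ : Fin k → ℝ) : Measure (Fin k → ℝ) :=
  Measure.pi fun j => gammaMeasure (δ j) 1

theorem isProbabilityMeasure_gammaPi {k : ℕ} {δ : Fin k → ℝ} (hδ : ∀ j, 0 < δ j) :
    IsProbabilityMeasure (gammaPi δ) := by
  have := fun j => isProbabilityMeasure_gammaMeasure (hδ j) one_pos
  unfold gammaPi
  infer_instance

theorem ae_pos_gammaPi {k : ℕ} {δ : Fin k → ℝ} (hδ : ∀ j, 0 < δ j) :
    ∀ᵐ g ∂gammaPi δ, ∀ j, 0 < g j := by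
  have := fun j => isProbabilityMeasure_gammaMeasure (hδ j) one_pos
  rw [ae_all_iff]
  intro j
  exact (measurePreserving_eval (fun j => gammaMeasure (δ j) 1) j).quasiMeasurePreserving.ae
    (ae_pos_gammaMeasure (δ j) 1)

/-- Division of a vector by the sum of its coordinates. -/
def normalize {k : ℕ} (g : Fin k → ℝ) : Fin k → ℝ := fun j => g j / ∑ i, g i

@[fun_prop]
theorem measurable_normalize {k : ℕ} : Measurable (normalize (k := k)) := by
  unfold normalize
  fun_prop

theorem dirichlet_eq_map {k : ℕ} (δ : Fin k → ℝ) :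
    dirichlet δ = (gammaPi δ).map normalize := rfl

theorem isProbabilityMeasure_dirichlet {k : ℕ} {δ : Fin k → ℝ} (hδ : ∀ j, 0 < δ j) :
    IsProbabilityMeasure (dirichlet δ) := by
  have := isProbabilityMeasure_gammaPi hδ
  rw [dirichlet_eq_map]
  exact Measure.isProbabilityMeasure_map measurable_normalize.aemeasurable

theorem normalize_div {k : ℕ} (g : Fin k → ℝ) {r : ℝ} (hr : 0 < r) :
    normalize (fun j => g j / r) = normalize g := by
  funext j
  simp only [normalize]
  rw [← Finset.sum_div, div_div_div_cancel_right₀ hr.ne']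

theorem gammaPi_withDensity {k : ℕ} {δ m : Fin k → ℝ} {r : ℝ} (hδ : ∀ j, 0 < δ j)
    (hm : ∀ j, 0 < δ j + m j) (hr : 0 < r) :
    (gammaPi δ).withDensity
        (fun g => ∏ j, ENNReal.ofReal (g j ^ m j * Real.exp ((1 - r) * g j))) =
      (∏ j, ENNReal.ofReal (Real.Gamma (δ j + m j) / Real.Gamma (δ j) * r ^ (-(δ j + m j)))) •
        Measure.pi fun j => gammaMeasure (δ j + m j) r := by
  have h1 := fun j => isProbabilityMeasure_gammaMeasure (hδ j) one_pos
  have h2 := fun j => isProbabilityMeasure_gammaMeasure (hm j) hr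
  have h3 : ∀ j, IsFiniteMeasure (ENNReal.ofReal
      (Real.Gamma (δ j + m j) / Real.Gamma (δ j) * r ^ (-(δ j + m j))) •
        gammaMeasure (δ j + m j) r) := fun j => Measure.smul_finite _ ENNReal.ofReal_ne_top
  have h4 := fun j => gammaMeasure_withDensity (hδ j) (hm j) hr
  rw [← pi_smul_measure]
  simp_rw [← h4]
  have h5 : ∀ j, SigmaFinite ((gammaMeasure (δ j) 1).withDensity
      fun x => ENNReal.ofReal (x ^ m j * Real.exp ((1 - r) * x))) := by
    intro j
    rw [h4]
    infer_instance
  exact pi_withDensity_prod (fun j => gammaMeasure (δ j) 1)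
    (fun j x => ENNReal.ofReal (x ^ m j * Real.exp ((1 - r) * x))) (fun j => by fun_prop)

/-- An exponential tilt in the total mass turns each coordinate into a Gamma variable of rate `r`,
which is the original one divided by `r`. -/
theorem lintegral_exp_gammaPi {k : ℕ} {δ : Fin k → ℝ} {r : ℝ} (hδ : ∀ j, 0 < δ j) (hr : 0 < r)
    {F : (Fin k → ℝ) → ℝ≥0∞} (hF : Measurable F) :
    ∫⁻ g, ENNReal.ofReal (Real.exp ((1 - r) * ∑ j, g j)) * F g ∂gammaPi δ =
      ENNReal.ofReal (r ^ (-∑ j, δ j)) * ∫⁻ g, F (fun j => g j / r) ∂gammaPi δ := by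
  have h1 := fun j => isProbabilityMeasure_gammaMeasure (hδ j) one_pos
  have h2 := fun j => isProbabilityMeasure_gammaMeasure (hδ j) hr
  have h := gammaPi_withDensity (m := fun _ => 0) hδ (by simpa using hδ) hr
  have e1 : (fun g : Fin k → ℝ => ENNReal.ofReal (Real.exp ((1 - r) * ∑ j, g j))) =
      fun g => ∏ j, ENNReal.ofReal (g j ^ (0 : ℝ) * Real.exp ((1 - r) * g j)) := by
    funext g
    rw [← ENNReal.ofReal_prod_of_nonneg (fun j _ => by positivity), Finset.mul_sum, Real.exp_sum]
    simp
  have e2 : ∏ j, ENNReal.ofReal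
      (Real.Gamma (δ j + 0) / Real.Gamma (δ j) * r ^ (-(δ j + 0))) =
      ENNReal.ofReal (r ^ (-∑ j, δ j)) := by
    rw [← Finset.sum_neg_distrib, Real.rpow_sum_of_pos hr,
      ENNReal.ofReal_prod_of_nonneg (fun j _ => by positivity)]
    refine Finset.prod_congr rfl fun j _ => ?_
    rw [add_zero, div_self (Real.Gamma_pos_of_pos (hδ j)).ne', one_mul]
  have e3 : (Measure.pi fun j => gammaMeasure (δ j + 0) r) =
      (gammaPi δ).map fun g j => g j / r := by
    have h3 : ∀ j, SigmaFinite ((gammaMeasure (δ j) 1).map fun x => x / r) := by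
      intro j
      rw [gammaMeasure_map_div hr]
      infer_instance
    unfold gammaPi
    rw [Measure.pi_map_pi (f := fun _ x => x / r) (fun j => by fun_prop)]
    simp_rw [gammaMeasure_map_div hr, add_zero]
  rw [e2, e3, ← e1] at h
  have h6 := congrArg (fun μ => ∫⁻ g, F g ∂μ) h
  rw [lintegral_withDensity_eq_lintegral_mul _ (by fun_prop) hF, lintegral_smul_measure,
    lintegral_map hF (by fun_prop)] at h6
  simpa using h6

/-- A substitute for the independence of `g/∑ g` and `∑ g`, avoiding a change of variables. With `S
= ∑ g`, the power `S^{-M}` is the mean of `e^{(1-S)u}` over `u` with the Gamma law of shape `M`. For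
each `u` the factor `e^{-uS}` is an exponential tilt, hence a rescaling by `1 + u`, and this leaves
the scale invariant `F` unchanged. The constant `C` may be infinite here. -/
theorem exists_lintegral_rpow_sum_gammaPi {k : ℕ} [NeZero k] {δ : Fin k → ℝ} {M : ℝ}
    (hδ : ∀ j, 0 < δ j) (hM : 0 < M) :
    ∃ C : ℝ≥0∞, ∀ F : (Fin k → ℝ) → ℝ≥0∞, Measurable F →
      (∀ g r, 0 < r → F (fun j => g j / r) = F g) →
      ∫⁻ g, ENNReal.ofReal ((∑ j, g j) ^ (-M)) * F g ∂gammaPi δ = C * ∫⁻ g, F g ∂gammaPi δ := by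
  have := isProbabilityMeasure_gammaPi hδ
  have := isProbabilityMeasure_gammaMeasure hM one_pos
  refine ⟨∫⁻ u, ENNReal.ofReal (Real.exp u * (1 + u) ^ (-∑ j, δ j)) ∂gammaMeasure M 1,
    fun F hF hF0 => ?_⟩
  have e1 : ∫⁻ g, ENNReal.ofReal ((∑ j, g j) ^ (-M)) * F g ∂gammaPi δ =
      ∫⁻ g, ∫⁻ u, ENNReal.ofReal (Real.exp ((1 - ∑ j, g j) * u)) * F g ∂gammaMeasure M 1
        ∂gammaPi δ := by
    refine lintegral_congr_ae ?_
    filter_upwards [ae_pos_gammaPi hδ] with g hg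
    have hS : 0 < ∑ j, g j := Finset.sum_pos (fun j _ => hg j) Finset.univ_nonempty
    rw [lintegral_mul_const _ (by fun_prop)]
    have h := lintegral_rpow_mul_exp_gammaMeasure (m := 0) hM (by simpa using hM) hS
    simp only [Real.rpow_zero, one_mul, add_zero, div_self (Real.Gamma_pos_of_pos hM).ne'] at h
    rw [h]
  rw [e1, lintegral_lintegral_swap (by fun_prop), ← lintegral_mul_const _ (by fun_prop)]
  refine lintegral_congr_ae ?_
  filter_upwards [ae_pos_gammaMeasure M 1] with u hu
  have h := lintegral_exp_gammaPi (r := 1 + u) hδ (by positivity) hF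
  have e2 : ∀ g : Fin k → ℝ, F (fun j => g j / (1 + u)) = F g := fun g =>
    hF0 g _ (by positivity)
  simp_rw [e2] at h
  rw [ENNReal.ofReal_mul (by positivity), mul_assoc, ← h, ← lintegral_const_mul _ (by fun_prop)]
  refine lintegral_congr fun g => ?_
  rw [← mul_assoc, ← ENNReal.ofReal_mul (by positivity), ← Real.exp_add]
  ring_nf

/-- The number of observations allocated to the bin `j`. -/
def count {n k : ℕ} (J : Fin n → Fin k) (j : Fin k) : ℕ :=
  (Finset.univ.filter fun i => J i = j).card

theorem sum_count_mul {n k : ℕ} (J : Fin n → Fin k) (φ : Fin k → ℝ) :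
    ∑ j, (count J j : ℝ) * φ j = ∑ i, φ (J i) := by
  rw [← Finset.sum_fiberwise Finset.univ J]
  refine Finset.sum_congr rfl fun j _ => ?_
  rw [Finset.sum_congr rfl (g := fun _ => φ j), Finset.sum_const, nsmul_eq_mul, count]
  intro i hi
  rw [(Finset.mem_filter.mp hi).2]

theorem prod_rpow_count {n k : ℕ} (J : Fin n → Fin k) (α : ℝ) {g : Fin k → ℝ}
    (hg : ∀ j, 0 < g j) : ∏ j, g j ^ (α * count J j) = ∏ i, g (J i) ^ α := by
  rw [← Finset.prod_fiberwise Finset.univ J]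
  refine Finset.prod_congr rfl fun j _ => ?_
  rw [Finset.prod_congr rfl (g := fun _ => g j ^ α), Finset.prod_const,
    Real.rpow_mul (hg j).le, Real.rpow_natCast, count]
  intro i hi
  rw [(Finset.mem_filter.mp hi).2]

/-- Conjugacy. At `ω = g/S` the tempered likelihood is a constant times `∏ g_j^{α N_j}` times
`S^{-αn}`. The product shifts the Gamma shapes; the power of `S` only contributes a constant,
because events about `ω` are scale invariant in `g`. -/
theorem fracPosterior_dirichlet {n k : ℕ} (hn : 0 < n) (hk : 0 < k) (J : Fin n → Fin k)
    {δ : Fin k → ℝ} (hδ : ∀ j, 0 < δ j) {α : ℝ} (hα : 0 < α) {c : ℝ} (hc : 0 < c) :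
    fracPosterior (dirichlet δ) (fun ω => ∏ i, c * ω (J i)) α =
      dirichlet fun j => δ j + α * count J j := by
  have : NeZero k := ⟨hk.ne'⟩
  have hβ : ∀ j, 0 < δ j + α * count J j := fun j => by have := hδ j; positivity
  have hD := isProbabilityMeasure_dirichlet hδ
  have hD' := isProbabilityMeasure_dirichlet hβ
  have hM : 0 < α * n := by positivity
  obtain ⟨C, hC⟩ := exists_lintegral_rpow_sum_gammaPi hβ hM
  set L : (Fin k → ℝ) → ℝ := fun ω => ∏ i, c * ω (J i) with hL
  have hLm : Measurable L := by fun_prop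
  have hLm' : Measurable fun ω => ENNReal.ofReal (L ω ^ α) := by fun_prop
  have hsum : ∀ g : Fin k → ℝ, (∀ j, 0 < g j) → 0 < ∑ j, g j := fun g hg =>
    Finset.sum_pos (fun j _ => hg j) Finset.univ_nonempty
  have htilt := gammaPi_withDensity (m := fun j => α * count J j) hδ hβ one_pos
  set κ₀ : ℝ≥0∞ := ∏ j, ENNReal.ofReal (Real.Gamma (δ j + α * count J j) / Real.Gamma (δ j) *
    (1 : ℝ) ^ (-(δ j + α * count J j))) with hκ₀
  have hLg : ∀ g : Fin k → ℝ, (∀ j, 0 < g j) → ENNReal.ofReal (L (normalize g) ^ α) =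
      ENNReal.ofReal (c ^ (α * n)) * ((∏ j, ENNReal.ofReal
        (g j ^ (α * count J j) * Real.exp ((1 - 1) * g j))) *
          ENNReal.ofReal ((∑ j, g j) ^ (-(α * n)))) := by
    intro g hg
    have hS := hsum g hg
    rw [← ENNReal.ofReal_prod_of_nonneg (fun j _ => by have := hg j; positivity),
      ← ENNReal.ofReal_mul (Finset.prod_nonneg fun j _ => by have := hg j; positivity),
      ← ENNReal.ofReal_mul (by positivity)]
    congr 1
    simp only [sub_self, zero_mul, Real.exp_zero, mul_one]
    rw [prod_rpow_count J α hg, hL]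
    simp only [normalize]
    rw [← Real.finsetProd_rpow _ _ (fun i _ => by have := hg (J i); positivity)]
    have : ∀ i, (c * (g (J i) / ∑ i, g i)) ^ α =
        (c ^ α * (∑ i, g i) ^ (-α)) * g (J i) ^ α := by
      intro i
      rw [Real.mul_rpow hc.le (by have := hg (J i); positivity),
        Real.div_rpow (hg (J i)).le hS.le, Real.rpow_neg hS.le]
      ring
    simp_rw [this]
    rw [Finset.prod_mul_distrib, Finset.prod_const, Finset.card_univ, Fintype.card_fin, mul_pow,
      ← Real.rpow_natCast, ← Real.rpow_natCast, ← Real.rpow_mul hc.le, ← Real.rpow_mul hS.le]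
    ring_nf
  have hmain : (dirichlet δ).withDensity (fun ω => ENNReal.ofReal (L ω ^ α)) =
      (ENNReal.ofReal (c ^ (α * n)) * (κ₀ * C)) • dirichlet fun j => δ j + α * count J j := by
    ext B hB
    have hBm : Measurable (B.indicator (1 : (Fin k → ℝ) → ℝ≥0∞)) := measurable_one.indicator hB
    rw [withDensity_apply _ hB, ← lintegral_indicator hB, dirichlet_eq_map,
      lintegral_map (hLm'.indicator hB) measurable_normalize]
    have e1 : ∫⁻ g, B.indicator (fun ω => ENNReal.ofReal (L ω ^ α)) (normalize g) ∂gammaPi δ =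
        ∫⁻ g, ENNReal.ofReal (c ^ (α * n)) * ((∏ j, ENNReal.ofReal
        (g j ^ (α * count J j) * Real.exp ((1 - 1) * g j))) *
          (ENNReal.ofReal ((∑ j, g j) ^ (-(α * n))) * B.indicator 1 (normalize g)))
            ∂gammaPi δ := by
      refine lintegral_congr_ae ?_
      filter_upwards [ae_pos_gammaPi hδ] with g hg
      by_cases hgB : normalize g ∈ B
      · rw [Set.indicator_of_mem hgB, Set.indicator_of_mem hgB, hLg g hg]
        simp
      · rw [Set.indicator_of_notMem hgB, Set.indicator_of_notMem hgB]
        simp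
    have hm1 : Measurable fun g : Fin k → ℝ => ENNReal.ofReal ((∑ j, g j) ^ (-(α * n))) *
        B.indicator (1 : (Fin k → ℝ) → ℝ≥0∞) (normalize g) :=
      (by fun_prop : Measurable fun g : Fin k → ℝ =>
        ENNReal.ofReal ((∑ j, g j) ^ (-(α * n)))).mul (hBm.comp measurable_normalize)
    have hm2 : Measurable fun g : Fin k → ℝ => ∏ j, ENNReal.ofReal
        (g j ^ (α * count J j) * Real.exp ((1 - 1) * g j)) := by fun_prop
    rw [e1, lintegral_const_mul' _ _ ENNReal.ofReal_ne_top]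
    have e2 := lintegral_withDensity_eq_lintegral_mul (gammaPi δ) hm2 hm1
    simp only [Pi.mul_apply] at e2
    rw [← e2, htilt, lintegral_smul_measure]
    have e3 := hC (fun g => B.indicator 1 (normalize g)) (hBm.comp measurable_normalize)
      (fun g r hr => by rw [normalize_div g hr])
    unfold gammaPi at e3
    rw [e3]
    have e4 : ∫⁻ g, B.indicator (1 : (Fin k → ℝ) → ℝ≥0∞) (normalize g)
        ∂(Measure.pi fun j => gammaMeasure (δ j + α * count J j) 1) =
        dirichlet (fun j => δ j + α * count J j) B := by
      rw [dirichlet_eq_map, ← lintegral_map hBm measurable_normalize, lintegral_indicator_one hB]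
      rfl
    rw [e4]
    simp only [smul_eq_mul, Measure.smul_apply]
    ring
  set κ := ENNReal.ofReal (c ^ (α * n)) * (κ₀ * C) with hκ
  have hZ : ∫⁻ ω, ENNReal.ofReal (L ω ^ α) ∂dirichlet δ = κ := by
    have h := congrArg (fun μ : Measure (Fin k → ℝ) => μ Set.univ) hmain
    simpa [withDensity_apply] using h
  -- The normalising constant is never evaluated. That it is neither `0` nor `∞` follows from the
  -- likelihood taking values in `(0, c ^ n]` almost surely under the prior.
  have hsupp : ∀ᵐ ω ∂dirichlet δ, ∀ j, 0 < ω j ∧ ω j ≤ 1 := by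
    rw [ae_all_iff]
    intro j
    have hms : MeasurableSet {ω : Fin k → ℝ | 0 < ω j ∧ ω j ≤ 1} :=
      (measurableSet_lt measurable_const (measurable_pi_apply j)).inter
        (measurableSet_le (measurable_pi_apply j) measurable_const)
    rw [dirichlet_eq_map, ae_map_iff measurable_normalize.aemeasurable hms]
    filter_upwards [ae_pos_gammaPi hδ] with g hg
    have hS := hsum g hg
    exact ⟨div_pos (hg j) hS, (div_le_one hS).mpr
      (Finset.single_le_sum (fun i _ => (hg i).le) (Finset.mem_univ j))⟩
  have hκ0 : κ ≠ 0 := by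
    rw [← hZ, Ne, lintegral_eq_zero_iff hLm']
    intro h0
    have h1 : ∀ᵐ ω ∂dirichlet δ, False := by
      filter_upwards [hsupp, h0] with ω hω h0
      have hLpos : 0 < L ω := Finset.prod_pos fun i _ => mul_pos hc (hω (J i)).1
      have : 0 < L ω ^ α := by positivity
      simp only [Pi.zero_apply, ENNReal.ofReal_eq_zero] at h0
      linarith
    simp only [ae_iff, not_false_eq_true, Set.ofPred_true, measure_univ, one_ne_zero] at h1
  have hκtop : κ ≠ ∞ := by
    rw [← hZ]
    refine ne_of_lt (lt_of_le_of_lt (b := ∫⁻ _, ENNReal.ofReal ((c ^ n) ^ α) ∂dirichlet δ)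
      (lintegral_mono_ae ?_) ?_)
    · filter_upwards [hsupp] with ω hω
      refine ENNReal.ofReal_le_ofReal (Real.rpow_le_rpow
        (Finset.prod_nonneg fun i _ => mul_nonneg hc.le (hω (J i)).1.le) ?_ hα.le)
      calc L ω ≤ ∏ _i : Fin n, c := Finset.prod_le_prod
            (fun i _ => mul_nonneg hc.le (hω (J i)).1.le)
            (fun i _ => mul_le_of_le_one_right hc.le (hω (J i)).2)
        _ = c ^ n := by simp
    · simp
  unfold fracPosterior
  rw [hZ, hmain, smul_smul, ENNReal.inv_mul_cancel hκ0 hκtop, one_smul]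

/-! ### Weak convergence and the bounded Lipschitz distance -/

/-- Layer-cake comparison: the superlevel sets of `g` under `μ` are compared with their
`ε`-thickenings under `ν`, and the Lipschitz bound places each thickening in a superlevel set of `g
+ L * ε`. The layer-cake formula needs nonnegative functions, hence the shift of `g` by `M`. -/
theorem integral_sub_le_of_levyProkhorovEDist_lt {μ ν : Measure ℝ} [IsProbabilityMeasure μ]
    [IsProbabilityMeasure ν] {ε : ℝ} (hε : 0 < ε)
    (h : levyProkhorovEDist μ ν < ENNReal.ofReal ε) {g : ℝ → ℝ} {L M : ℝ≥0} (hLM : L + M ≤ 1)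
    (hg : LipschitzWith L g) (hM : ∀ x, |g x| ≤ M) :
    ∫ x, g x ∂μ - ∫ x, g x ∂ν ≤ 3 * ε := by
  have hLM' : (L : ℝ) + M ≤ 1 := by exact_mod_cast hLM
  have hL0 : (0 : ℝ) ≤ L := L.2
  have hM0 : (0 : ℝ) ≤ M := M.2
  have hgi : ∀ (ρ : Measure ℝ) [IsProbabilityMeasure ρ], Integrable g ρ := fun ρ _ =>
    Integrable.of_bound hg.continuous.aestronglyMeasurable M (ae_of_all _ hM)
  let mk : ℝ → (ℝ → ℝ) := fun q x => g x + q
  have hb : ∀ q : ℝ, 0 ≤ q → ∀ x, |g x + q| ≤ M + q := fun q hq x =>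
    (abs_add_le _ _).trans (by rw [abs_of_nonneg hq]; have := hM x; linarith)
  let f : BoundedContinuousFunction ℝ ℝ := BoundedContinuousFunction.ofNormedAddCommGroup
    (fun x => g x + M) (hg.continuous.add continuous_const) (M + M) (hb M hM0)
  -- The extra `L * ε` makes `{t ≤ f'}` contain the `ε`-thickening of `{t ≤ f}`.
  let f' : BoundedContinuousFunction ℝ ℝ := BoundedContinuousFunction.ofNormedAddCommGroup
    (fun x => g x + (M + L * ε)) (hg.continuous.add continuous_const) (M + (M + L * ε))
    (hb _ (by positivity))
  have hf0 : ∀ x, 0 ≤ f x := fun x => by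
    have := (abs_le.mp (hM x)).1
    change 0 ≤ g x + M
    linarith
  have hf'0 : ∀ x, 0 ≤ f' x := fun x => by
    have := (abs_le.mp (hM x)).1
    have : 0 ≤ L * ε := by positivity
    change 0 ≤ g x + (M + L * ε)
    linarith
  have hfn : ‖f‖ ≤ M + M := BoundedContinuousFunction.norm_ofNormedAddCommGroup_le _
    (by positivity) _
  have hff' : ‖f‖ ≤ ‖f'‖ := by
    refine (BoundedContinuousFunction.norm_le (norm_nonneg _)).mpr fun x => ?_
    refine le_trans ?_ (f'.norm_coe_le_norm x)
    rw [Real.norm_of_nonneg (hf0 x), Real.norm_of_nonneg (hf'0 x)]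
    have : 0 ≤ L * ε := by positivity
    change g x + M ≤ g x + (M + L * ε)
    linarith
  have h1 := BoundedContinuousFunction.integral_le_of_levyProkhorovEDist_lt μ ν hε h f
    (ae_of_all _ hf0)
  have h2 := BoundedContinuousFunction.integral_eq_integral_meas_le f' ν (ae_of_all _ hf'0)
  have hint : ∀ S : Set ℝ, volume S ≠ ∞ →
      IntegrableOn (fun t => ν.real {a | t ≤ f' a}) S := fun S hS => by
    refine Measure.integrableOn_of_bounded (M := 1) hS ?_ (ae_of_all _ fun t => ?_)
    · apply (Measurable.ennreal_toReal (Antitone.measurable ?_)).aestronglyMeasurable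
      exact fun _ _ hst => measure_mono fun _ h => hst.trans h
    · rw [Real.norm_of_nonneg measureReal_nonneg]
      exact measureReal_le_one
  have h3 : ∫ t in Set.Ioc 0 ‖f‖, ν.real (Metric.thickening ε {a | t ≤ f a}) ≤
      ∫ t in Set.Ioc 0 ‖f'‖, ν.real {a | t ≤ f' a} := by
    refine le_trans (b := ∫ t in Set.Ioc 0 ‖f‖, ν.real {a | t ≤ f' a}) ?_ ?_
    · refine integral_mono_of_nonneg (ae_of_all _ fun _ => measureReal_nonneg)
        (hint _ measure_Ioc_lt_top.ne) (ae_of_all _ fun t => measureReal_mono ?_)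
      intro x hx
      obtain ⟨z, hz, hxz⟩ := Metric.mem_thickening_iff.mp hx
      have hz' : t ≤ g z + M := hz
      have h4 := hg.dist_le_mul z x
      rw [Real.dist_eq, dist_comm] at h4
      have h5 := (le_abs_self _).trans h4
      have h6 : L * dist x z ≤ L * ε := by gcongr
      change t ≤ g x + (M + L * ε)
      linarith
    · exact setIntegral_mono_set (hint _ measure_Ioc_lt_top.ne)
        (ae_of_all _ fun _ => measureReal_nonneg)
        (Set.Ioc_subset_Ioc_right hff').eventuallyLE
  have h4 : ∫ x, f x ∂μ = ∫ x, g x ∂μ + M := by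
    change ∫ x, (g x + M) ∂μ = _
    rw [integral_add (hgi μ) (integrable_const _)]
    simp
  have h5 : ∫ x, f' x ∂ν = ∫ x, g x ∂ν + (M + L * ε) := by
    change ∫ x, (g x + (M + L * ε)) ∂ν = _
    rw [integral_add (hgi ν) (integrable_const _)]
    simp
  have h6 : ε * ‖f‖ ≤ ε * (M + M) := by gcongr
  rw [h4] at h1
  rw [h5] at h2
  nlinarith

theorem dBL_le_of_levyProkhorovEDist_lt {μ ν : Measure ℝ} [IsProbabilityMeasure μ]
    [IsProbabilityMeasure ν] {ε : ℝ} (hε : 0 < ε)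
    (h : levyProkhorovEDist μ ν < ENNReal.ofReal ε) : dBL μ ν ≤ ENNReal.ofReal (3 * ε) := by
  refine iSup₂_le fun g hg => ENNReal.ofReal_le_ofReal ?_
  obtain ⟨L, M, hLM, hL, hM⟩ := hg
  rw [abs_le]
  have h1 := integral_sub_le_of_levyProkhorovEDist_lt hε h hLM hL hM
  have h2 := integral_sub_le_of_levyProkhorovEDist_lt hε
    (by rwa [levyProkhorovEDist_comm]) hLM hL hM
  constructor <;> linarith

/-- Weak convergence of probability measures on the line implies convergence in the Lévy–Prokhorov
distance, which controls `dBL`. -/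
theorem tendsto_dBL_of_tendsto {μ : ℕ → ProbabilityMeasure ℝ} {ν : ProbabilityMeasure ℝ}
    (h : Tendsto μ atTop (𝓝 ν)) :
    Tendsto (fun n => dBL (μ n : Measure ℝ) (ν : Measure ℝ)) atTop (𝓝 0) := by
  have h1 := ((LevyProkhorov.continuous_ofMeasure_probabilityMeasure (Ω := ℝ)).tendsto ν).comp h
  rw [ENNReal.tendsto_nhds_zero]
  intro ε hε
  obtain ⟨δ, hδ, hδε⟩ : ∃ δ : ℝ, 0 < δ ∧ ENNReal.ofReal (3 * δ) ≤ ε := by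
    by_cases ht : ε = ∞
    · exact ⟨1, one_pos, by simp [ht]⟩
    · refine ⟨ε.toReal / 3, by have := ENNReal.toReal_pos hε.ne' ht; positivity, ?_⟩
      rw [mul_div_cancel₀ _ three_ne_zero, ENNReal.ofReal_toReal ht]
  rw [Metric.tendsto_nhds] at h1
  filter_upwards [h1 δ hδ] with n hn
  refine (dBL_le_of_levyProkhorovEDist_lt hδ ?_).trans hδε
  rw [← LevyProkhorov.edist_probabilityMeasure_def, ← edist_lt_ofReal] at *
  exact hn

/-! ### Linear combinations of independent Gamma variables -/

theorem integral_cexp_sum_gammaPi {k : ℕ} {β : Fin k → ℝ} (hβ : ∀ j, 0 < β j) (d : Fin k → ℝ)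
    (t : ℝ) : ∫ g, Complex.exp (((t * ∑ j, d j * g j : ℝ) : ℂ) * Complex.I) ∂gammaPi β =
      ∏ j, (1 - ((t * d j : ℝ) : ℂ) * Complex.I) ^ (-(β j : ℂ)) := by
  have := fun j => isProbabilityMeasure_gammaMeasure (hβ j) one_pos
  have h1 : ∀ g : Fin k → ℝ, Complex.exp (((t * ∑ j, d j * g j : ℝ) : ℂ) * Complex.I) =
      ∏ j, Complex.exp (((t * d j : ℝ) : ℂ) * (g j : ℂ) * Complex.I) := by
    intro g
    rw [← Complex.exp_sum]
    congr 1
    push_cast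
    rw [Finset.mul_sum, Finset.sum_mul]
    exact Finset.sum_congr rfl fun j _ => by ring
  simp_rw [h1]
  unfold gammaPi
  rw [integral_fintype_prod_eq_prod
    (f := fun j (x : ℝ) => Complex.exp (((t * d j : ℝ) : ℂ) * (x : ℂ) * Complex.I))]
  refine Finset.prod_congr rfl fun j _ => ?_
  rw [← charFun_gammaMeasure (hβ j), charFun_apply_real]

theorem memLp_sum_gammaPi {k : ℕ} {β : Fin k → ℝ} (hβ : ∀ j, 0 < β j) (d : Fin k → ℝ) :
    MemLp (fun g : Fin k → ℝ => ∑ j, d j * g j) 2 (gammaPi β) := by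
  have := fun j => isProbabilityMeasure_gammaMeasure (hβ j) one_pos
  refine memLp_finsetSum _ fun j _ => MemLp.const_mul ?_ _
  exact (memLp_id_gammaMeasure (hβ j)).comp_measurePreserving
    (measurePreserving_eval (fun j => gammaMeasure (β j) 1) j)

theorem integral_sum_gammaPi {k : ℕ} {β : Fin k → ℝ} (hβ : ∀ j, 0 < β j) (d : Fin k → ℝ) :
    ∫ g, ∑ j, d j * g j ∂gammaPi β = ∑ j, β j * d j := by
  have := fun j => isProbabilityMeasure_gammaMeasure (hβ j) one_pos
  have hmp := fun j => measurePreserving_eval (fun j => gammaMeasure (β j) 1) j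
  rw [integral_finsetSum]
  · refine Finset.sum_congr rfl fun j _ => ?_
    rw [integral_const_mul, mul_comm]
    congr 1
    exact (integral_comp_eval (μ := fun j => gammaMeasure (β j) 1) (i := j) (f := fun x => x)
      (by fun_prop)).trans (integral_id_gammaMeasure (hβ j))
  · intro j _
    refine Integrable.const_mul ?_ _
    exact ((memLp_id_gammaMeasure (hβ j)).comp_measurePreserving (hmp j)).integrable one_le_two

/-- Variance plus squared bias, the variance of a Gamma variable of rate `1` being its shape. It
serves both the numerator and the total mass of a Dirichlet average. -/
theorem integral_sum_sub_sq_gammaPi {k : ℕ} {β : Fin k → ℝ} (hβ : ∀ j, 0 < β j) (d : Fin k → ℝ)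
    (q : ℝ) : ∫ g, (∑ j, d j * g j - q) ^ 2 ∂gammaPi β =
      ∑ j, β j * d j ^ 2 + (∑ j, β j * d j - q) ^ 2 := by
  have := fun j => isProbabilityMeasure_gammaMeasure (hβ j) one_pos
  have := isProbabilityMeasure_gammaPi hβ
  have hL := memLp_sum_gammaPi hβ d
  have hv : Var[fun g : Fin k → ℝ => ∑ j, d j * g j; gammaPi β] = ∑ j, β j * d j ^ 2 := by
    have h := variance_sum_pi (μ := fun j => gammaMeasure (β j) 1)
      (X := fun j x => d j * x) fun j => (memLp_id_gammaMeasure (hβ j)).const_mul (d j)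
    have e : (∑ j, fun ω : Fin k → ℝ => d j * ω j) = fun ω => ∑ j, d j * ω j := by
      funext ω
      simp
    rw [e] at h
    unfold gammaPi
    rw [h]
    refine Finset.sum_congr rfl fun j _ => ?_
    rw [variance_const_mul, variance_id_gammaMeasure (hβ j), mul_comm]
  rw [variance_eq_sub hL, integral_sum_gammaPi hβ] at hv
  have h2 : Integrable (fun g : Fin k → ℝ => (∑ j, d j * g j) ^ 2) (gammaPi β) := hL.integrable_sq
  have h1 : Integrable (fun g : Fin k → ℝ => ∑ j, d j * g j) (gammaPi β) :=
    hL.integrable one_le_two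
  have e : ∀ g : Fin k → ℝ, (∑ j, d j * g j - q) ^ 2 =
      (∑ j, d j * g j) ^ 2 - (2 * q) * (∑ j, d j * g j) + q ^ 2 := fun g => by ring
  simp_rw [e]
  have h21 : Integrable (fun g : Fin k → ℝ =>
      (∑ j, d j * g j) ^ 2 - (2 * q) * (∑ j, d j * g j)) (gammaPi β) := h2.sub (h1.const_mul _)
  rw [integral_add h21 (integrable_const _),
    integral_sub h2 (h1.const_mul _), integral_const_mul, integral_sum_gammaPi hβ]
  simp only [Pi.pow_apply] at hv
  simp only [integral_const, probReal_univ, smul_eq_mul, one_mul]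
  linarith

theorem norm_log_one_sub_add_le {z : ℂ} (hz : ‖z‖ ≤ 1 / 2) :
    ‖Complex.log (1 - z) + z + z ^ 2 / 2‖ ≤ ‖z‖ ^ 3 := by
  have h := Complex.norm_log_sub_logTaylor_le 2 (z := -z) (by rw [norm_neg]; linarith)
  have e : Complex.logTaylor (2 + 1) (-z) = -z - z ^ 2 / 2 := by
    simp [Complex.logTaylor, Finset.sum_range_succ]
    ring
  rw [e, norm_neg, ← sub_eq_add_neg] at h
  have e2 : Complex.log (1 - z) + z + z ^ 2 / 2 = Complex.log (1 - z) - (-z - z ^ 2 / 2) := by ring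
  rw [e2]
  refine h.trans ?_
  have h1 : (1 - ‖z‖)⁻¹ ≤ 2 := by
    rw [inv_le_comm₀ (by linarith) two_pos]
    linarith
  have h3 : 0 ≤ ‖z‖ ^ 3 := by positivity
  have : ‖z‖ ^ (2 + 1) * (1 - ‖z‖)⁻¹ ≤ ‖z‖ ^ 3 * 2 := by gcongr
  push_cast
  rw [div_le_iff₀ (by norm_num)]
  linarith

/-! ### A central limit theorem for Dirichlet averages -/

/-- The logarithm of the characteristic function is `-∑ β_j log(1 - z_j)` with `z_j = i t c_j / √s`,
uniformly of order `s^{-1/2}`. Its linear term is the normalised mean, its quadratic term gives `-V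
t²/2`, and the cubic remainder is small. -/
theorem tendsto_charFun_gammaPi {k : ℕ → ℕ} {β c : ∀ n, Fin (k n) → ℝ} {A V : ℝ} {s : ℕ → ℝ}
    (hβ : ∀ n j, 0 < β n j) (hA : ∀ n j, |c n j| ≤ A) (hs : Tendsto s atTop atTop)
    (hB : Tendsto (fun n => (∑ j, β n j) / s n) atTop (𝓝 1))
    (hmean : Tendsto (fun n => (∑ j, β n j * c n j) / √(s n)) atTop (𝓝 0))
    (hvar : Tendsto (fun n => (∑ j, β n j * c n j ^ 2) / s n) atTop (𝓝 V)) (t : ℝ) :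
    Tendsto (fun n => ∫ g, Complex.exp
        (((t * ∑ j, (c n j / √(s n)) * g j : ℝ) : ℂ) * Complex.I) ∂gammaPi (β n))
      atTop (𝓝 (Complex.exp (-(V * t ^ 2 / 2 : ℝ)))) := by
  simp_rw [fun n => integral_cexp_sum_gammaPi (hβ n)]
  let z : ∀ n, Fin (k n) → ℂ := fun n j => ((t * (c n j / √(s n)) : ℝ) : ℂ) * Complex.I
  let err : ∀ n, Fin (k n) → ℂ := fun n j =>
    Complex.log (1 - z n j) + z n j + z n j ^ 2 / 2
  have hsq : Tendsto (fun n => √(s n)) atTop atTop := Real.tendsto_sqrt_atTop.comp hs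
  have hz : ∀ n j, ‖z n j‖ ≤ |t| * A / √(s n) := by
    intro n j
    simp only [z, norm_mul, Complex.norm_I, mul_one, Complex.norm_real, Real.norm_eq_abs,
      abs_div, abs_of_nonneg (Real.sqrt_nonneg (s n))]
    rw [mul_div_assoc]
    have := hA n j
    gcongr
  have hz2 : ∀ᶠ n in atTop, ∀ j, ‖z n j‖ ≤ 1 / 2 := by
    have h1 : Tendsto (fun n => |t| * A / √(s n)) atTop (𝓝 0) :=
      tendsto_const_nhds.div_atTop hsq
    filter_upwards [h1.eventually_le_const (show (0 : ℝ) < 1 / 2 by norm_num)] with n hn j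
    exact (hz n j).trans hn
  have hexp : ∀ᶠ n in atTop, ∏ j, (1 - z n j) ^ (-(β n j : ℂ)) =
      Complex.exp (((t * ((∑ j, β n j * c n j) / √(s n)) : ℝ) : ℂ) * Complex.I +
        ((-((∑ j, β n j * c n j ^ 2) / s n * t ^ 2 / 2) : ℝ) : ℂ) - ∑ j, β n j * err n j) := by
    filter_upwards [hz2, hs.eventually_gt_atTop 0] with n hn hsn
    have h1 : ∀ j, (1 - z n j) ^ (-(β n j : ℂ)) =
        Complex.exp (β n j * (z n j + z n j ^ 2 / 2 - err n j)) := by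
      intro j
      have h2 : 1 - z n j ≠ 0 := by
        intro h
        have h3 : z n j = 1 := (sub_eq_zero.mp h).symm
        have := hn j
        rw [h3, norm_one] at this
        norm_num at this
      rw [Complex.cpow_def_of_ne_zero h2]
      congr 1
      simp only [err]
      ring
    simp_rw [h1]
    rw [← Complex.exp_sum]
    congr 1
    simp_rw [mul_sub]
    rw [Finset.sum_sub_distrib]
    congr 1
    simp_rw [mul_add]
    rw [Finset.sum_add_distrib]
    have hs2 : (((√(s n) : ℝ)) : ℂ) ^ 2 = (s n : ℂ) := by
      rw [← Complex.ofReal_pow, Real.sq_sqrt hsn.le]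
    congr 1
    · push_cast
      rw [Finset.sum_div, Finset.mul_sum, Finset.sum_mul]
      refine Finset.sum_congr rfl fun j _ => ?_
      simp only [z]
      push_cast
      ring
    · push_cast
      rw [Finset.sum_div, Finset.sum_mul, Finset.sum_div, ← Finset.sum_neg_distrib]
      refine Finset.sum_congr rfl fun j _ => ?_
      simp only [z]
      push_cast
      rw [mul_pow, mul_pow, div_pow, hs2, Complex.I_sq]
      ring
  have herr : Tendsto (fun n => ∑ j, (β n j : ℂ) * err n j) atTop (𝓝 0) := by
    rw [tendsto_zero_iff_norm_tendsto_zero]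
    -- Total weight of order `s` against cubes of order `s^{-3/2}`.
    have h1 : Tendsto (fun n => ((∑ j, β n j) / s n) * ((|t| * A) ^ 3 / √(s n))) atTop (𝓝 0) := by
      simpa using hB.mul (tendsto_const_nhds (x := (|t| * A) ^ 3) |>.div_atTop hsq)
    refine squeeze_zero' (Eventually.of_forall fun _ => norm_nonneg _) ?_ h1
    filter_upwards [hz2, hs.eventually_gt_atTop 0] with n hn hsn
    calc ‖∑ j, (β n j : ℂ) * err n j‖ ≤ ∑ j, β n j * (|t| * A / √(s n)) ^ 3 := by
          refine (norm_sum_le _ _).trans (Finset.sum_le_sum fun j _ => ?_)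
          rw [norm_mul, Complex.norm_real, Real.norm_of_nonneg (hβ n j).le]
          refine mul_le_mul_of_nonneg_left ?_ (hβ n j).le
          refine (norm_log_one_sub_add_le (hn j)).trans ?_
          exact pow_le_pow_left₀ (norm_nonneg _) (hz n j) 3
      _ = _ := by
          rw [← Finset.sum_mul, div_pow, div_mul_div_comm, mul_div_assoc]
          have h2 : √(s n) ^ 3 = s n * √(s n) := by
            rw [pow_succ, Real.sq_sqrt hsn.le]
          rw [h2]
  refine Tendsto.congr' (hexp.mono fun n hn => hn.symm) ?_
  refine (Complex.continuous_exp.tendsto _).comp ?_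
  have h1 : Tendsto (fun n => ((t * ((∑ j, β n j * c n j) / √(s n)) : ℝ) : ℂ) * Complex.I)
      atTop (𝓝 (((t * 0 : ℝ) : ℂ) * Complex.I)) :=
    ((Complex.continuous_ofReal.tendsto _).comp (hmean.const_mul t)).mul_const _
  have h2 : Tendsto (fun n => ((-((∑ j, β n j * c n j ^ 2) / s n * t ^ 2 / 2) : ℝ) : ℂ))
      atTop (𝓝 ((-(V * t ^ 2 / 2) : ℝ) : ℂ)) :=
    (Complex.continuous_ofReal.tendsto _).comp (((hvar.mul_const _).div_const _).neg)
  have h3 := (h1.add h2).sub herr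
  simpa using h3

/-- Cost of replacing the random denominator `S` by `s`. For `S ≥ s/2` the phases differ by at most
`2|t||T||S - s|/s`, which is split by the arithmetic-geometric inequality with a free weight `τ`.
For `S < s/2` the trivial bound `2` is at most `8((S - s)/s)²`. The result is quadratic in `T` and
`S`, so second moments suffice. -/
theorem norm_cexp_sub_cexp_le {t T S s τ : ℝ} (hS : 0 < S) (hs : 0 < s) (hτ : 0 < τ) :
    ‖Complex.exp (((t * (T * (s / S)) : ℝ) : ℂ) * Complex.I) -
        Complex.exp (((t * T : ℝ) : ℂ) * Complex.I)‖ ≤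
      |t| * (τ * T ^ 2 + ((S - s) / s) ^ 2 / τ) + 8 * ((S - s) / s) ^ 2 := by
  have h0 : 0 ≤ |t| * (τ * T ^ 2 + ((S - s) / s) ^ 2 / τ) := by positivity
  by_cases h : S < s / 2
  · have h1 : (1 / 2) ^ 2 ≤ ((S - s) / s) ^ 2 := by
      rw [← sq_abs ((S - s) / s)]
      refine pow_le_pow_left₀ (by norm_num) ?_ 2
      rw [abs_div, abs_of_pos hs, le_div_iff₀ hs, abs_of_neg (by linarith)]
      linarith
    have h2 : ‖Complex.exp (((t * (T * (s / S)) : ℝ) : ℂ) * Complex.I) -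
        Complex.exp (((t * T : ℝ) : ℂ) * Complex.I)‖ ≤ 1 + 1 := by
      refine (norm_sub_le _ _).trans_eq ?_
      rw [Complex.norm_exp_ofReal_mul_I, Complex.norm_exp_ofReal_mul_I]
    linarith
  · rw [not_lt] at h
    have h1 : Complex.exp (((t * (T * (s / S)) : ℝ) : ℂ) * Complex.I) -
        Complex.exp (((t * T : ℝ) : ℂ) * Complex.I) =
        Complex.exp (((t * T : ℝ) : ℂ) * Complex.I) *
          (Complex.exp (Complex.I * ((t * (T * ((s - S) / S)) : ℝ) : ℂ)) - 1) := by
      rw [mul_sub, ← Complex.exp_add, mul_one]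
      congr 2
      have hS' : (S : ℂ) ≠ 0 := by exact_mod_cast hS.ne'
      push_cast
      field_simp
      ring
    rw [h1, norm_mul, Complex.norm_exp_ofReal_mul_I, one_mul]
    refine (Real.norm_exp_I_mul_ofReal_sub_one_le).trans ?_
    have h2 : |(s - S) / S| ≤ 2 * |(S - s) / s| := by
      rw [abs_div, abs_div, abs_sub_comm, abs_of_pos hS, abs_of_pos hs, div_le_iff₀ hS]
      have h3 : 2 * (|S - s| / s) * S = |S - s| * (2 * S / s) := by ring
      rw [h3]
      refine le_mul_of_one_le_right (abs_nonneg _) ?_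
      rw [one_le_div hs]
      linarith
    rw [Real.norm_eq_abs, abs_mul, abs_mul]
    have h4 : |T| * |(s - S) / S| ≤ τ * T ^ 2 + ((S - s) / s) ^ 2 / τ := by
      refine (mul_le_mul_of_nonneg_left h2 (abs_nonneg _)).trans ?_
      rw [← sq_abs T, ← sq_abs ((S - s) / s)]
      set p := |T|
      set u := |(S - s) / s|
      have h5 : 0 ≤ (τ * p - u) ^ 2 / τ := by positivity
      have h6 : (τ * p - u) ^ 2 / τ = τ * p ^ 2 + u ^ 2 / τ - p * (2 * u) := by
        field_simp
        ring
      linarith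
    have h7 := mul_le_mul_of_nonneg_left h4 (abs_nonneg t)
    have h8 : 0 ≤ 8 * ((S - s) / s) ^ 2 := by positivity
    linarith

/-- The centred Dirichlet average equals `T * (s / S)`, where `T` is the Gamma combination handled
by `tendsto_charFun_gammaPi` and `S` the total mass. Since `S/s → 1` in mean square, the
characteristic functions have the same limit, and Lévy's continuity theorem applies. -/
theorem tendsto_dBL_dirichlet {k : ℕ → ℕ} {β a : ∀ n, Fin (k n) → ℝ} {m : ℕ → ℝ} {A V : ℝ}
    {s : ℕ → ℝ} (hk : ∀ n, 0 < k n)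
    (hβ : ∀ n j, 0 < β n j) (hA : ∀ n j, |a n j - m n| ≤ A) (hs : Tendsto s atTop atTop)
    (hB : Tendsto (fun n => (∑ j, β n j) / s n) atTop (𝓝 1))
    (hmean : Tendsto (fun n => (∑ j, β n j * (a n j - m n)) / √(s n)) atTop (𝓝 0))
    (hvar : Tendsto (fun n => (∑ j, β n j * (a n j - m n) ^ 2) / s n) atTop (𝓝 V)) :
    Tendsto (fun n => dBL ((dirichlet (β n)).map fun ω => √(s n) * (∑ j, ω j * a n j - m n))
      (gaussianReal 0 V.toNNReal)) atTop (𝓝 0) := by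
  have hV : 0 ≤ V := by
    refine ge_of_tendsto hvar ?_
    filter_upwards [hs.eventually_gt_atTop 0] with n hn
    exact div_nonneg (Finset.sum_nonneg fun j _ => mul_nonneg (hβ n j).le (sq_nonneg _)) hn.le
  have hD := fun n => isProbabilityMeasure_dirichlet (hβ n)
  have hG := fun n => isProbabilityMeasure_gammaPi (hβ n)
  have hX : ∀ n, Measurable fun ω : Fin (k n) → ℝ => √(s n) * (∑ j, ω j * a n j - m n) :=
    fun n => by fun_prop
  have hP : ∀ n, IsProbabilityMeasure
      ((dirichlet (β n)).map fun ω => √(s n) * (∑ j, ω j * a n j - m n)) :=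
    fun n => Measure.isProbabilityMeasure_map (hX n).aemeasurable
  let μ : ℕ → ProbabilityMeasure ℝ := fun n => ⟨_, hP n⟩
  let ν : ProbabilityMeasure ℝ := ⟨gaussianReal 0 V.toNNReal, inferInstance⟩
  refine tendsto_dBL_of_tendsto (μ := μ) (ν := ν) ?_
  refine ProbabilityMeasure.tendsto_of_tendsto_charFun fun t => ?_
  have hlim : charFun (ν : Measure ℝ) t = Complex.exp (-(V * t ^ 2 / 2 : ℝ)) := by
    change charFun (gaussianReal 0 V.toNNReal) t = _
    rw [charFun_gaussianReal]
    congr 1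
    have hc : ((V.toNNReal : ℝ≥0) : ℂ) = (V : ℂ) :=
      congrArg Complex.ofReal (Real.coe_toNNReal V hV)
    rw [hc]
    push_cast
    ring
  rw [hlim]
  have hT := tendsto_charFun_gammaPi hβ hA hs hB hmean hvar t
  let T : ∀ n, (Fin (k n) → ℝ) → ℝ := fun n g => ∑ j, ((a n j - m n) / √(s n)) * g j
  let w : ℕ → ℝ := fun n => ∫ g, T n g ^ 2 ∂gammaPi (β n)
  let u : ℕ → ℝ := fun n => ∫ g, ((∑ j, g j - s n) / s n) ^ 2 ∂gammaPi (β n)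
  -- This weight tends to `0` while `u / τ ≤ τ`, so both terms of the split vanish; the summand `1 /
  -- s` keeps it positive when `u = 0`.
  let τ : ℕ → ℝ := fun n => √(u n + 1 / s n)
  have hTi : ∀ n, Integrable (fun g => T n g ^ 2) (gammaPi (β n)) := fun n =>
    (memLp_sum_gammaPi (hβ n) _).integrable_sq
  have hUi : ∀ n, Integrable (fun g : Fin (k n) → ℝ => ((∑ j, g j - s n) / s n) ^ 2)
      (gammaPi (β n)) := fun n => by
    have h1 := memLp_sum_gammaPi (hβ n) (fun _ => 1)
    simp only [one_mul] at h1
    have h2 := ((h1.sub (memLp_const (s n))).mul_const (s n)⁻¹).integrable_sq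
    simpa [div_eq_mul_inv] using h2
  have hw : Tendsto w atTop (𝓝 V) := by
    have h1 : ∀ᶠ n in atTop, (∑ j, β n j * (a n j - m n) ^ 2) / s n +
        ((∑ j, β n j * (a n j - m n)) / √(s n)) ^ 2 = w n := by
      filter_upwards [hs.eventually_gt_atTop 0] with n hn
      have h2 := integral_sum_sub_sq_gammaPi (hβ n) (fun j => (a n j - m n) / √(s n)) 0
      simp only [sub_zero] at h2
      change _ = ∫ g, (∑ j, ((a n j - m n) / √(s n)) * g j) ^ 2 ∂gammaPi (β n)
      rw [h2, Finset.sum_div, Finset.sum_div]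
      congr 1
      · refine Finset.sum_congr rfl fun j _ => ?_
        rw [div_pow, Real.sq_sqrt hn.le, mul_div_assoc]
      · congr 1
        exact Finset.sum_congr rfl fun j _ => mul_div_assoc _ _ _
    have h3 := (hvar.add (hmean.pow 2)).congr' h1
    simpa using h3
  have hu : Tendsto u atTop (𝓝 0) := by
    have h1 : ∀ᶠ n in atTop, ((∑ j, β n j) / s n) * (1 / s n) +
        ((∑ j, β n j) / s n - 1) ^ 2 = u n := by
      filter_upwards [hs.eventually_gt_atTop 0] with n hn
      have h2 := integral_sum_sub_sq_gammaPi (hβ n) (fun _ => 1 / s n) 1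
      have h3 : ∀ g : Fin (k n) → ℝ, ∑ j, 1 / s n * g j - 1 = (∑ j, g j - s n) / s n := fun g => by
        rw [← Finset.mul_sum]
        field_simp
      simp_rw [h3] at h2
      simp only [u]
      rw [h2, ← Finset.sum_mul, ← Finset.sum_mul]
      field_simp
    have h4 := ((hB.mul (tendsto_const_nhds (x := (1 : ℝ)).div_atTop hs)).add
      ((hB.sub_const 1).pow 2)).congr' h1
    simpa using h4
  have hτ0 : Tendsto τ atTop (𝓝 0) := by
    have h1 := (hu.add (tendsto_const_nhds (x := (1 : ℝ)).div_atTop hs)).sqrt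
    rw [add_zero, Real.sqrt_zero] at h1
    exact h1
  have hbound : Tendsto (fun n => |t| * (τ n * w n + τ n) + 8 * u n) atTop (𝓝 0) := by
    have h1 := (((hτ0.mul hw).add hτ0).const_mul |t|).add (hu.const_mul 8)
    simpa using h1
  have hu0 : ∀ n, 0 ≤ u n := fun n => integral_nonneg fun g => sq_nonneg _
  have hdiff : Tendsto (fun n => charFun (μ n : Measure ℝ) t - ∫ g, Complex.exp
        (((t * T n g : ℝ) : ℂ) * Complex.I) ∂gammaPi (β n)) atTop (𝓝 0) := by
    rw [tendsto_zero_iff_norm_tendsto_zero]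
    refine squeeze_zero' (Eventually.of_forall fun _ => norm_nonneg _) ?_ hbound
    filter_upwards [hs.eventually_gt_atTop 0] with n hn
    have : NeZero (k n) := ⟨(hk n).ne'⟩
    have hτn : 0 < τ n := Real.sqrt_pos.mpr (by have := hu0 n; positivity)
    have huτ : u n / τ n ≤ τ n := by
      rw [div_le_iff₀ hτn, Real.mul_self_sqrt (by have := hu0 n; positivity)]
      have : 0 ≤ 1 / s n := by positivity
      linarith
    have h1 : charFun (μ n : Measure ℝ) t = ∫ g, Complex.exp
        (((t * (T n g * (s n / ∑ j, g j)) : ℝ) : ℂ) * Complex.I) ∂gammaPi (β n) := by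
      have hcm : Continuous fun ω : Fin (k n) → ℝ =>
          Complex.exp (t * ((√(s n) * (∑ j, ω j * a n j - m n) : ℝ) : ℂ) * Complex.I) := by
        fun_prop
      change charFun ((dirichlet (β n)).map fun ω => √(s n) * (∑ j, ω j * a n j - m n)) t = _
      rw [charFun_apply_real, integral_map (hX n).aemeasurable (by fun_prop), dirichlet_eq_map,
        integral_map measurable_normalize.aemeasurable hcm.aestronglyMeasurable]
      refine integral_congr_ae ?_
      filter_upwards [ae_pos_gammaPi (hβ n)] with g hg
      have hS : 0 < ∑ j, g j := Finset.sum_pos (fun j _ => hg j) Finset.univ_nonempty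
      have h2 : √(s n) * (∑ j, normalize g j * a n j - m n) = T n g * (s n / ∑ j, g j) := by
        have h3 : ∑ j, normalize g j * a n j - m n =
            (∑ j, (a n j - m n) * g j) / ∑ j, g j := by
          rw [eq_div_iff hS.ne', sub_mul, Finset.sum_mul, Finset.mul_sum, ← Finset.sum_sub_distrib]
          refine Finset.sum_congr rfl fun j _ => ?_
          simp only [normalize]
          field_simp
        have h4 : T n g = (∑ j, (a n j - m n) * g j) / √(s n) := by
          rw [Finset.sum_div]
          exact Finset.sum_congr rfl fun j _ => by ring
        rw [h3, h4]
        have h5 : s n = √(s n) * √(s n) := (Real.mul_self_sqrt hn.le).symm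
        have h6 : 0 < √(s n) := Real.sqrt_pos.mpr hn
        nth_rw 3 [h5]
        field_simp
      rw [h2]
      push_cast
      rfl
    have hmT : Measurable (T n) := by fun_prop
    rw [h1, ← integral_sub]
    · refine (norm_integral_le_of_norm_le (((((hTi n).const_mul (τ n)).add
        ((hUi n).div_const (τ n))).const_mul |t|).add ((hUi n).const_mul 8)) ?_).trans ?_
      · filter_upwards [ae_pos_gammaPi (hβ n)] with g hg
        have hS : 0 < ∑ j, g j := Finset.sum_pos (fun j _ => hg j) Finset.univ_nonempty
        exact norm_cexp_sub_cexp_le hS hn hτn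
      · have e1 : ∫ g, (|t| * (τ n * T n g ^ 2 + ((∑ j, g j - s n) / s n) ^ 2 / τ n) +
            8 * ((∑ j, g j - s n) / s n) ^ 2) ∂gammaPi (β n) =
            |t| * (τ n * w n + u n / τ n) + 8 * u n := by
          have h5 : Integrable (fun g => |t| * (τ n * T n g ^ 2 +
              ((∑ j, g j - s n) / s n) ^ 2 / τ n)) (gammaPi (β n)) :=
            (((hTi n).const_mul (τ n)).add ((hUi n).div_const (τ n))).const_mul |t|
          rw [integral_add h5 ((hUi n).const_mul 8), integral_const_mul,
            integral_add ((hTi n).const_mul (τ n)) ((hUi n).div_const (τ n)), integral_const_mul,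
            integral_div, integral_const_mul]
        refine e1.trans_le ?_
        gcongr
    · refine Integrable.of_bound (by fun_prop) 1 (ae_of_all _ fun g => ?_)
      rw [Complex.norm_exp_ofReal_mul_I]
    · refine Integrable.of_bound (by fun_prop) 1 (ae_of_all _ fun g => ?_)
      rw [Complex.norm_exp_ofReal_mul_I]
  have h := hdiff.add hT
  rw [zero_add] at h
  exact h.congr fun n => sub_add_cancel _ _

/-! ### The square wave and the Haar series -/

/-- The `1`-periodic square wave, `1` on `[0,1/2)` and `-1` on `[1/2,1)`. -/
def squareWave (t : ℝ) : ℝ := if Even ⌊2 * t⌋ then 1 else -1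

@[fun_prop]
theorem measurable_squareWave : Measurable squareWave := by
  unfold squareWave
  refine Measurable.ite ?_ measurable_const measurable_const
  have h : Measurable fun t : ℝ => ⌊2 * t⌋ := by fun_prop
  exact h (MeasurableSet.of_discrete (s := {m : ℤ | Even m}))

theorem abs_squareWave (t : ℝ) : |squareWave t| = 1 := by
  unfold squareWave
  split_ifs <;> simp

theorem squareWave_add_natCast (t : ℝ) (j : ℕ) : squareWave (t + j) = squareWave t := by
  unfold squareWave
  have h : ⌊2 * (t + j)⌋ = ⌊2 * t⌋ + 2 * (j : ℤ) := by
    rw [← Int.floor_add_intCast]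
    congr 1
    push_cast
    ring
  rw [h]
  simp [Int.even_add]

theorem squareWave_of_lt_half {t : ℝ} (h0 : 0 ≤ t) (h1 : t < 1 / 2) : squareWave t = 1 := by
  have h : ⌊2 * t⌋ = 0 := Int.floor_eq_iff.mpr ⟨by push_cast; linarith, by push_cast; linarith⟩
  simp [squareWave, h]

theorem squareWave_of_half_le {t : ℝ} (h0 : 1 / 2 ≤ t) (h1 : t < 1) : squareWave t = -1 := by
  have h : ⌊2 * t⌋ = 1 := Int.floor_eq_iff.mpr ⟨by push_cast; linarith, by push_cast; linarith⟩
  simp [squareWave, h]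

theorem haarMother_eq_squareWave {t : ℝ} (h0 : 0 ≤ t) (h1 : t < 1) :
    haarMother t = squareWave t := by
  unfold haarMother
  by_cases h : t < 1 / 2
  · rw [squareWave_of_lt_half h0 h, Set.indicator_of_mem (show t ∈ Set.Ico (0 : ℝ) (1 / 2) from ⟨h0, h⟩), Set.indicator_of_notMem]
    · simp
    · exact fun h' => absurd h'.1 (not_le.mpr h)
  · rw [not_lt] at h
    rw [squareWave_of_half_le h h1, Set.indicator_of_notMem, Set.indicator_of_mem (show t ∈ Set.Ico (1 / 2 : ℝ) 1 from ⟨h, h1⟩)]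
    · simp
    · exact fun h' => absurd h'.2 (not_lt.mpr h)

theorem haarMother_eq_zero {t : ℝ} (h : t < 0 ∨ 1 ≤ t) : haarMother t = 0 := by
  unfold haarMother
  rw [Set.indicator_of_notMem, Set.indicator_of_notMem, sub_zero]
  · rintro ⟨h1, h2⟩
    rcases h with h | h <;> linarith
  · rintro ⟨h1, h2⟩
    rcases h with h | h <;> linarith

theorem sum_haarMother {x : ℝ} (h0 : 0 ≤ x) (h1 : x < 1) (l : ℕ) :
    ∑ k ∈ Finset.range (2 ^ l), haarMother (2 ^ l * x - k) = squareWave (2 ^ l * x) := by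
  have hx : (0 : ℝ) ≤ 2 ^ l * x := by positivity
  set m := ⌊(2 : ℝ) ^ l * x⌋₊ with hm
  have hm1 : (m : ℝ) ≤ 2 ^ l * x := Nat.floor_le hx
  have hm2 : 2 ^ l * x < m + 1 := Nat.lt_floor_add_one _
  -- The translates at one level have disjoint supports; only the one with index `⌊2^l x⌋` sees `x`.
  rw [Finset.sum_eq_single m]
  · rw [haarMother_eq_squareWave (by linarith) (by linarith)]
    have := squareWave_add_natCast (2 ^ l * x - m) m
    rw [sub_add_cancel] at this
    exact this.symm
  · intro k _ hk
    apply haarMother_eq_zero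
    rcases lt_or_gt_of_ne hk with h | h
    · right
      have : (k : ℝ) + 1 ≤ m := by exact_mod_cast h
      linarith
    · left
      have : (m : ℝ) + 1 ≤ k := by exact_mod_cast h
      linarith
  · intro h
    exfalso
    apply h
    rw [Finset.mem_range]
    have : (m : ℝ) < 2 ^ l := hm1.trans_lt (by
      have : (0 : ℝ) < 2 ^ l := by positivity
      nlinarith)
    exact_mod_cast this

/-- The lacunary series `∑ q^l s(2^l x)` of square waves. -/
def squareSeries (q x : ℝ) : ℝ := ∑' l : ℕ, q ^ l * squareWave (2 ^ l * x)

/-- The wavelet normalisation `2^{l/2}` cancels half of the exponent and leaves `2^{-γl}`. The point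
`x = 1` is excluded: the wavelets vanish there, the periodic square waves do not. -/
theorem haarSeries_eq (γ : ℝ) {x : ℝ} (h0 : 0 ≤ x) (h1 : x < 1) :
    haarSeries γ x = (2 : ℝ) ^ (1 / 2 + γ) + squareSeries ((2 : ℝ) ^ (-γ)) x := by
  unfold haarSeries squareSeries
  rw [Set.indicator_of_mem (show x ∈ Set.Icc (0 : ℝ) 1 from ⟨h0, h1.le⟩), Pi.one_apply, mul_one]
  congr 1
  refine tsum_congr fun l => ?_
  rw [← sum_haarMother h0 h1, Finset.mul_sum]
  refine Finset.sum_congr rfl fun k _ => ?_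
  unfold haar
  rw [← mul_assoc, ← Real.rpow_add two_pos, ← Real.rpow_natCast ((2 : ℝ) ^ (-γ)) l,
    ← Real.rpow_mul two_pos.le]
  congr 2
  ring

variable {q : ℝ}

theorem norm_squareSeries_term (hq0 : 0 ≤ q) (x : ℝ) (l : ℕ) :
    ‖q ^ l * squareWave (2 ^ l * x)‖ = q ^ l := by
  rw [norm_mul, Real.norm_eq_abs (squareWave _), abs_squareWave, mul_one,
    Real.norm_of_nonneg (by positivity)]

theorem summable_squareSeries (hq0 : 0 ≤ q) (hq1 : q < 1) (x : ℝ) :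
    Summable fun l : ℕ => q ^ l * squareWave (2 ^ l * x) := by
  refine Summable.of_norm ?_
  simp_rw [norm_squareSeries_term hq0]
  exact summable_geometric_of_lt_one hq0 hq1

theorem abs_squareSeries_le (hq0 : 0 ≤ q) (hq1 : q < 1) (x : ℝ) :
    |squareSeries q x| ≤ (1 - q)⁻¹ := by
  have h := tsum_of_norm_bounded (hasSum_geometric_of_lt_one hq0 hq1)
    (fun l => (norm_squareSeries_term hq0 x l).le)
  exact h

theorem measurable_squareSeries (hq0 : 0 ≤ q) (hq1 : q < 1) : Measurable (squareSeries q) := by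
  refine measurable_of_tendsto_metrizable (f := fun n x => ∑ l ∈ Finset.range n,
    q ^ l * squareWave (2 ^ l * x)) (fun n => by fun_prop) ?_
  rw [tendsto_pi_nhds]
  exact fun x => (summable_squareSeries hq0 hq1 x).hasSum.tendsto_sum_nat

theorem squareSeries_add_natCast (x : ℝ) (j : ℕ) :
    squareSeries q (x + j) = squareSeries q x := by
  unfold squareSeries
  refine tsum_congr fun l => ?_
  have h := squareWave_add_natCast (2 ^ l * x) (2 ^ l * j)
  push_cast at h
  rw [mul_add, h]

/-- Self-similarity: the tail of the series is a scaled copy of the series at a dyadic dilation. -/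
theorem squareSeries_eq_sum_add (hq0 : 0 ≤ q) (hq1 : q < 1) (x : ℝ) (p : ℕ) :
    squareSeries q x = ∑ l ∈ Finset.range p, q ^ l * squareWave (2 ^ l * x) +
      q ^ p * squareSeries q (2 ^ p * x) := by
  unfold squareSeries
  rw [← (summable_squareSeries hq0 hq1 x).sum_add_tsum_nat_add p, ← tsum_mul_left]
  congr 1
  refine tsum_congr fun l => ?_
  rw [pow_add, pow_add]
  ring_nf

theorem squareWave_congr_floor {x y : ℝ} {l p : ℕ} (hl : l < p)
    (h : ⌊(2 : ℝ) ^ p * x⌋ = ⌊(2 : ℝ) ^ p * y⌋) :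
    squareWave (2 ^ l * x) = squareWave (2 ^ l * y) := by
  -- The coarser dyadic index is the integer quotient of the finer one, so it depends on `z` only
  -- through the cell of level `p`.
  have key : ∀ z : ℝ, ⌊2 * ((2 : ℝ) ^ l * z)⌋ = ⌊(2 : ℝ) ^ p * z⌋ / ((2 ^ (p - l - 1) : ℕ) : ℤ) := by
    intro z
    rw [← Int.floor_div_natCast]
    congr 1
    have e : p = l + 1 + (p - l - 1) := by omega
    conv_rhs => rw [e]
    rw [pow_add]
    push_cast
    have : (2 : ℝ) ^ (l + 1 + (p - l - 1) - l - 1) = 2 ^ (p - l - 1) := by congr 1; omega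
    rw [this]
    field_simp
    ring
  unfold squareWave
  rw [key, key, h]

/-! ### Integrals of square waves against functions with bounded slopes -/

/-- `h` is continuous on `[0,1]` and all its slopes there lie in `[ρ, L]`. -/
def SlopesIn (ρ L : ℝ) (h : ℝ → ℝ) : Prop :=
  ContinuousOn h (Set.Icc 0 1) ∧ ∀ x y, 0 ≤ x → x ≤ y → y ≤ 1 →
    ρ * (y - x) ≤ h y - h x ∧ h y - h x ≤ L * (y - x)

theorem intervalIntegrable_bdd_mul {g h : ℝ → ℝ} {C a b : ℝ} (hg : Measurable g)
    (hC : ∀ x, |g x| ≤ C) (hh : IntervalIntegrable h volume a b) :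
    IntervalIntegrable (fun x => g x * h x) volume a b := by
  rw [intervalIntegrable_iff] at *
  exact hh.bdd_mul hg.aestronglyMeasurable (ae_of_all _ hC)

theorem SlopesIn.intervalIntegrable {ρ L : ℝ} {h : ℝ → ℝ} (hh : SlopesIn ρ L h) {a b : ℝ}
    (ha : 0 ≤ a) (hab : a ≤ b) (hb : b ≤ 1) : IntervalIntegrable h volume a b := by
  refine ContinuousOn.intervalIntegrable (hh.1.mono ?_)
  rw [Set.uIcc_of_le hab]
  exact Set.Icc_subset_Icc ha hb

/-- The quantity `-∫ s h` is the integral over `[0,1/2]` of the increment `h(x + 1/2) - h(x)`, which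
lies between `ρ/2` and `L/2`. -/
theorem integral_squareWave_mul {ρ L : ℝ} {h : ℝ → ℝ} (hh : SlopesIn ρ L h) :
    ρ / 4 ≤ -∫ x in (0 : ℝ)..1, squareWave x * h x ∧
      -∫ x in (0 : ℝ)..1, squareWave x * h x ≤ L / 4 := by
  have hi := hh.intervalIntegrable le_rfl (by norm_num : (0 : ℝ) ≤ 1 / 2) (by norm_num)
  have hi' := hh.intervalIntegrable (by norm_num) (by norm_num : (1 / 2 : ℝ) ≤ 1) le_rfl
  have hsw : ∀ x, |squareWave x| ≤ 1 := fun x => (abs_squareWave x).le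
  have e1 : ∫ x in (0 : ℝ)..(1 / 2), squareWave x * h x = ∫ x in (0 : ℝ)..(1 / 2), h x := by
    refine intervalIntegral.integral_congr_ae ?_
    have h0 : ∀ᵐ x : ℝ, x ≠ 1 / 2 := by simp [ae_iff]
    filter_upwards [h0] with x hx hx2
    rw [Set.uIoc_of_le (by norm_num)] at hx2
    rw [squareWave_of_lt_half hx2.1.le (lt_of_le_of_ne hx2.2 hx), one_mul]
  have e2 : ∫ x in (1 / 2 : ℝ)..1, squareWave x * h x = -∫ x in (1 / 2 : ℝ)..1, h x := by
    rw [← intervalIntegral.integral_neg]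
    refine intervalIntegral.integral_congr_ae ?_
    have h0 : ∀ᵐ x : ℝ, x ≠ 1 := by simp [ae_iff]
    filter_upwards [h0] with x hx hx2
    rw [Set.uIoc_of_le (by norm_num)] at hx2
    rw [squareWave_of_half_le hx2.1.le (lt_of_le_of_ne hx2.2 hx), neg_one_mul]
  have e3 : ∫ x in (1 / 2 : ℝ)..1, h x = ∫ x in (0 : ℝ)..(1 / 2), h (x + 1 / 2) := by
    rw [intervalIntegral.integral_comp_add_right]
    norm_num
  have hi'' : IntervalIntegrable (fun x => h (x + 1 / 2)) volume 0 (1 / 2) := by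
    have := hi'.comp_add_right (1 / 2)
    norm_num at this
    simpa using this
  have e4 : -∫ x in (0 : ℝ)..1, squareWave x * h x =
      ∫ x in (0 : ℝ)..(1 / 2), (h (x + 1 / 2) - h x) := by
    rw [← intervalIntegral.integral_add_adjacent_intervals (b := 1 / 2)
      (intervalIntegrable_bdd_mul measurable_squareWave hsw hi)
      (intervalIntegrable_bdd_mul measurable_squareWave hsw hi'), e1, e2, e3,
      intervalIntegral.integral_sub hi'' hi]
    ring
  rw [e4]
  constructor
  · have h1 := intervalIntegral.integral_mono_on (a := (0 : ℝ)) (b := 1 / 2)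
      (f := fun _ => ρ * (1 / 2)) (by norm_num) (by simp) (hi''.sub hi) fun x hx => by
        have := (hh.2 x (x + 1 / 2) hx.1 (by linarith) (by linarith [hx.2])).1
        simpa using this
    rw [intervalIntegral.integral_const] at h1
    simp only [smul_eq_mul] at h1
    linarith
  · have h1 := intervalIntegral.integral_mono_on (a := (0 : ℝ)) (b := 1 / 2)
      (g := fun _ => L * (1 / 2)) (by norm_num) (hi''.sub hi) (by simp) fun x hx => by
        have := (hh.2 x (x + 1 / 2) hx.1 (by linarith) (by linarith [hx.2])).2
        simpa using this
    rw [intervalIntegral.integral_const] at h1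
    simp only [smul_eq_mul] at h1
    linarith

theorem SlopesIn.comp_half {ρ L : ℝ} {h : ℝ → ℝ} (hh : SlopesIn ρ L h) {d : ℝ} (hd0 : 0 ≤ d)
    (hd1 : d ≤ 1 / 2) : SlopesIn (ρ / 2) (L / 2) fun x => h (d + x / 2) := by
  refine ⟨hh.1.comp (by fun_prop) fun x hx => ⟨by linarith [hx.1], by linarith [hx.2]⟩, ?_⟩
  intro x y h0 hxy h1
  have := hh.2 (d + x / 2) (d + y / 2) (by linarith) (by linarith) (by linarith)
  constructor <;> linarith

/-- Induction on the frequency. Rescaling each half of `[0,1]` to the whole interval lowers the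
level by one and halves the slopes; the integral is the mean of the two rescaled ones. -/
theorem integral_squareWave_pow_mul (l : ℕ) : ∀ {ρ L : ℝ} {h : ℝ → ℝ}, SlopesIn ρ L h →
    ρ / (4 * 2 ^ l) ≤ -∫ x in (0 : ℝ)..1, squareWave (2 ^ l * x) * h x ∧
      -∫ x in (0 : ℝ)..1, squareWave (2 ^ l * x) * h x ≤ L / (4 * 2 ^ l) := by
  induction l with
  | zero =>
    intro ρ L h hh
    simpa using integral_squareWave_mul hh
  | succ l ih =>
    intro ρ L h hh
    have hsw : ∀ x, |squareWave (2 ^ (l + 1) * x)| ≤ 1 := fun x => (abs_squareWave _).le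
    have hm : Measurable fun x => squareWave (2 ^ (l + 1) * x) := by fun_prop
    have hi := hh.intervalIntegrable le_rfl (by norm_num : (0 : ℝ) ≤ 1 / 2) (by norm_num)
    have hi' := hh.intervalIntegrable (by norm_num) (by norm_num : (1 / 2 : ℝ) ≤ 1) le_rfl
    have h1 := ih (hh.comp_half le_rfl (by norm_num))
    have h2 := ih (hh.comp_half (d := 1 / 2) (by norm_num) le_rfl)
    have e1 : ∫ x in (0 : ℝ)..1, squareWave (2 ^ l * x) * h (0 + x / 2) =
        2 * ∫ x in (0 : ℝ)..(1 / 2), squareWave (2 ^ (l + 1) * x) * h x := by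
      have := intervalIntegral.integral_comp_add_div (a := 0) (b := 1)
        (fun x => squareWave (2 ^ (l + 1) * x) * h x) two_ne_zero 0
      simp only [smul_eq_mul] at this
      norm_num at this ⊢
      rw [← this]
      refine intervalIntegral.integral_congr fun x _ => ?_
      congr 2
      rw [pow_succ]
      ring
    have e2 : ∫ x in (0 : ℝ)..1, squareWave (2 ^ l * x) * h (1 / 2 + x / 2) =
        2 * ∫ x in (1 / 2 : ℝ)..1, squareWave (2 ^ (l + 1) * x) * h x := by
      have := intervalIntegral.integral_comp_add_div (a := 0) (b := 1)
        (fun x => squareWave (2 ^ (l + 1) * x) * h x) two_ne_zero (1 / 2)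
      simp only [smul_eq_mul] at this
      norm_num at this ⊢
      rw [← this]
      refine intervalIntegral.integral_congr fun x _ => ?_
      congr 1
      have e := squareWave_add_natCast (2 ^ l * x) (2 ^ l)
      rw [← e]
      congr 1
      push_cast
      rw [pow_succ]
      ring
    rw [← intervalIntegral.integral_add_adjacent_intervals (b := 1 / 2)
      (intervalIntegrable_bdd_mul hm hsw hi) (intervalIntegrable_bdd_mul hm hsw hi')]
    rw [e1] at h1
    rw [e2] at h2
    have e3 : ∀ c : ℝ, c / (4 * 2 ^ (l + 1)) = c / 2 / (4 * 2 ^ l) := fun c => by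
      rw [pow_succ]
      field_simp
    rw [e3, e3]
    constructor <;> linarith [h1.1, h1.2, h2.1, h2.2]

/-- All terms have the same sign because `ρ ≥ 0`, so the first one alone gives the lower bound. The
upper bound uses `q ^ l ≤ 1` and sums the geometric series in `1/2`. -/
theorem integral_squareSeries_mul (hq0 : 0 ≤ q) (hq1 : q < 1) (p : ℕ) {ρ L : ℝ} {h : ℝ → ℝ}
    (hρ : 0 ≤ ρ) (hL : 0 ≤ L) (hh : SlopesIn ρ L h) :
    ρ / (4 * 2 ^ p) ≤ -∫ x in (0 : ℝ)..1, squareSeries q (2 ^ p * x) * h x ∧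
      -∫ x in (0 : ℝ)..1, squareSeries q (2 ^ p * x) * h x ≤ L / (2 * 2 ^ p) := by
  have hi := hh.intervalIntegrable le_rfl zero_le_one le_rfl
  have hterm : ∀ l : ℕ, (fun x => q ^ l * squareWave (2 ^ l * (2 ^ p * x)) * h x) =
      fun x => q ^ l * (squareWave (2 ^ (p + l) * x) * h x) := fun l => by
    funext x
    rw [pow_add]
    ring_nf
  have hFi : ∀ l : ℕ, Integrable (fun x => q ^ l * (squareWave (2 ^ (p + l) * x) * h x))
      (volume.restrict (Set.Ioc 0 1)) := fun l => by
    refine Integrable.const_mul ?_ _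
    have := intervalIntegrable_bdd_mul (g := fun x => squareWave (2 ^ (p + l) * x)) (C := 1)
      (by fun_prop) (fun x => (abs_squareWave _).le) hi
    rwa [intervalIntegrable_iff_integrableOn_Ioc_of_le zero_le_one] at this
  have hsum : HasSum (fun l : ℕ => ∫ x in Set.Ioc (0 : ℝ) 1,
      q ^ l * (squareWave (2 ^ (p + l) * x) * h x))
      (∫ x in Set.Ioc (0 : ℝ) 1, ∑' l : ℕ, q ^ l * (squareWave (2 ^ (p + l) * x) * h x)) := by
    refine hasSum_integral_of_summable_integral_norm hFi ?_
    have e : ∀ l : ℕ, ∫ x in Set.Ioc (0 : ℝ) 1,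
        ‖q ^ l * (squareWave (2 ^ (p + l) * x) * h x)‖ =
        q ^ l * ∫ x in Set.Ioc (0 : ℝ) 1, ‖h x‖ := fun l => by
      rw [← integral_const_mul]
      congr 1
      funext x
      rw [norm_mul, norm_mul, Real.norm_eq_abs (squareWave _), abs_squareWave, one_mul,
        Real.norm_of_nonneg (by positivity)]
    simp_rw [e]
    exact (summable_geometric_of_lt_one hq0 hq1).mul_right _
  have e1 : ∀ x, ∑' l : ℕ, q ^ l * (squareWave (2 ^ (p + l) * x) * h x) =
      squareSeries q (2 ^ p * x) * h x := fun x => by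
    unfold squareSeries
    rw [← tsum_mul_right]
    exact tsum_congr fun l => (congrFun (hterm l) x).symm
  simp_rw [e1, integral_const_mul] at hsum
  simp_rw [← intervalIntegral.integral_of_le zero_le_one] at hsum
  have hsum' := hsum.neg
  have hl := fun l => integral_squareWave_pow_mul (p + l) hh
  constructor
  · have h1 := le_hasSum hsum' 0 fun l _ => by
      have := (hl l).1
      have h2 : 0 ≤ ρ / (4 * 2 ^ (p + l)) := by positivity
      rw [← mul_neg]
      exact mul_nonneg (by positivity) (h2.trans this)
    have h2 := (hl 0).1
    simp only [add_zero, pow_zero, one_mul] at h1 h2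
    linarith
  · have hgeo : HasSum (fun l : ℕ => L / (4 * 2 ^ p) * (1 / 2) ^ l) (L / (4 * 2 ^ p) * 2) :=
      hasSum_geometric_two.mul_left _
    have h1 := hasSum_le (fun l => ?_) hsum' hgeo
    · refine h1.trans_eq ?_
      field_simp
      norm_num
    · have h2 := (hl l).2
      rw [← mul_neg]
      have h3 : 0 ≤ L / (4 * 2 ^ (p + l)) := by positivity
      calc q ^ l * -∫ x in (0 : ℝ)..1, squareWave (2 ^ (p + l) * x) * h x
          ≤ q ^ l * (L / (4 * 2 ^ (p + l))) := by gcongr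
        _ ≤ 1 * (L / (4 * 2 ^ (p + l))) := by
            gcongr
            exact pow_le_one₀ hq0 hq1.le
        _ = _ := by
            rw [pow_add, one_div, inv_pow]
            field_simp

theorem integral_squareSeries (hq0 : 0 ≤ q) (hq1 : q < 1) :
    ∫ x in (0 : ℝ)..1, squareSeries q x = 0 := by
  -- A constant has slopes in `[0,0]`, so both bounds collapse to zero.
  have h := integral_squareSeries_mul hq0 hq1 0 (ρ := 0) (L := 0) (h := fun _ => 1) le_rfl le_rfl
    ⟨continuousOn_const, fun x y _ _ _ => by simp⟩
  simp only [pow_zero, one_mul, mul_one, zero_div] at h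
  linarith [h.1, h.2]

end FracBvM

/-! ### Projection onto histograms and the exact order of the bias. -/

namespace FracBvM

/-! ### Histograms off the grid -/

/-- `x` lies in the interior of the bin `j`. -/
def InBin (k : ℕ) (j : Fin k) (x : ℝ) : Prop := (j : ℝ) / k < x ∧ x < ((j : ℝ) + 1) / k

theorem InBin.mem_Ico {k : ℕ} {j : Fin k} {x : ℝ} (h : InBin k j x) : 0 ≤ x ∧ x < 1 := by
  have hk : (0 : ℝ) < k := by exact_mod_cast j.pos
  constructor
  · exact (div_nonneg (by positivity) hk.le).trans h.1.le
  · refine h.2.trans_le ((div_le_one hk).mpr ?_)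
    exact_mod_cast j.2

theorem InBin.eq_of_mem_bin {k : ℕ} {i j : Fin k} {x : ℝ} (h : InBin k j x) (hi : x ∈ bin k i) :
    i = j := by
  have hk : (0 : ℝ) < k := by exact_mod_cast j.pos
  obtain ⟨h1, h2⟩ := h
  obtain ⟨h3, h4⟩ := hi
  have h5 : (j : ℝ) < (i : ℝ) + 1 := (div_lt_div_iff_of_pos_right hk).mp (h1.trans_le h4)
  have h6 : (i : ℝ) < (j : ℝ) + 1 := (div_lt_div_iff_of_pos_right hk).mp (h3.trans_lt h2)
  have h7 : (j : ℕ) < i + 1 := by exact_mod_cast h5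
  have h8 : (i : ℕ) < j + 1 := by exact_mod_cast h6
  exact Fin.ext (by omega)

/-- Closed neighbouring bins share an endpoint, where a histogram adds two heights. Working in the
open bins discards only a null set. -/
theorem hist_of_inBin {k : ℕ} {j : Fin k} {x : ℝ} (h : InBin k j x) (ω : Fin k → ℝ) :
    hist k ω x = k * ω j := by
  unfold hist
  rw [Finset.sum_eq_single j, Set.indicator_of_mem (show x ∈ bin k j from ⟨h.1.le, h.2.le⟩)]
  · simp
  · intro i _ hi
    rw [Set.indicator_of_notMem fun hx => hi (h.eq_of_mem_bin hx), mul_zero]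
  · simp

theorem proj_of_inBin {k : ℕ} {j : Fin k} {x : ℝ} (h : InBin k j x) (g : ℝ → ℝ) :
    proj k g x = k * ∫ y in bin k j, g y := hist_of_inBin h _

theorem ae_exists_inBin {k : ℕ} (hk : 0 < k) :
    ∀ᵐ x ∂volume.restrict (Set.Icc (0 : ℝ) 1), ∃ j, InBin k j x := by
  have hk' : (0 : ℝ) < k := by exact_mod_cast hk
  rw [ae_restrict_iff' measurableSet_Icc]
  have h0 : (Set.range fun j : ℕ => (j : ℝ) / k).Countable := Set.countable_range _
  filter_upwards [h0.ae_notMem volume] with x hx h01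
  have hkx : 0 ≤ (k : ℝ) * x := mul_nonneg hk'.le h01.1
  have h1 := Nat.floor_le hkx
  have h2 := Nat.lt_floor_add_one ((k : ℝ) * x)
  have hx1 : x ≠ 1 := fun h => hx ⟨k, by simp only [h, div_self hk'.ne']⟩
  have hlt : ⌊(k : ℝ) * x⌋₊ < k := by
    have h3 : x < 1 := lt_of_le_of_ne h01.2 hx1
    have h4 : ((⌊(k : ℝ) * x⌋₊ : ℕ) : ℝ) < k := h1.trans_lt (by nlinarith)
    exact_mod_cast h4
  refine ⟨⟨_, hlt⟩, ?_, ?_⟩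
  · rw [div_lt_iff₀ hk', mul_comm x]
    refine lt_of_le_of_ne h1 fun h => hx ⟨⌊(k : ℝ) * x⌋₊, ?_⟩
    simp only [h]
    rw [mul_div_cancel_left₀ _ hk'.ne']
  · rw [lt_div_iff₀ hk', mul_comm x]
    exact h2

theorem setIntegral_bin {k : ℕ} (j : Fin k) (g : ℝ → ℝ) :
    ∫ x in bin k j, g x = ∫ x in ((j : ℝ) / k)..(((j : ℝ) + 1) / k), g x := by
  have hk : (0 : ℝ) < k := by exact_mod_cast j.pos
  unfold bin
  rw [integral_Icc_eq_integral_Ioc, intervalIntegral.integral_of_le]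
  gcongr
  linarith

theorem bin_subset {k : ℕ} (j : Fin k) : bin k j ⊆ Set.Icc 0 1 := by
  have hk : (0 : ℝ) < k := by exact_mod_cast j.pos
  refine Set.Icc_subset_Icc (by positivity) ((div_le_one hk).mpr ?_)
  exact_mod_cast j.2

theorem integ_hist {k : ℕ} {g : ℝ → ℝ} (hg : IntegrableOn g (Set.Icc 0 1)) (ω : Fin k → ℝ) :
    integ (hist k ω) g = ∑ j, ω j * (k * ∫ x in bin k j, g x) := by
  unfold integ hist
  have h1 : ∀ x, g x * (k * ∑ j, ω j * (bin k j).indicator 1 x) =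
      ∑ j, (k * ω j) * (bin k j).indicator g x := by
    intro x
    rw [Finset.mul_sum, Finset.mul_sum]
    refine Finset.sum_congr rfl fun j _ => ?_
    by_cases hx : x ∈ bin k j
    · rw [Set.indicator_of_mem hx, Set.indicator_of_mem hx, Pi.one_apply]
      ring
    · rw [Set.indicator_of_notMem hx, Set.indicator_of_notMem hx]
      ring
  simp_rw [h1]
  rw [integral_finsetSum]
  · refine Finset.sum_congr rfl fun j _ => ?_
    rw [integral_const_mul, setIntegral_indicator (show MeasurableSet (bin k j) from measurableSet_Icc),
      Set.inter_eq_right.mpr (bin_subset j)]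
    ring
  · intro j _
    exact Integrable.const_mul (Integrable.indicator hg measurableSet_Icc) _

/-! ### Bin averages of the Haar series -/

theorem two_rpow_neg_mem {γ : ℝ} (hγ : 0 < γ) : 0 ≤ (2 : ℝ) ^ (-γ) ∧ (2 : ℝ) ^ (-γ) < 1 :=
  ⟨by positivity, Real.rpow_lt_one_of_one_lt_of_neg one_lt_two (by linarith)⟩

theorem integrableOn_haarSeries {γ : ℝ} (hγ : 0 < γ) :
    IntegrableOn (haarSeries γ) (Set.Icc 0 1) := by
  obtain ⟨hq0, hq1⟩ := two_rpow_neg_mem hγ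
  have h1 : IntegrableOn (fun x => (2 : ℝ) ^ (1 / 2 + γ) + squareSeries ((2 : ℝ) ^ (-γ)) x)
      (Set.Icc (0 : ℝ) 1) := by
    refine Integrable.add (integrable_const _) ?_
    exact Integrable.of_bound (measurable_squareSeries hq0 hq1).aestronglyMeasurable _
      (ae_of_all _ (abs_squareSeries_le hq0 hq1))
  refine Integrable.congr h1 ?_
  filter_upwards [ae_exists_inBin one_pos] with x ⟨j, hj⟩
  exact (haarSeries_eq γ hj.mem_Ico.1 hj.mem_Ico.2).symm

theorem abs_haarSeries_le {γ : ℝ} (hγ : 0 < γ) {x : ℝ} (h0 : 0 ≤ x) (h1 : x < 1) :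
    |haarSeries γ x| ≤ (2 : ℝ) ^ (1 / 2 + γ) + (1 - (2 : ℝ) ^ (-γ))⁻¹ := by
  obtain ⟨hq0, hq1⟩ := two_rpow_neg_mem hγ
  rw [haarSeries_eq γ h0 h1]
  refine (abs_add_le _ _).trans ?_
  rw [abs_of_pos (by positivity : (0 : ℝ) < 2 ^ (1 / 2 + γ))]
  gcongr
  exact abs_squareSeries_le hq0 hq1 x

theorem integral_squareSeries_bin {q : ℝ} (hq0 : 0 ≤ q) (hq1 : q < 1) {k : ℕ} (j : Fin k) :
    ∫ x in ((j : ℝ) / k)..(((j : ℝ) + 1) / k), squareSeries q (k * x) = 0 := by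
  have hk : (0 : ℝ) < k := by exact_mod_cast j.pos
  rw [intervalIntegral.integral_comp_mul_left _ hk.ne', mul_div_cancel₀ _ hk.ne',
    mul_div_cancel₀ _ hk.ne']
  have h := intervalIntegral.integral_comp_add_right (a := 0) (b := 1) (squareSeries q) (j : ℝ)
  simp_rw [squareSeries_add_natCast] at h
  rw [integral_squareSeries hq0 hq1, zero_add, add_comm (1 : ℝ)] at h
  rw [← h, smul_zero]

theorem floor_of_inBin {p : ℕ} {j : Fin (2 ^ p)} {x : ℝ} (h : InBin (2 ^ p) j x) :
    ⌊(2 : ℝ) ^ p * x⌋ = (j : ℕ) := by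
  have hk : (0 : ℝ) < 2 ^ p := by positivity
  obtain ⟨h1, h2⟩ := h
  push_cast at h1 h2
  rw [div_lt_iff₀ hk] at h1
  rw [lt_div_iff₀ hk] at h2
  rw [Int.floor_eq_iff]
  push_cast
  constructor <;> linarith

/-- On a bin of level `p` the terms of frequency below `2 ^ p` are constant, and the remaining tail
is a square series running through one full period, hence of mean zero. Averaging therefore removes
exactly the tail. -/
theorem binAverage_haarSeries {γ : ℝ} (hγ : 0 < γ) {p : ℕ} {j : Fin (2 ^ p)} {x : ℝ}
    (h : InBin (2 ^ p) j x) :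
    ((2 ^ p : ℕ) : ℝ) * ∫ y in bin (2 ^ p) j, haarSeries γ y =
      haarSeries γ x - ((2 : ℝ) ^ (-γ)) ^ p * squareSeries ((2 : ℝ) ^ (-γ)) (2 ^ p * x) := by
  obtain ⟨hq0, hq1⟩ := two_rpow_neg_mem hγ
  set q := (2 : ℝ) ^ (-γ) with hq
  have hk : (0 : ℝ) < ((2 ^ p : ℕ) : ℝ) := by positivity
  set c := (2 : ℝ) ^ (1 / 2 + γ) + ∑ l ∈ Finset.range p, q ^ l * squareWave (2 ^ l * x) with hc
  have hloc : ∀ y, InBin (2 ^ p) j y →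
      haarSeries γ y = c + q ^ p * squareSeries q (((2 ^ p : ℕ) : ℝ) * y) := by
    intro y hy
    rw [haarSeries_eq γ hy.mem_Ico.1 hy.mem_Ico.2, squareSeries_eq_sum_add hq0 hq1 y p, ← add_assoc,
      hc]
    push_cast
    congr 2
    refine Finset.sum_congr rfl fun l hl => ?_
    rw [squareWave_congr_floor (Finset.mem_range.mp hl)
      ((floor_of_inBin hy).trans (floor_of_inBin h).symm)]
  have hle : (j : ℝ) / (2 ^ p : ℕ) ≤ ((j : ℝ) + 1) / (2 ^ p : ℕ) := by
    gcongr
    linarith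
  have h1 : ∫ y in ((j : ℝ) / (2 ^ p : ℕ))..(((j : ℝ) + 1) / (2 ^ p : ℕ)), haarSeries γ y =
      ∫ y in ((j : ℝ) / (2 ^ p : ℕ))..(((j : ℝ) + 1) / (2 ^ p : ℕ)),
        (c + q ^ p * squareSeries q (((2 ^ p : ℕ) : ℝ) * y)) := by
    refine intervalIntegral.integral_congr_ae ?_
    have h0 : ∀ᵐ y : ℝ, y ≠ ((j : ℝ) + 1) / (2 ^ p : ℕ) := by simp [ae_iff]
    filter_upwards [h0] with y hy hy2
    rw [Set.uIoc_of_le hle] at hy2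
    exact hloc y ⟨hy2.1, lt_of_le_of_ne hy2.2 hy⟩
  have hm : Measurable fun y => squareSeries q (((2 ^ p : ℕ) : ℝ) * y) :=
    (measurable_squareSeries hq0 hq1).comp (measurable_const_mul _)
  have hi : IntervalIntegrable (fun y => squareSeries q (((2 ^ p : ℕ) : ℝ) * y)) volume
      ((j : ℝ) / (2 ^ p : ℕ)) (((j : ℝ) + 1) / (2 ^ p : ℕ)) := by
    have := intervalIntegrable_bdd_mul (h := fun _ => 1) hm
      (fun y => abs_squareSeries_le hq0 hq1 _) (intervalIntegrable_const (c := (1 : ℝ))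
        (a := (j : ℝ) / (2 ^ p : ℕ)) (b := ((j : ℝ) + 1) / (2 ^ p : ℕ)))
    simpa only [mul_one] using this
  rw [setIntegral_bin, h1, intervalIntegral.integral_add intervalIntegrable_const
    (hi.const_mul _), intervalIntegral.integral_const_mul, integral_squareSeries_bin hq0 hq1,
    intervalIntegral.integral_const, hloc x h]
  push_cast
  simp only [smul_eq_mul]
  field_simp
  ring

theorem proj_influence_of_inBin {f₀ : ℝ → ℝ} {γ : ℝ} (hγ : 0 < γ) {p : ℕ} {j : Fin (2 ^ p)} {x : ℝ}
    (h : InBin (2 ^ p) j x) :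
    proj (2 ^ p) (influence f₀ (haarSeries γ)) x =
      ((2 ^ p : ℕ) : ℝ) * (∫ y in bin (2 ^ p) j, haarSeries γ y) - integ f₀ (haarSeries γ) := by
  rw [proj_of_inBin h]
  unfold influence
  have hk : (0 : ℝ) < ((2 ^ p : ℕ) : ℝ) := by positivity
  have hv : volume.real (bin (2 ^ p) j) = 1 / ((2 ^ p : ℕ) : ℝ) := by
    unfold bin
    rw [Real.volume_real_Icc_of_le (by gcongr; linarith)]
    ring
  have hfin : IntegrableOn (fun _ : ℝ => integ f₀ (haarSeries γ)) (bin (2 ^ p) j) :=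
    integrableOn_const (by unfold bin; simp)
  rw [integral_sub ((integrableOn_haarSeries hγ).mono_set (bin_subset j)) hfin,
    setIntegral_const, hv, smul_eq_mul]
  field_simp

/-! ### The law of one observation -/

/-- The law of one observation with density `f` on `[0,1]`. -/
def obsLaw (f : ℝ → ℝ) : Measure ℝ :=
  (volume.restrict (Set.Icc (0 : ℝ) 1)).withDensity fun x => ENNReal.ofReal (f x)

variable {f₀ : ℝ → ℝ}

theorem obsLaw_absolutelyContinuous : obsLaw f₀ ≪ volume.restrict (Set.Icc (0 : ℝ) 1) :=
  withDensity_absolutelyContinuous _ _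

theorem isProbabilityMeasure_obsLaw (hf : IsDensity f₀) : IsProbabilityMeasure (obsLaw f₀) := by
  obtain ⟨h0, h1, h2⟩ := hf
  constructor
  unfold obsLaw
  rw [withDensity_apply _ MeasurableSet.univ, Measure.restrict_univ,
    ← ofReal_integral_eq_lintegral_ofReal h1 ((ae_restrict_iff' measurableSet_Icc).mpr
      (ae_of_all _ h0)), h2, ENNReal.ofReal_one]

theorem integral_obsLaw (hf : IsDensity f₀) (g : ℝ → ℝ) : ∫ x, g x ∂obsLaw f₀ = integ f₀ g := by
  unfold obsLaw integ
  rw [integral_withDensity_eq_integral_toReal_smul₀ hf.2.1.aemeasurable.ennreal_ofReal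
    (ae_of_all _ fun _ => ENNReal.ofReal_lt_top)]
  refine setIntegral_congr_fun measurableSet_Icc fun x hx => ?_
  rw [ENNReal.toReal_ofReal (hf.1 x hx), smul_eq_mul, mul_comm]

theorem ae_obsLaw_exists_inBin {k : ℕ} (hk : 0 < k) : ∀ᵐ x ∂obsLaw f₀, ∃ j, InBin k j x :=
  obsLaw_absolutelyContinuous.ae_le (ae_exists_inBin hk)

theorem aestronglyMeasurable_haarSeries {γ : ℝ} (hγ : 0 < γ) :
    AEStronglyMeasurable (haarSeries γ) (obsLaw f₀) :=
  (integrableOn_haarSeries hγ).aestronglyMeasurable.mono_ac obsLaw_absolutelyContinuous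

theorem integrable_haarSeries (hf : IsDensity f₀) {γ : ℝ} (hγ : 0 < γ) :
    Integrable (haarSeries γ) (obsLaw f₀) := by
  have := isProbabilityMeasure_obsLaw hf
  refine Integrable.of_bound (aestronglyMeasurable_haarSeries hγ)
    ((2 : ℝ) ^ (1 / 2 + γ) + (1 - (2 : ℝ) ^ (-γ))⁻¹) ?_
  filter_upwards [ae_obsLaw_exists_inBin one_pos] with x ⟨j, hj⟩
  exact abs_haarSeries_le hγ hj.mem_Ico.1 hj.mem_Ico.2

theorem exists_slopesIn {ρ : ℝ} (hC1 : ContDiffOn ℝ 1 f₀ (Set.Icc 0 1))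
    (hderiv : ∀ x ∈ Set.Icc (0 : ℝ) 1, ρ < derivWithin f₀ (Set.Icc 0 1) x) :
    ∃ L, SlopesIn ρ L f₀ := by
  have hcd : ContinuousOn (derivWithin f₀ (Set.Icc 0 1)) (Set.Icc 0 1) :=
    hC1.continuousOn_derivWithin (uniqueDiffOn_Icc zero_lt_one) le_rfl
  obtain ⟨L, hL⟩ := (isCompact_Icc.image_of_continuousOn hcd).bddAbove
  have hd : DifferentiableOn ℝ f₀ (interior (Set.Icc 0 1)) :=
    (hC1.differentiableOn one_ne_zero).mono interior_subset
  have he : ∀ x ∈ interior (Set.Icc (0 : ℝ) 1), deriv f₀ x = derivWithin f₀ (Set.Icc 0 1) x :=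
    fun x hx => (derivWithin_of_mem_nhds (mem_interior_iff_mem_nhds.mp hx)).symm
  refine ⟨L, hC1.continuousOn, fun x y h0 hxy h1 => ⟨?_, ?_⟩⟩
  · exact Convex.mul_sub_le_image_sub_of_le_deriv (convex_Icc 0 1) hC1.continuousOn hd
      (fun z hz => by rw [he z hz]; exact (hderiv z (interior_subset hz)).le) x
      ⟨h0, hxy.trans h1⟩ y ⟨h0.trans hxy, h1⟩ hxy
  · exact Convex.image_sub_le_mul_sub_of_deriv_le (convex_Icc 0 1) hC1.continuousOn hd
      (fun z hz => by rw [he z hz]; exact hL ⟨z, interior_subset hz, rfl⟩) x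
      ⟨h0, hxy.trans h1⟩ y ⟨h0.trans hxy, h1⟩ hxy

/-- The influence function has mean zero under `f₀`, so the mean of its projection is minus the mean
of the removed tail. -/
theorem integ_proj_influence (hf : IsDensity f₀) {γ : ℝ} (hγ : 0 < γ) (p : ℕ) :
    integ f₀ (proj (2 ^ p) (influence f₀ (haarSeries γ))) =
      -(((2 : ℝ) ^ (-γ)) ^ p *
        ∫ x in (0 : ℝ)..1, squareSeries ((2 : ℝ) ^ (-γ)) (2 ^ p * x) * f₀ x) := by
  obtain ⟨hq0, hq1⟩ := two_rpow_neg_mem hγ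
  have := isProbabilityMeasure_obsLaw hf
  set q := (2 : ℝ) ^ (-γ) with hq
  have hm : Measurable fun y => squareSeries q (2 ^ p * y) :=
    (measurable_squareSeries hq0 hq1).comp (measurable_const_mul _)
  have hS : Integrable (fun x => squareSeries q (2 ^ p * x)) (obsLaw f₀) :=
    Integrable.of_bound hm.aestronglyMeasurable _ (ae_of_all _ fun x => abs_squareSeries_le hq0 hq1 _)
  have h1 : ∫ x, proj (2 ^ p) (influence f₀ (haarSeries γ)) x ∂obsLaw f₀ =
      ∫ x, (haarSeries γ x - q ^ p * squareSeries q (2 ^ p * x) - integ f₀ (haarSeries γ))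
        ∂obsLaw f₀ := by
    refine integral_congr_ae ?_
    filter_upwards [ae_obsLaw_exists_inBin (k := 2 ^ p) (by positivity)] with x ⟨j, hj⟩
    rw [proj_influence_of_inBin hγ hj, binAverage_haarSeries hγ hj]
  have h2 : Integrable (fun x => haarSeries γ x - q ^ p * squareSeries q (2 ^ p * x))
    (obsLaw f₀) := (integrable_haarSeries hf hγ).sub (hS.const_mul _)
  rw [← integral_obsLaw hf, h1, integral_sub h2 (integrable_const _),
    integral_sub (integrable_haarSeries hf hγ) (hS.const_mul _), integral_const_mul,
    integral_obsLaw hf, integral_obsLaw hf]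
  simp only [integral_const, probReal_univ, smul_eq_mul, one_mul]
  unfold integ
  rw [intervalIntegral.integral_of_le zero_le_one, ← integral_Icc_eq_integral_Ioc]
  ring

/-- The tail carries the factor `2^{-γp}`, and its integral against a function of bounded positive
slopes contributes a further `2^{-p}`. -/
theorem integ_proj_influence_bounds (hf : IsDensity f₀) {γ : ℝ} (hγ : 0 < γ) {ρ L : ℝ}
    (hρ : 0 ≤ ρ) (hL : 0 ≤ L) (hs : SlopesIn ρ L f₀) (p : ℕ) :
    ((2 : ℝ) ^ p) ^ (-(1 + γ)) * (ρ / 4) ≤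
        integ f₀ (proj (2 ^ p) (influence f₀ (haarSeries γ))) ∧
      integ f₀ (proj (2 ^ p) (influence f₀ (haarSeries γ))) ≤
        ((2 : ℝ) ^ p) ^ (-(1 + γ)) * (L / 2) := by
  obtain ⟨hq0, hq1⟩ := two_rpow_neg_mem hγ
  have h := integral_squareSeries_mul hq0 hq1 p hρ hL hs
  rw [integ_proj_influence hf hγ p, ← mul_neg]
  have hp : (0 : ℝ) < 2 ^ p := by positivity
  have e : ((2 : ℝ) ^ p) ^ (-(1 + γ)) = ((2 : ℝ) ^ (-γ)) ^ p * (2 ^ p)⁻¹ := by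
    rw [neg_add, add_comm, Real.rpow_add hp, Real.rpow_neg_one, ← Real.rpow_natCast,
      ← Real.rpow_natCast, ← Real.rpow_mul two_pos.le, ← Real.rpow_mul two_pos.le, mul_comm (-γ)]
  have hqp : 0 ≤ ((2 : ℝ) ^ (-γ)) ^ p := by positivity
  rw [e]
  constructor
  · calc ((2 : ℝ) ^ (-γ)) ^ p * (2 ^ p)⁻¹ * (ρ / 4) = ((2 : ℝ) ^ (-γ)) ^ p * (ρ / (4 * 2 ^ p)) := by
          field_simp
      _ ≤ _ := mul_le_mul_of_nonneg_left h.1 hqp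
  · calc _ ≤ ((2 : ℝ) ^ (-γ)) ^ p * (L / (2 * 2 ^ p)) := mul_le_mul_of_nonneg_left h.2 hqp
      _ = _ := by field_simp

end FracBvM

/-! ### Rates along `K_n` and laws of large numbers. -/

namespace FracBvM

/-! ### The number of bins -/

/-- The resolution level `p_n`, with `numBins n = 2 ^ level n`. -/
def level (n : ℕ) : ℕ := ⌊Real.log ((n : ℝ) ^ (1 / 3 : ℝ)) / Real.log 2⌋₊

theorem numBins_eq (n : ℕ) : numBins n = 2 ^ level n := rfl

theorem numBins_pos (n : ℕ) : 0 < numBins n := by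
  rw [numBins_eq]
  positivity

theorem cast_numBins (n : ℕ) : (numBins n : ℝ) = 2 ^ level n := by
  rw [numBins_eq]
  push_cast
  rfl

theorem numBins_le {n : ℕ} (hn : 1 ≤ n) : (2 : ℝ) ^ level n ≤ (n : ℝ) ^ (1 / 3 : ℝ) := by
  have hn' : (1 : ℝ) ≤ n := by exact_mod_cast hn
  have h2 : 0 < Real.log 2 := Real.log_pos one_lt_two
  have h1 : 1 ≤ (n : ℝ) ^ (1 / 3 : ℝ) := Real.one_le_rpow hn' (by norm_num)
  have h3 : (level n : ℝ) ≤ Real.log ((n : ℝ) ^ (1 / 3 : ℝ)) / Real.log 2 :=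
    Nat.floor_le (div_nonneg (Real.log_nonneg h1) h2.le)
  rw [le_div_iff₀ h2] at h3
  rw [← Real.rpow_natCast, ← Real.log_le_log_iff (by positivity) (by positivity),
    Real.log_rpow two_pos]
  exact h3

theorem lt_numBins {n : ℕ} (hn : 1 ≤ n) : (n : ℝ) ^ (1 / 3 : ℝ) / 2 ≤ (2 : ℝ) ^ level n := by
  have hn' : (1 : ℝ) ≤ n := by exact_mod_cast hn
  have h2 : 0 < Real.log 2 := Real.log_pos one_lt_two
  have h3 : Real.log ((n : ℝ) ^ (1 / 3 : ℝ)) / Real.log 2 < (level n : ℝ) + 1 :=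
    Nat.lt_floor_add_one _
  rw [div_lt_iff₀ h2] at h3
  rw [div_le_iff₀ two_pos, ← pow_succ, ← Real.rpow_natCast,
    ← Real.log_le_log_iff (by positivity) (by positivity), Real.log_rpow two_pos]
  push_cast
  exact h3.le

theorem tendsto_rpow_natCast_atTop {e : ℝ} (he : 0 < e) :
    Tendsto (fun n : ℕ => (n : ℝ) ^ e) atTop atTop :=
  (tendsto_rpow_atTop he).comp tendsto_natCast_atTop_atTop

theorem tendsto_rpow_natCast_zero {e : ℝ} (he : e < 0) :
    Tendsto (fun n : ℕ => (n : ℝ) ^ e) atTop (𝓝 0) := by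
  have := (tendsto_rpow_neg_atTop (neg_pos.mpr he)).comp tendsto_natCast_atTop_atTop
  simpa [Function.comp_def] using this

theorem tendsto_two_pow_level : Tendsto (fun n => (2 : ℝ) ^ level n) atTop atTop := by
  have h1 : Tendsto (fun n : ℕ => (n : ℝ) ^ (1 / 3 : ℝ) / 2) atTop atTop :=
    (tendsto_rpow_natCast_atTop (by norm_num)).atTop_div_const two_pos
  refine tendsto_atTop_mono' _ ?_ h1
  filter_upwards [eventually_ge_atTop 1] with n hn
  exact lt_numBins hn

/-- A bound on the oscillation of the representer over the bins. -/
def oscBound (γ : ℝ) (n : ℕ) : ℝ := ((2 : ℝ) ^ (-γ)) ^ level n * (1 - (2 : ℝ) ^ (-γ))⁻¹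

theorem oscBound_nonneg {γ : ℝ} (hγ : 0 < γ) (n : ℕ) : 0 ≤ oscBound γ n := by
  have h := (two_rpow_neg_mem hγ).2
  exact mul_nonneg (by positivity) (inv_nonneg.mpr (by linarith))

theorem oscBound_le {γ : ℝ} (hγ : 0 < γ) (n : ℕ) : oscBound γ n ≤ (1 - (2 : ℝ) ^ (-γ))⁻¹ := by
  obtain ⟨h0, h1⟩ := two_rpow_neg_mem hγ
  exact mul_le_of_le_one_left (inv_nonneg.mpr (by linarith)) (pow_le_one₀ h0 h1.le)

theorem tendsto_oscBound {γ : ℝ} (hγ : 0 < γ) : Tendsto (oscBound γ) atTop (𝓝 0) := by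
  have e : ∀ n, ((2 : ℝ) ^ (-γ)) ^ level n = ((2 : ℝ) ^ level n) ^ (-γ) := fun n => by
    rw [← Real.rpow_natCast, ← Real.rpow_natCast, ← Real.rpow_mul two_pos.le,
      ← Real.rpow_mul two_pos.le, mul_comm]
  have h1 := ((tendsto_rpow_neg_atTop hγ).comp tendsto_two_pow_level).mul_const
    (1 - (2 : ℝ) ^ (-γ))⁻¹
  rw [zero_mul] at h1
  refine h1.congr fun n => ?_
  unfold oscBound
  rw [e]
  rfl

/-! ### The bias -/

/-- The bias `F₀(ψ̃_{[K_n]})`. -/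
def bias (f₀ : ℝ → ℝ) (γ : ℝ) (n : ℕ) : ℝ :=
  integ f₀ (proj (numBins n) (influence f₀ (haarSeries γ)))

variable {f₀ : ℝ → ℝ} {γ : ℝ}

/-- The inequality `K_n ≤ n^{1/3}` bounds the bias below by a multiple of `n^{-(1+γ)/3}`, and `1/2 -
(1+γ)/3 = (1-2γ)/6`. -/
theorem le_sqrt_mul_bias (hf : IsDensity f₀) (hγ : 0 < γ) {ρ L : ℝ} (hρ : 0 ≤ ρ) (hL : 0 ≤ L)
    (hs : SlopesIn ρ L f₀) {n : ℕ} (hn : 1 ≤ n) :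
    (n : ℝ) ^ ((1 - 2 * γ) / 6) * (ρ / 4) ≤ √(n : ℝ) * bias f₀ γ n := by
  have hn0 : (0 : ℝ) < n := by exact_mod_cast hn
  have h := (integ_proj_influence_bounds hf hγ hρ hL hs (level n)).1
  have h1 : (n : ℝ) ^ (-(1 + γ) / 3) ≤ ((2 : ℝ) ^ level n) ^ (-(1 + γ)) := by
    have := Real.rpow_le_rpow_of_nonpos (by positivity) (numBins_le hn)
      (show -(1 + γ) ≤ 0 by linarith)
    rw [← Real.rpow_mul hn0.le] at this
    convert this using 2
    ring
  have e : (n : ℝ) ^ ((1 - 2 * γ) / 6) = √(n : ℝ) * (n : ℝ) ^ (-(1 + γ) / 3) := by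
    rw [Real.sqrt_eq_rpow, ← Real.rpow_add hn0]
    congr 1
    ring
  rw [e, mul_assoc]
  refine mul_le_mul_of_nonneg_left (le_trans ?_ h) (Real.sqrt_nonneg _)
  gcongr

/-- The factor `(1/2)^{-(1+γ)}` is the price of rounding to a power of two: only `K_n ≥ n^{1/3}/2`
is available. -/
theorem bias_le (hf : IsDensity f₀) (hγ : 0 < γ) {ρ L : ℝ} (hρ : 0 ≤ ρ) (hL : 0 ≤ L)
    (hs : SlopesIn ρ L f₀) {n : ℕ} (hn : 1 ≤ n) :
    bias f₀ γ n ≤ (n : ℝ) ^ (-(1 + γ) / 3) * ((1 / 2 : ℝ) ^ (-(1 + γ)) * (L / 2)) := by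
  have hn0 : (0 : ℝ) < n := by exact_mod_cast hn
  have h := (integ_proj_influence_bounds hf hγ hρ hL hs (level n)).2
  have h1 : ((2 : ℝ) ^ level n) ^ (-(1 + γ)) ≤
      (n : ℝ) ^ (-(1 + γ) / 3) * (1 / 2 : ℝ) ^ (-(1 + γ)) := by
    have := Real.rpow_le_rpow_of_nonpos (by positivity) (lt_numBins hn)
      (show -(1 + γ) ≤ 0 by linarith)
    rw [div_eq_mul_one_div, Real.mul_rpow (by positivity) (by norm_num),
      ← Real.rpow_mul hn0.le] at this
    convert this using 3
    ring
  refine h.trans ?_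
  rw [← mul_assoc]
  gcongr

theorem bias_nonneg (hf : IsDensity f₀) (hγ : 0 < γ) {ρ L : ℝ} (hρ : 0 ≤ ρ) (hL : 0 ≤ L)
    (hs : SlopesIn ρ L f₀) (n : ℕ) : 0 ≤ bias f₀ γ n :=
  le_trans (by positivity) (integ_proj_influence_bounds hf hγ hρ hL hs (level n)).1

/-! ### Convergence to zero in probability -/

/-- `X n → 0` in probability. -/
def TendstoZeroInProb (P : ∀ n : ℕ, Measure (Fin n → ℝ)) (X : ∀ n : ℕ, (Fin n → ℝ) → ℝ) : Prop :=
  ∀ ε : ℝ, 0 < ε → Tendsto (fun n => P n {y | ε ≤ |X n y|}) atTop (𝓝 0)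

section

variable {P : ∀ n : ℕ, Measure (Fin n → ℝ)} {X Y : ∀ n : ℕ, (Fin n → ℝ) → ℝ}

theorem TendstoZeroInProb.of_le (hY : TendstoZeroInProb P Y) {C : ℝ} (hC : 0 < C) {r : ℕ → ℝ}
    (hr : Tendsto r atTop (𝓝 0))
    (h : ∀ᶠ n in atTop, ∀ᵐ y ∂P n, |X n y| ≤ C * |Y n y| + r n) : TendstoZeroInProb P X := by
  intro ε hε
  refine tendsto_of_tendsto_of_tendsto_of_le_of_le' tendsto_const_nhds
    (hY (ε / (2 * C)) (by positivity)) (Eventually.of_forall fun _ => zero_le) ?_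
  filter_upwards [h, hr.eventually_lt_const (show 0 < ε / 2 by positivity)] with n hn hrn
  refine measure_mono_ae ?_
  filter_upwards [hn] with y hy hX
  have hX' : ε ≤ |X n y| := hX
  change ε / (2 * C) ≤ |Y n y|
  rw [div_le_iff₀ (by positivity)]
  nlinarith

theorem isLittleOP_inv_sqrt_iff :
    IsLittleOP P X (fun n => 1 / √(n : ℝ)) ↔
      TendstoZeroInProb P fun n y => √(n : ℝ) * X n y := by
  unfold IsLittleOP TendstoZeroInProb
  refine forall₂_congr fun ε hε => tendsto_congr' ?_
  filter_upwards [eventually_ge_atTop 1] with n hn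
  have hn0 : (0 : ℝ) < √(n : ℝ) := Real.sqrt_pos.mpr (by exact_mod_cast hn)
  congr 1
  ext y
  simp only [Set.mem_ofPred_eq]
  rw [mul_one_div, div_le_iff₀ hn0, abs_mul, abs_of_pos hn0, mul_comm]

end

/-! ### Chebyshev's inequality for empirical means -/

theorem sampleLaw_eq (f₀ : ℝ → ℝ) (n : ℕ) : sampleLaw f₀ n = Measure.pi fun _ => obsLaw f₀ := rfl

theorem isProbabilityMeasure_sampleLaw (hf : IsDensity f₀) (n : ℕ) :
    IsProbabilityMeasure (sampleLaw f₀ n) := by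
  have := isProbabilityMeasure_obsLaw hf
  rw [sampleLaw_eq]
  infer_instance

theorem ae_sampleLaw_forall (hf : IsDensity f₀) {n : ℕ} {p : ℝ → Prop}
    (h : ∀ᵐ x ∂obsLaw f₀, p x) : ∀ᵐ y ∂sampleLaw f₀ n, ∀ i, p (y i) := by
  have := isProbabilityMeasure_obsLaw hf
  rw [ae_all_iff]
  intro i
  exact (measurePreserving_eval (fun _ : Fin n => obsLaw f₀) i).quasiMeasurePreserving.ae h

/-- Chebyshev's inequality with an explicit bound, so that `h`, `H` and `ε` may vary with `n`. -/
theorem sampleLaw_mean_ge_le (hf : IsDensity f₀) {h : ℝ → ℝ} {H : ℝ}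
    (hm : AEStronglyMeasurable h (obsLaw f₀)) (hH : ∀ᵐ x ∂obsLaw f₀, |h x| ≤ H) {n : ℕ}
    (hn : 1 ≤ n) {ε : ℝ} (hε : 0 < ε) :
    sampleLaw f₀ n {y | ε ≤ |(∑ i, h (y i)) / n - integ f₀ h|} ≤
      ENNReal.ofReal (H ^ 2 / (n * ε ^ 2)) := by
  have := isProbabilityMeasure_obsLaw hf
  have := isProbabilityMeasure_sampleLaw hf n
  have hn0 : (0 : ℝ) < n := by exact_mod_cast hn
  have hL : MemLp h 2 (obsLaw f₀) := MemLp.of_bound hm H hH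
  have hLi : ∀ i : Fin n, MemLp (fun y : Fin n → ℝ => h (y i)) 2 (sampleLaw f₀ n) := fun i =>
    hL.comp_measurePreserving (measurePreserving_eval (fun _ : Fin n => obsLaw f₀) i)
  have hS : MemLp (fun y : Fin n → ℝ => ∑ i, h (y i)) 2 (sampleLaw f₀ n) :=
    memLp_finsetSum _ fun i _ => hLi i
  have hmean : ∫ y, ∑ i, h (y i) ∂sampleLaw f₀ n = n * integ f₀ h := by
    rw [integral_finsetSum _ fun i _ => (hLi i).integrable one_le_two]
    have : ∀ i : Fin n, ∫ y, h (y i) ∂sampleLaw f₀ n = integ f₀ h := fun i => by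
      rw [← integral_obsLaw hf]
      exact integral_comp_eval (μ := fun _ : Fin n => obsLaw f₀) (i := i) hm
    simp [this]
  have hvar : Var[fun y : Fin n → ℝ => ∑ i, h (y i); sampleLaw f₀ n] ≤ n * H ^ 2 := by
    have h1 := variance_sum_pi (μ := fun _ : Fin n => obsLaw f₀) (X := fun _ => h) fun _ => hL
    have e : (∑ i : Fin n, fun ω : Fin n → ℝ => h (ω i)) = fun y => ∑ i, h (y i) := by
      funext y
      simp
    rw [e] at h1
    rw [sampleLaw_eq, h1]
    simp only [Finset.sum_const, Finset.card_univ, Fintype.card_fin, nsmul_eq_mul]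
    gcongr
    refine (variance_le_expectation_sq hm).trans ?_
    have h2 : ∫ x, (h ^ 2) x ∂obsLaw f₀ ≤ ∫ _, H ^ 2 ∂obsLaw f₀ := by
      refine integral_mono_ae hL.integrable_sq (integrable_const _) ?_
      filter_upwards [hH] with x hx
      simp only [Pi.pow_apply]
      rw [← sq_abs]
      exact pow_le_pow_left₀ (abs_nonneg _) hx 2
    simpa using h2
  have hcheb := meas_ge_le_variance_div_sq hS (show 0 < n * ε by positivity)
  rw [hmean] at hcheb
  have hset : {y : Fin n → ℝ | ε ≤ |(∑ i, h (y i)) / n - integ f₀ h|} =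
      {y | n * ε ≤ |∑ i, h (y i) - n * integ f₀ h|} := by
    ext y
    simp only [Set.mem_ofPred_eq]
    have e : ∑ i, h (y i) - n * integ f₀ h = n * ((∑ i, h (y i)) / n - integ f₀ h) := by
      field_simp
    rw [e, abs_mul, abs_of_pos hn0, mul_le_mul_iff_right₀ hn0]
  rw [hset]
  refine hcheb.trans (ENNReal.ofReal_le_ofReal ?_)
  rw [div_le_div_iff₀ (by positivity) (by positivity)]
  nlinarith [mul_le_mul_of_nonneg_right hvar (show 0 ≤ n * ε ^ 2 by positivity)]

theorem tendstoZeroInProb_mean (hf : IsDensity f₀) {h : ℝ → ℝ} {H : ℝ}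
    (hm : AEStronglyMeasurable h (obsLaw f₀)) (hH : ∀ᵐ x ∂obsLaw f₀, |h x| ≤ H) :
    TendstoZeroInProb (sampleLaw f₀) fun n y => (∑ i, h (y i)) / n - integ f₀ h := by
  intro ε hε
  have h1 : Tendsto (fun n : ℕ => ENNReal.ofReal (H ^ 2 / (n * ε ^ 2))) atTop (𝓝 0) := by
    rw [← ENNReal.ofReal_zero]
    refine ENNReal.tendsto_ofReal (tendsto_const_nhds.div_atTop ?_)
    exact tendsto_natCast_atTop_atTop.atTop_mul_const (by positivity)
  refine tendsto_of_tendsto_of_tendsto_of_le_of_le' tendsto_const_nhds h1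
    (Eventually.of_forall fun _ => zero_le) ?_
  filter_upwards [eventually_ge_atTop 1] with n hn
  exact sampleLaw_mean_ge_le hf hm hH hn hε

end FracBvM

/-! ### The uniform posterior limit theorem and the two centrings. -/

namespace FracBvM

variable {f₀ : ℝ → ℝ} {γ : ℝ}

/-! ### The posterior is a Dirichlet distribution -/

/-- The average of the representer over the bin `j`. -/
def binAverage (γ : ℝ) (k : ℕ) (j : Fin k) : ℝ := k * ∫ x in bin k j, haarSeries γ x

theorem histPosteriorLaw_eq (hγ : 0 < γ) {n k : ℕ} (hn : 0 < n) (hk : 0 < k) {δ : Fin k → ℝ}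
    (hδ : ∀ j, 0 < δ j) {α : ℝ} (hα : 0 < α) {y : Fin n → ℝ} {J : Fin n → Fin k}
    (hJ : ∀ i, InBin k (J i) (y i)) (v m : ℝ) :
    histPosteriorLaw (haarSeries γ) δ α y v m =
      (dirichlet fun j => δ j + α * count J j).map
        fun ω => v * (∑ j, ω j * binAverage γ k j - m) := by
  unfold histPosteriorLaw
  have h1 : (fun ω : Fin k → ℝ => ∏ i, hist k ω (y i)) = fun ω => ∏ i, (k : ℝ) * ω (J i) := by
    funext ω
    exact Finset.prod_congr rfl fun i _ => hist_of_inBin (hJ i) ω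
  rw [h1, fracPosterior_dirichlet hn hk J hδ hα (by exact_mod_cast hk)]
  congr 1
  funext ω
  rw [integ_hist (integrableOn_haarSeries hγ)]
  rfl

theorem ae_exists_inBin_sample (hf : IsDensity f₀) (n : ℕ) {k : ℕ} (hk : 0 < k) :
    ∀ᵐ y ∂sampleLaw f₀ n, ∃ J : Fin n → Fin k, ∀ i, InBin k (J i) (y i) := by
  filter_upwards [ae_sampleLaw_forall hf (ae_obsLaw_exists_inBin hk)] with y hy
  exact ⟨fun i => (hy i).choose, fun i => (hy i).choose_spec⟩

/-! ### A uniform central limit theorem for the posterior -/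

/-- The total prior weight is negligible against the posterior scale. The exponent is negative
because `1/3 - b < 1/6 < (1 - x)/2`. -/
theorem tendsto_numBins_rpow {b x : ℝ} (hb : 1 / 6 < b) (hx : x < 2 / 3) :
    Tendsto (fun n : ℕ => (numBins n : ℝ) * (n : ℝ) ^ (-b) / √((n : ℝ) * (n : ℝ) ^ (-x)))
      atTop (𝓝 0) := by
  have h1 := tendsto_rpow_natCast_zero (e := 1 / 3 - b - (1 - x) / 2) (by linarith)
  refine squeeze_zero' (Eventually.of_forall fun n => by positivity) ?_ h1
  filter_upwards [eventually_ge_atTop 1] with n hn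
  have hn0 : (0 : ℝ) < n := by exact_mod_cast hn
  have e1 : √((n : ℝ) * (n : ℝ) ^ (-x)) = (n : ℝ) ^ ((1 - x) / 2) := by
    rw [← Real.rpow_one_add' hn0.le (by linarith), Real.sqrt_eq_rpow, ← Real.rpow_mul hn0.le]
    congr 1
    ring
  rw [e1, Real.rpow_sub hn0, sub_eq_add_neg (1 / 3 : ℝ) b, Real.rpow_add hn0, cast_numBins]
  gcongr
  exact numBins_le hn

theorem tendsto_natCast_mul_rpow {x : ℝ} (hx : x < 2 / 3) :
    Tendsto (fun n : ℕ => (n : ℝ) * (n : ℝ) ^ (-x)) atTop atTop := by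
  refine (tendsto_rpow_natCast_atTop (e := 1 - x) (by linarith)).congr' ?_
  filter_upwards [eventually_ge_atTop 1] with n hn
  have hn0 : (0 : ℝ) < n := by exact_mod_cast hn
  rw [sub_eq_add_neg, Real.rpow_add hn0, Real.rpow_one]

/-- A deterministic statement uniform in the allocation `J`, the values `a` and the centring `m`; it
turns the central limit theorem into a bound on events of the sample space without any extraction of
almost sure subsequences. -/
theorem exists_dBL_dirichlet_lt {b x : ℝ} (hb : 1 / 6 < b) (hx : x < 2 / 3) (A V : ℝ) {ε : ℝ≥0∞}
    (hε : 0 < ε) :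
    ∃ η : ℝ, 0 < η ∧ ∃ N : ℕ, ∀ n, N ≤ n → ∀ (J : Fin n → Fin (numBins n))
      (a : Fin (numBins n) → ℝ) (m : ℝ), (∀ j, |a j - m| ≤ A) →
      |√((n : ℝ) * (n : ℝ) ^ (-x)) * ((∑ i, a (J i)) / n - m)| ≤ η →
      |(∑ i, (a (J i) - m) ^ 2) / n - V| ≤ η →
      dBL ((dirichlet fun j => (n : ℝ) ^ (-b) + (n : ℝ) ^ (-x) * count J j).map
        fun ω => √((n : ℝ) * (n : ℝ) ^ (-x)) * (∑ j, ω j * a j - m))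
        (gaussianReal 0 V.toNNReal) < ε := by
  -- Failure would give, for tolerances `1/(i+1)`, counterexamples with sample sizes tending to
  -- infinity; along them `tendsto_dBL_dirichlet` applies and yields a contradiction.
  by_contra! hcon
  have h1 : ∀ i : ℕ, ∃ n, i + 1 ≤ n ∧ ∃ (J : Fin n → Fin (numBins n))
      (a : Fin (numBins n) → ℝ) (m : ℝ), (∀ j, |a j - m| ≤ A) ∧
      |√((n : ℝ) * (n : ℝ) ^ (-x)) * ((∑ i, a (J i)) / n - m)| ≤ 1 / ((i : ℝ) + 1) ∧
      |(∑ i, (a (J i) - m) ^ 2) / n - V| ≤ 1 / ((i : ℝ) + 1) ∧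
      ε ≤ dBL ((dirichlet fun j => (n : ℝ) ^ (-b) + (n : ℝ) ^ (-x) * count J j).map
        fun ω => √((n : ℝ) * (n : ℝ) ^ (-x)) * (∑ j, ω j * a j - m))
        (gaussianReal 0 V.toNNReal) := fun i => by
    obtain ⟨n, hn, J, a, m, h⟩ := hcon (1 / ((i : ℝ) + 1)) (by positivity) (i + 1)
    exact ⟨n, hn, J, a, m, h⟩
  choose n hn J a m hA hmean hvar hd using h1
  have hnt : Tendsto n atTop atTop :=
    tendsto_atTop_mono (fun i => (Nat.le_succ i).trans (hn i)) tendsto_id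
  have hn0 : ∀ i, (0 : ℝ) < n i := fun i => by
    have := hn i
    exact_mod_cast (by omega : 0 < n i)
  set s : ℕ → ℝ := fun i => (n i : ℝ) * (n i : ℝ) ^ (-x) with hsdef
  have hs0 : ∀ i, 0 < s i := fun i => by have := hn0 i; positivity
  have hs : Tendsto s atTop atTop := (tendsto_natCast_mul_rpow hx).comp hnt
  have hsq : Tendsto (fun i => √(s i)) atTop atTop := Real.tendsto_sqrt_atTop.comp hs
  -- The ratio of prior mass to `√s`; every prior contribution to the three limits is bounded in
  -- terms of it.
  set r : ℕ → ℝ := fun i => (numBins (n i) : ℝ) * (n i : ℝ) ^ (-b) / √(s i) with hrdef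
  have hr : Tendsto r atTop (𝓝 0) := (tendsto_numBins_rpow hb hx).comp hnt
  have hr0 : ∀ i, 0 ≤ r i := fun i => by positivity
  have hrs : Tendsto (fun i => r i / √(s i)) atTop (𝓝 0) := hr.div_atTop hsq
  have hss : ∀ i, √(s i) * √(s i) = s i := fun i => Real.mul_self_sqrt (hs0 i).le
  have hsn : ∀ i, (n i : ℝ) ^ (-x) = s i / n i := fun i => by
    have := hn0 i
    simp only [hsdef]
    field_simp
  have hone : Tendsto (fun i : ℕ => 1 / ((i : ℝ) + 1)) atTop (𝓝 0) :=
    tendsto_one_div_add_atTop_nhds_zero_nat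
  have hβsum : ∀ i (φ : Fin (numBins (n i)) → ℝ),
      ∑ j, ((n i : ℝ) ^ (-b) + (n i : ℝ) ^ (-x) * count (J i) j) * φ j =
        (n i : ℝ) ^ (-b) * ∑ j, φ j + s i / n i * ∑ l, φ (J i l) := fun i φ => by
    rw [← sum_count_mul (J i) φ, ← hsn, Finset.mul_sum, Finset.mul_sum, ← Finset.sum_add_distrib]
    exact Finset.sum_congr rfl fun j _ => by ring
  have hbd : ∀ i (φ : Fin (numBins (n i)) → ℝ) (C : ℝ), (∀ j, |φ j| ≤ C) →
      |(n i : ℝ) ^ (-b) * ∑ j, φ j| ≤ r i * √(s i) * C := fun i φ C hC => by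
    have h2 : |∑ j, φ j| ≤ numBins (n i) * C := by
      refine (Finset.abs_sum_le_sum_abs _ _).trans ((Finset.sum_le_sum fun j _ => hC j).trans ?_)
      simp
    have h3 : r i * √(s i) = numBins (n i) * (n i : ℝ) ^ (-b) := by
      simp only [hrdef]
      have := Real.sqrt_pos.mpr (hs0 i)
      field_simp
    rw [abs_mul, abs_of_nonneg (by positivity), h3]
    calc _ ≤ (n i : ℝ) ^ (-b) * (numBins (n i) * C) := by gcongr
      _ = _ := by ring
  have hfin := tendsto_dBL_dirichlet (k := fun i => numBins (n i))
    (β := fun i j => (n i : ℝ) ^ (-b) + (n i : ℝ) ^ (-x) * count (J i) j) (a := a) (m := m)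
    (A := A) (V := V) (s := s) (fun i => numBins_pos _)
    (fun i j => by have := hn0 i; positivity) hA hs ?_ ?_ ?_
  · obtain ⟨i, hi⟩ := (hfin.eventually_lt_const hε).exists
    exact absurd (hd i) (not_le.mpr hi)
  · have h2 : ∀ i, (∑ j, ((n i : ℝ) ^ (-b) + (n i : ℝ) ^ (-x) * count (J i) j)) / s i =
        r i / √(s i) + 1 := fun i => by
      have h3 := hβsum i fun _ => 1
      simp only [mul_one, Finset.sum_const, Finset.card_univ, Fintype.card_fin, nsmul_eq_mul] at h3
      rw [h3]
      simp only [hrdef]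
      rw [div_div, hss]
      have := hn0 i
      have := hs0 i
      field_simp
    simp_rw [h2]
    simpa using hrs.add_const 1
  · have h2 : Tendsto (fun i => r i * A + 1 / ((i : ℝ) + 1)) atTop (𝓝 0) := by
      simpa using (hr.mul_const A).add hone
    refine squeeze_zero_norm (fun i => ?_) h2
    have h3 := hbd i (fun j => a i j - m i) A (hA i)
    have hsi := Real.sqrt_pos.mpr (hs0 i)
    have h4 : (s i / n i * ∑ l, (a i (J i l) - m i)) / √(s i) =
        √(s i) * ((∑ l, a i (J i l)) / n i - m i) := by
      rw [Finset.sum_sub_distrib]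
      simp only [Finset.sum_const, Finset.card_univ, Fintype.card_fin, nsmul_eq_mul]
      have := hn0 i
      rw [div_eq_iff hsi.ne', mul_right_comm, hss]
      field_simp
    rw [hβsum, add_div, h4, Real.norm_eq_abs]
    refine (abs_add_le _ _).trans (add_le_add ?_ (hmean i))
    rw [abs_div, abs_of_pos hsi, div_le_iff₀ hsi]
    linarith
  · have h2 : Tendsto (fun i => r i / √(s i) * A ^ 2 + 1 / ((i : ℝ) + 1)) atTop (𝓝 0) := by
      simpa using (hrs.mul_const (A ^ 2)).add hone
    rw [tendsto_iff_norm_sub_tendsto_zero]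
    refine squeeze_zero (fun i => norm_nonneg _) (fun i => ?_) h2
    have h3 := hbd i (fun j => (a i j - m i) ^ 2) (A ^ 2) fun j => by
      rw [abs_of_nonneg (sq_nonneg _), ← sq_abs]
      exact pow_le_pow_left₀ (abs_nonneg _) (hA i j) 2
    have hsi := Real.sqrt_pos.mpr (hs0 i)
    have h4 : (s i / n i * ∑ l, (a i (J i l) - m i) ^ 2) / s i =
        (∑ l, (a i (J i l) - m i) ^ 2) / n i := by
      have := hn0 i
      have := hs0 i
      field_simp
    rw [hβsum, add_div, h4, Real.norm_eq_abs, add_sub_assoc]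
    refine (abs_add_le _ _).trans (add_le_add ?_ (hvar i))
    rw [abs_div, abs_of_pos (hs0 i), div_le_iff₀ (hs0 i)]
    refine h3.trans_eq ?_
    nth_rw 3 [← hss i]
    field_simp

/-! ### Comparison of the centrings -/

/-- A bound on the representer. -/
def supBound (γ : ℝ) : ℝ := (2 : ℝ) ^ (1 / 2 + γ) + (1 - (2 : ℝ) ^ (-γ))⁻¹

theorem abs_haarSeries_le_of_inBin (hγ : 0 < γ) {k : ℕ} {j : Fin k} {x : ℝ} (h : InBin k j x) :
    |haarSeries γ x| ≤ supBound γ := abs_haarSeries_le hγ h.mem_Ico.1 h.mem_Ico.2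

theorem abs_binAverage_sub_le (hγ : 0 < γ) {n : ℕ} {j : Fin (numBins n)} {x : ℝ}
    (h : InBin (numBins n) j x) : |binAverage γ (numBins n) j - haarSeries γ x| ≤ oscBound γ n := by
  obtain ⟨hq0, hq1⟩ := two_rpow_neg_mem hγ
  have h1 : binAverage γ (numBins n) j = _ := binAverage_haarSeries (p := level n) hγ h
  rw [h1, sub_sub_cancel_left, abs_neg, abs_mul, abs_of_nonneg (by positivity)]
  exact mul_le_mul_of_nonneg_left (abs_squareSeries_le hq0 hq1 _) (by positivity)

theorem abs_binAverage_le (hγ : 0 < γ) {n : ℕ} (j : Fin (numBins n)) :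
    |binAverage γ (numBins n) j| ≤ supBound γ + oscBound γ n := by
  have hk : (0 : ℝ) < numBins n := by exact_mod_cast numBins_pos n
  -- The midpoint serves as a point of the open bin at which the average is compared with the
  -- representer.
  have h : InBin (numBins n) j (((j : ℝ) + 1 / 2) / numBins n) :=
    ⟨by gcongr; linarith, by gcongr; norm_num⟩
  have h1 := abs_binAverage_sub_le hγ h
  have h2 := abs_haarSeries_le_of_inBin hγ h
  have h3 := abs_add_le (binAverage γ (numBins n) j - haarSeries γ (((j : ℝ) + 1 / 2) / numBins n))
    (haarSeries γ (((j : ℝ) + 1 / 2) / numBins n))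
  rw [sub_add_cancel] at h3
  linarith

theorem psiHat_eq {n : ℕ} (hn : 1 ≤ n) (y : Fin n → ℝ) :
    psiHat f₀ (haarSeries γ) n y = (∑ i, haarSeries γ (y i)) / n := by
  have hn0 : (0 : ℝ) < n := by exact_mod_cast hn
  unfold psiHat centring influence
  rw [Finset.sum_sub_distrib]
  simp only [Finset.sum_const, Finset.card_univ, Fintype.card_fin, nsmul_eq_mul]
  field_simp
  ring

theorem psiHatProj_eq (hγ : 0 < γ) {n : ℕ} (hn : 1 ≤ n) {y : Fin n → ℝ}
    {J : Fin n → Fin (numBins n)} (hJ : ∀ i, InBin (numBins n) (J i) (y i)) :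
    psiHatProj f₀ (haarSeries γ) (numBins n) n y =
      (∑ i, binAverage γ (numBins n) (J i)) / n := by
  have hn0 : (0 : ℝ) < n := by exact_mod_cast hn
  unfold psiHatProj centring
  have h1 : ∀ i, proj (numBins n) (influence f₀ (haarSeries γ)) (y i) =
      binAverage γ (numBins n) (J i) - integ f₀ (haarSeries γ) := fun i =>
    proj_influence_of_inBin (p := level n) hγ (hJ i)
  simp_rw [h1]
  rw [Finset.sum_sub_distrib]
  simp only [Finset.sum_const, Finset.card_univ, Fintype.card_fin, nsmul_eq_mul]
  field_simp
  ring

theorem abs_sum_div_le {n : ℕ} (hn : 1 ≤ n) {φ : Fin n → ℝ} {C : ℝ} (h : ∀ i, |φ i| ≤ C) :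
    |(∑ i, φ i) / n| ≤ C := by
  have hn0 : (0 : ℝ) < n := by exact_mod_cast hn
  rw [abs_div, abs_of_pos hn0, div_le_iff₀ hn0]
  refine (Finset.abs_sum_le_sum_abs _ _).trans ((Finset.sum_le_sum fun i _ => h i).trans_eq ?_)
  simp [mul_comm]

theorem abs_psiHatProj_sub_psiHat_le (hγ : 0 < γ) {n : ℕ} (hn : 1 ≤ n) {y : Fin n → ℝ}
    {J : Fin n → Fin (numBins n)} (hJ : ∀ i, InBin (numBins n) (J i) (y i)) :
    |psiHatProj f₀ (haarSeries γ) (numBins n) n y - psiHat f₀ (haarSeries γ) n y| ≤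
      oscBound γ n := by
  rw [psiHatProj_eq hγ hn hJ, psiHat_eq hn, ← sub_div, ← Finset.sum_sub_distrib]
  exact abs_sum_div_le hn fun i => abs_binAverage_sub_le hγ (hJ i)

theorem abs_integ_haarSeries_le (hf : IsDensity f₀) (hγ : 0 < γ) :
    |integ f₀ (haarSeries γ)| ≤ supBound γ := by
  have := isProbabilityMeasure_obsLaw hf
  rw [← integral_obsLaw hf]
  have h : ∀ᵐ x ∂obsLaw f₀, ‖haarSeries γ x‖ ≤ supBound γ := by
    filter_upwards [ae_obsLaw_exists_inBin one_pos] with x ⟨j, hj⟩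
    exact abs_haarSeries_le_of_inBin hγ hj
  simpa using norm_integral_le_of_norm_le_const h

theorem abs_influence_le (hf : IsDensity f₀) (hγ : 0 < γ) {k : ℕ} {j : Fin k} {x : ℝ}
    (h : InBin k j x) : |influence f₀ (haarSeries γ) x| ≤ 2 * supBound γ := by
  have h1 := abs_haarSeries_le_of_inBin hγ h
  have h2 := abs_integ_haarSeries_le hf hγ
  have h3 := abs_sub (haarSeries γ x) (integ f₀ (haarSeries γ))
  unfold influence
  linarith

theorem tendstoZeroInProb_psiHat (hf : IsDensity f₀) (hγ : 0 < γ) :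
    TendstoZeroInProb (sampleLaw f₀) fun n y =>
      psiHat f₀ (haarSeries γ) n y - integ f₀ (haarSeries γ) := by
  have hH : ∀ᵐ x ∂obsLaw f₀, |haarSeries γ x| ≤ supBound γ := by
    filter_upwards [ae_obsLaw_exists_inBin one_pos] with x ⟨j, hj⟩
    exact abs_haarSeries_le_of_inBin hγ hj
  refine (tendstoZeroInProb_mean hf (aestronglyMeasurable_haarSeries hγ) hH).of_le one_pos
    (tendsto_const_nhds (x := (0 : ℝ))) ?_
  filter_upwards [eventually_ge_atTop 1] with n hn
  refine ae_of_all _ fun y => ?_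
  rw [psiHat_eq hn]
  simp

theorem tendstoZeroInProb_variance (hf : IsDensity f₀) (hγ : 0 < γ) :
    TendstoZeroInProb (sampleLaw f₀) fun n y =>
      (∑ i, influence f₀ (haarSeries γ) (y i) ^ 2) / n -
        integ f₀ (fun x => influence f₀ (haarSeries γ) x ^ 2) := by
  refine tendstoZeroInProb_mean hf (h := fun x => influence f₀ (haarSeries γ) x ^ 2)
    (H := (2 * supBound γ) ^ 2) ?_ ?_
  · exact ((aestronglyMeasurable_haarSeries hγ).sub aestronglyMeasurable_const).pow 2
  · filter_upwards [ae_obsLaw_exists_inBin one_pos] with x ⟨j, hj⟩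
    rw [abs_pow]
    exact pow_le_pow_left₀ (abs_nonneg _) (abs_influence_le hf hγ hj) 2

/-- The two centrings differ by the empirical mean of `D`, whose expectation is the bias. Since `D`
is bounded by `oscBound γ n`, which tends to `0`, its fluctuations are `o_P(1/√n)`. -/
theorem tendstoZeroInProb_expansion (hf : IsDensity f₀) (hγ : 0 < γ) :
    TendstoZeroInProb (sampleLaw f₀) fun n y => √(n : ℝ) *
      (psiHatProj f₀ (haarSeries γ) (numBins n) n y - psiHat f₀ (haarSeries γ) n y -
        bias f₀ γ n) := by
  intro ε hε
  have := isProbabilityMeasure_obsLaw hf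
  have h1 : Tendsto (fun n : ℕ => ENNReal.ofReal (oscBound γ n ^ 2 / ε ^ 2)) atTop (𝓝 0) := by
    rw [← ENNReal.ofReal_zero]
    refine ENNReal.tendsto_ofReal ?_
    simpa using ((tendsto_oscBound hγ).pow 2).div_const (ε ^ 2)
  refine tendsto_of_tendsto_of_tendsto_of_le_of_le' tendsto_const_nhds h1
    (Eventually.of_forall fun _ => zero_le) ?_
  filter_upwards [eventually_ge_atTop 1] with n hn
  have hn0 : (0 : ℝ) < n := by exact_mod_cast hn
  have hsn := Real.sqrt_pos.mpr hn0
  set D : ℝ → ℝ := fun x => proj (numBins n) (influence f₀ (haarSeries γ)) x -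
    influence f₀ (haarSeries γ) x with hD
  have hDb : ∀ᵐ x ∂obsLaw f₀, |D x| ≤ oscBound γ n := by
    filter_upwards [ae_obsLaw_exists_inBin (numBins_pos n)] with x ⟨j, hj⟩
    have h2 := proj_influence_of_inBin (f₀ := f₀) (p := level n) hγ hj
    have h3 := abs_binAverage_sub_le hγ hj
    have h4 : D x = binAverage γ (numBins n) j - haarSeries γ x := by
      simp only [hD, numBins_eq]
      rw [h2]
      unfold influence binAverage
      rw [sub_sub_sub_cancel_right]
    rwa [h4]
  have hpm : Measurable (proj (numBins n) (influence f₀ (haarSeries γ))) := by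
    unfold proj hist
    refine Measurable.const_mul (Finset.measurable_sum _ fun j _ => Measurable.const_mul ?_ _) _
    exact measurable_one.indicator measurableSet_Icc
  have him : AEStronglyMeasurable (influence f₀ (haarSeries γ)) (obsLaw f₀) :=
    (aestronglyMeasurable_haarSeries hγ).sub aestronglyMeasurable_const
  have hDm : AEStronglyMeasurable D (obsLaw f₀) := hpm.aestronglyMeasurable.sub him
  have hii : Integrable (influence f₀ (haarSeries γ)) (obsLaw f₀) :=
    (integrable_haarSeries hf hγ).sub (integrable_const _)
  have hDi : Integrable D (obsLaw f₀) := Integrable.of_bound hDm _ hDb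
  have hpi : Integrable (proj (numBins n) (influence f₀ (haarSeries γ))) (obsLaw f₀) := by
    have := hDi.add hii
    refine this.congr (ae_of_all _ fun x => ?_)
    simp [hD]
  have hiz : ∫ x, influence f₀ (haarSeries γ) x ∂obsLaw f₀ = 0 := by
    unfold influence
    rw [integral_sub (integrable_haarSeries hf hγ) (integrable_const _), integral_obsLaw hf]
    simp
  have hDint : integ f₀ D = bias f₀ γ n := by
    rw [← integral_obsLaw hf, integral_sub hpi hii, hiz, sub_zero, integral_obsLaw hf]
    rfl
  -- At deviation `ε/√n` the factors of `n` cancel and the bound is `oscBound² / ε²`.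
  have hcheb := sampleLaw_mean_ge_le hf hDm hDb hn (show 0 < ε / √(n : ℝ) by positivity)
  have e : oscBound γ n ^ 2 / (n * (ε / √(n : ℝ)) ^ 2) = oscBound γ n ^ 2 / ε ^ 2 := by
    rw [div_pow, Real.sq_sqrt hn0.le]
    field_simp
  rw [e, hDint] at hcheb
  refine le_trans (measure_mono fun y hy => ?_) hcheb
  have hy' : ε ≤ |√(n : ℝ) * (psiHatProj f₀ (haarSeries γ) (numBins n) n y -
    psiHat f₀ (haarSeries γ) n y - bias f₀ γ n)| := hy
  change ε / √(n : ℝ) ≤ _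
  rw [abs_mul, abs_of_pos hsn] at hy'
  have e2 : (∑ i, D (y i)) / n - bias f₀ γ n = psiHatProj f₀ (haarSeries γ) (numBins n) n y -
      psiHat f₀ (haarSeries γ) n y - bias f₀ γ n := by
    unfold psiHatProj psiHat centring
    rw [Finset.sum_sub_distrib]
    ring
  rw [div_le_iff₀ hsn, mul_comm, e2]
  exact hy'

end FracBvM

/-! ### Convergence of the posteriors and failure at efficient centrings. -/

namespace FracBvM

variable {f₀ : ℝ → ℝ} {γ : ℝ}

/-! ### Convergence of the posteriors -/

/-- A difference of squares: the sum is bounded and the difference is small. The tolerance on `m`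
admits both `ψ̂` and `ψ̂_{[K_n]}`. -/
theorem abs_posteriorVariance_sub_le (hf : IsDensity f₀) (hγ : 0 < γ) {n : ℕ} (hn : 1 ≤ n)
    {y : Fin n → ℝ} {J : Fin n → Fin (numBins n)} (hJ : ∀ i, InBin (numBins n) (J i) (y i))
    {m : ℝ} (hm : |m - psiHat f₀ (haarSeries γ) n y| ≤ oscBound γ n) :
    |(∑ i, (binAverage γ (numBins n) (J i) - m) ^ 2) / n -
        (∑ i, influence f₀ (haarSeries γ) (y i) ^ 2) / n| ≤
      (4 * supBound γ + 2 * oscBound γ n) *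
        (2 * oscBound γ n + |psiHat f₀ (haarSeries γ) n y - integ f₀ (haarSeries γ)|) := by
  rw [← sub_div, ← Finset.sum_sub_distrib]
  have hhat : |psiHat f₀ (haarSeries γ) n y| ≤ supBound γ := by
    rw [psiHat_eq hn]
    exact abs_sum_div_le hn fun i => abs_haarSeries_le_of_inBin hγ (hJ i)
  refine abs_sum_div_le hn fun i => ?_
  have h1 := abs_binAverage_sub_le hγ (hJ i)
  have h2 := abs_influence_le hf hγ (hJ i)
  have h3 := abs_binAverage_le hγ (J i)
  set u := binAverage γ (numBins n) (J i)
  set z := influence f₀ (haarSeries γ) (y i) with hz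
  set ψ := psiHat f₀ (haarSeries γ) n y
  have e : (u - m) ^ 2 - z ^ 2 = ((u - m) + z) * ((u - m) - z) := by ring
  rw [e, abs_mul]
  have h4 : |u - m - z| ≤ 2 * oscBound γ n + |ψ - integ f₀ (haarSeries γ)| := by
    have e2 : u - m - z = (u - haarSeries γ (y i)) + (-(m - ψ) + -(ψ - integ f₀ (haarSeries γ))) := by
      rw [hz]
      unfold influence
      ring
    rw [e2]
    refine (abs_add_le _ _).trans ?_
    have := abs_add_le (-(m - ψ)) (-(ψ - integ f₀ (haarSeries γ)))
    rw [abs_neg, abs_neg] at this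
    linarith
  have h5 : |u - m + z| ≤ 4 * supBound γ + 2 * oscBound γ n := by
    have e3 : u - m + z = u + (-(m - ψ) + (-ψ + z)) := by ring
    rw [e3]
    refine (abs_add_le _ _).trans ?_
    have h6 := abs_add_le (-(m - ψ)) (-ψ + z)
    have h7 := abs_add_le (-ψ) z
    rw [abs_neg] at h6 h7
    linarith
  exact mul_le_mul h5 h4 (abs_nonneg _) ((abs_nonneg _).trans h5)

theorem supBound_pos (hγ : 0 < γ) : 0 < supBound γ := by
  have h := (two_rpow_neg_mem hγ).2
  exact add_pos_of_pos_of_nonneg (by positivity) (inv_nonneg.mpr (by linarith))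

theorem posteriorLaw_eq (hγ : 0 < γ) {n : ℕ} (hn : 1 ≤ n) {y : Fin n → ℝ}
    {J : Fin n → Fin (numBins n)} (hJ : ∀ i, InBin (numBins n) (J i) (y i)) (b : ℝ) {α : ℝ}
    (hα : 0 < α) (v m : ℝ) :
    posteriorLaw (haarSeries γ) b n α y v m =
      (dirichlet fun j => (n : ℝ) ^ (-b) + α * count J j).map
        fun ω => v * (∑ j, ω j * binAverage γ (numBins n) j - m) := by
  have hn0 : (0 : ℝ) < n := by exact_mod_cast hn
  exact histPosteriorLaw_eq hγ hn (numBins_pos n) (fun _ => by positivity) hα hJ v m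

/-- Common to both assertions: `x = 0` with centring `ψ̂_{[K_n]}`, and `x > 0` with `ψ̂`. Off three
events of vanishing probability (centring error, law of large numbers for `ψ̃²`, discretisation of
the variance) the uniform limit theorem applies. -/
theorem convWeaklyInProb_posteriorLaw (hf : IsDensity f₀) (hγ : 0 < γ) {b x : ℝ} (hb : 1 / 6 < b)
    (hx : x < 2 / 3) {m : ∀ n : ℕ, (Fin n → ℝ) → ℝ}
    (hm : ∀ n : ℕ, 1 ≤ n → ∀ᵐ y ∂sampleLaw f₀ n,
      |m n y - psiHat f₀ (haarSeries γ) n y| ≤ oscBound γ n)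
    (hcent : TendstoZeroInProb (sampleLaw f₀) fun n y => √((n : ℝ) * (n : ℝ) ^ (-x)) *
      (psiHatProj f₀ (haarSeries γ) (numBins n) n y - m n y)) :
    ConvWeaklyInProb (sampleLaw f₀)
      (fun n y => posteriorLaw (haarSeries γ) b n ((n : ℝ) ^ (-x)) y
        (√((n : ℝ) * (n : ℝ) ^ (-x))) (m n y))
      (limitLaw f₀ (haarSeries γ)) := by
  intro ε hε
  set V := integ f₀ fun x => influence f₀ (haarSeries γ) x ^ 2 with hV
  set Q := (1 - (2 : ℝ) ^ (-γ))⁻¹ with hQ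
  have hQ0 : 0 ≤ Q := (oscBound_nonneg hγ 0).trans (oscBound_le hγ 0)
  have hS0 := supBound_pos hγ
  -- Both a bin average and `m` are at most `supBound γ + Q` in modulus, whence the bound on their
  -- difference.
  obtain ⟨η, hη, N, hN⟩ := exists_dBL_dirichlet_lt hb hx (2 * supBound γ + 2 * Q) V
    (ENNReal.ofReal_pos.mpr hε)
  let W : ∀ n : ℕ, (Fin n → ℝ) → ℝ := fun n y =>
    ((∑ i, influence f₀ (haarSeries γ) (y i) ^ 2) / n - V)
  let U : ∀ n : ℕ, (Fin n → ℝ) → ℝ := fun n y =>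
    (4 * supBound γ + 2 * Q) *
      (2 * oscBound γ n + |psiHat f₀ (haarSeries γ) n y - integ f₀ (haarSeries γ)|)
  have hU : TendstoZeroInProb (sampleLaw f₀) U := by
    refine (tendstoZeroInProb_psiHat hf hγ).of_le (C := 4 * supBound γ + 2 * Q)
      (r := fun n => (4 * supBound γ + 2 * Q) * (2 * oscBound γ n)) (by positivity) ?_ ?_
    · simpa using ((tendsto_oscBound hγ).const_mul 2).const_mul (4 * supBound γ + 2 * Q)
    · refine Eventually.of_forall fun n => ae_of_all _ fun y => ?_
      have h0 := oscBound_nonneg hγ n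
      have h1 : 0 ≤ U n y := by positivity
      rw [abs_of_nonneg h1]
      simp only [U]
      linarith
  have h3 := ((hcent η hη).add ((tendstoZeroInProb_variance hf hγ) (η / 2) (by positivity))).add
    (hU (η / 2) (by positivity))
  rw [add_zero, add_zero] at h3
  refine tendsto_of_tendsto_of_tendsto_of_le_of_le' tendsto_const_nhds h3
    (Eventually.of_forall fun _ => zero_le) ?_
  filter_upwards [eventually_ge_atTop (max N 1)] with n hn
  have hn1 : 1 ≤ n := (le_max_right _ _).trans hn
  have hn0 : (0 : ℝ) < n := by exact_mod_cast hn1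
  refine le_trans (measure_mono_ae ?_) ((measure_union_le _ _).trans
    (add_le_add_left (measure_union_le _ _) _))
  filter_upwards [ae_exists_inBin_sample hf n (numBins_pos n), hm n hn1] with y ⟨J, hJ⟩ hmy hy
  have hy' : ENNReal.ofReal ε ≤ dBL _ _ := hy
  by_contra hcon
  have hcon' : y ∉ ({y | η ≤ |√((n : ℝ) * (n : ℝ) ^ (-x)) *
      (psiHatProj f₀ (haarSeries γ) (numBins n) n y - m n y)|} ∪ {y | η / 2 ≤ |W n y|}) ∪
      {y | η / 2 ≤ |U n y|} := hcon
  simp only [Set.mem_union, Set.mem_ofPred_eq, not_or, not_le] at hcon'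
  obtain ⟨⟨hc1, hc2⟩, hc3⟩ := hcon'
  rw [posteriorLaw_eq hγ hn1 hJ b (by positivity)] at hy'
  refine absurd (hN n ((le_max_left _ _).trans hn) J (binAverage γ (numBins n)) (m n y) ?_ ?_ ?_)
    (not_lt.mpr hy')
  · intro j
    have h4 := abs_binAverage_le hγ j
    have h5 : |psiHat f₀ (haarSeries γ) n y| ≤ supBound γ := by
      rw [psiHat_eq hn1]
      exact abs_sum_div_le hn1 fun i => abs_haarSeries_le_of_inBin hγ (hJ i)
    have h6 := oscBound_le hγ n
    have h7 := abs_sub_abs_le_abs_sub (m n y) (psiHat f₀ (haarSeries γ) n y)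
    have h8 := abs_sub (binAverage γ (numBins n) j) (m n y)
    linarith
  · rw [← psiHatProj_eq (f₀ := f₀) hγ hn1 hJ]
    exact hc1.le
  · have h4 := abs_posteriorVariance_sub_le hf hγ hn1 hJ hmy
    have h5 : |(∑ i, (binAverage γ (numBins n) (J i) - m n y) ^ 2) / n -
        (∑ i, influence f₀ (haarSeries γ) (y i) ^ 2) / n| ≤ U n y := by
      refine h4.trans (mul_le_mul_of_nonneg_right ?_ ?_)
      · have := oscBound_le hγ n
        linarith
      · have := oscBound_nonneg hγ n
        positivity
    have h6 := (le_abs_self (U n y)).trans hc3.le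
    have h7 := abs_add_le ((∑ i, (binAverage γ (numBins n) (J i) - m n y) ^ 2) / n -
        (∑ i, influence f₀ (haarSeries γ) (y i) ^ 2) / n) (W n y)
    have e : (∑ i, (binAverage γ (numBins n) (J i) - m n y) ^ 2) / n -
        (∑ i, influence f₀ (haarSeries γ) (y i) ^ 2) / n + W n y =
        (∑ i, (binAverage γ (numBins n) (J i) - m n y) ^ 2) / n - V := by
      simp only [W]
      ring
    rw [e] at h7
    linarith

/-! ### Failure of the Bernstein–von Mises theorem -/

/-- A strictly increasing test function for the bounded Lipschitz distance. -/
def testFun (x : ℝ) : ℝ := Real.arctan x / 4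

theorem testFun_mem : ∃ L M : ℝ≥0, L + M ≤ 1 ∧ LipschitzWith L testFun ∧ ∀ x, |testFun x| ≤ M := by
  refine ⟨1 / 4, 3 / 4, by norm_num, ?_, fun x => ?_⟩
  · refine lipschitzWith_of_nnnorm_deriv_le (Real.differentiable_arctan.div_const 4) fun x => ?_
    unfold testFun
    rw [← NNReal.coe_le_coe, coe_nnnorm, deriv_div_const, Real.deriv_arctan]
    push_cast
    rw [Real.norm_of_nonneg (by positivity)]
    gcongr
    rw [div_le_one (by positivity)]
    nlinarith [sq_nonneg x]
  · have h1 := Real.arctan_lt_pi_div_two x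
    have h2 := Real.neg_pi_div_two_lt_arctan x
    have h3 := Real.pi_lt_d2
    unfold testFun
    push_cast
    rw [abs_le]
    constructor <;> linarith

theorem ofReal_abs_integral_testFun_sub_le (μ ν : Measure ℝ) :
    ENNReal.ofReal |∫ x, testFun x ∂μ - ∫ x, testFun x ∂ν| ≤ dBL μ ν :=
  le_iSup₂_of_le testFun testFun_mem le_rfl

theorem testFun_shift_mem (θ : ℝ) : ∃ L M : ℝ≥0, L + M ≤ 1 ∧
    LipschitzWith L (fun x => testFun (x + θ)) ∧ ∀ x, |testFun (x + θ)| ≤ M := by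
  obtain ⟨L, M, h1, h2, h3⟩ := testFun_mem
  exact ⟨L, M, h1, .of_dist_le_mul fun x y => by simpa using h2.dist_le_mul (x + θ) (y + θ),
    fun x => h3 _⟩

theorem integrable_testFun (μ : Measure ℝ) [IsFiniteMeasure μ] (θ : ℝ) :
    Integrable (fun x => testFun (x + θ)) μ := by
  obtain ⟨L, M, -, h2, h3⟩ := testFun_shift_mem θ
  exact Integrable.of_bound h2.continuous.aestronglyMeasurable M (ae_of_all _ h3)

theorem strictMono_testFun : StrictMono testFun := fun _ _ h =>
  div_lt_div_of_pos_right (Real.arctan_strictMono h) (by norm_num)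

theorem integral_testFun_shift_pos (μ : Measure ℝ) [IsProbabilityMeasure μ] {c : ℝ} (hc : 0 < c) :
    0 < ∫ x, (testFun (x + c) - testFun x) ∂μ := by
  have hpos : ∀ x, 0 < testFun (x + c) - testFun x := fun x =>
    sub_pos.mpr (strictMono_testFun (by linarith))
  have h0 := integrable_testFun μ 0
  simp only [add_zero] at h0
  rw [integral_pos_iff_support_of_nonneg (fun x => (hpos x).le) ((integrable_testFun μ c).sub h0)]
  have : Function.support (fun x => testFun (x + c) - testFun x) = Set.univ :=
    Set.eq_univ_of_forall fun x => (hpos x).ne'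
  rw [this]
  simp

/-- Monotonicity of the test function replaces the shift `θ` by its lower bound `c`, so `θ` need not
be bounded; this covers a diverging bias. -/
theorem le_dBL_add_dBL_of_shift {μ ν : Measure ℝ} [IsProbabilityMeasure μ]
    [IsProbabilityMeasure ν] {c θ : ℝ} (hθ : c ≤ θ) :
    ENNReal.ofReal (∫ x, (testFun (x + c) - testFun x) ∂ν) ≤
      dBL μ ν + dBL (μ.map fun x => x + θ) ν := by
  have hi := fun θ => integrable_testFun μ θ
  have hi' := fun θ => integrable_testFun ν θ
  have hi0 := hi' 0
  simp only [add_zero] at hi0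
  have h1 : ENNReal.ofReal |∫ x, testFun (x + c) ∂μ - ∫ x, testFun (x + c) ∂ν| ≤ dBL μ ν :=
    le_iSup₂_of_le (fun x => testFun (x + c)) (testFun_shift_mem c) le_rfl
  have h2 := ofReal_abs_integral_testFun_sub_le (μ.map fun x => x + θ) ν
  have hc : Continuous testFun := Real.continuous_arctan.div_const 4
  rw [integral_map (by fun_prop) hc.aestronglyMeasurable] at h2
  have h3 : ∫ x, testFun (x + c) ∂μ ≤ ∫ x, testFun (x + θ) ∂μ :=
    integral_mono (hi c) (hi θ) fun x => strictMono_testFun.monotone (by linarith)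
  refine le_trans ?_ (add_le_add h1 h2)
  rw [← ENNReal.ofReal_add (abs_nonneg _) (abs_nonneg _), integral_sub (hi' c) hi0]
  refine ENNReal.ofReal_le_ofReal ?_
  have h4 := neg_abs_le (∫ x, testFun (x + c) ∂μ - ∫ x, testFun (x + c) ∂ν)
  have h5 := le_abs_self (∫ x, testFun (x + θ) ∂μ - ∫ x, testFun x ∂ν)
  linarith

/-- Recentring from `ψ̂_{[K_n]}` to `T` translates the posterior by `θ`, which is close to `√n`
times the bias. Convergence at both centrings would contradict `le_dBL_add_dBL_of_shift`. -/
theorem not_convWeaklyInProb_of_bias (hf : IsDensity f₀) (hγ : 0 < γ) {b c : ℝ} (hc : 0 < c)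
    (hbias : ∀ n : ℕ, 1 ≤ n → c ≤ √(n : ℝ) * bias f₀ γ n)
    (hconv : ConvWeaklyInProb (sampleLaw f₀)
        (fun n y => posteriorLaw (haarSeries γ) b n 1 y (√(n : ℝ))
          (psiHatProj f₀ (haarSeries γ) (numBins n) n y))
        (limitLaw f₀ (haarSeries γ)))
    {T : ∀ n : ℕ, (Fin n → ℝ) → ℝ}
    (hT : TendstoZeroInProb (sampleLaw f₀) fun n y => √(n : ℝ) *
      (T n y - psiHat f₀ (haarSeries γ) n y)) :
    ¬ ConvWeaklyInProb (sampleLaw f₀)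
        (fun n y => posteriorLaw (haarSeries γ) b n 1 y (√(n : ℝ)) (T n y))
        (limitLaw f₀ (haarSeries γ)) := by
  intro hconvT
  have hν : IsProbabilityMeasure (limitLaw f₀ (haarSeries γ)) := by
    unfold limitLaw
    infer_instance
  set κ := ∫ x, (testFun (x + c / 2) - testFun x) ∂limitLaw f₀ (haarSeries γ) with hκ
  have hκ0 : 0 < κ := integral_testFun_shift_pos _ (by positivity)
  -- The four probabilities tend to zero, yet the four events together have full probability; a
  -- single `n` with sum below `1` is absurd.
  have h3 := (((hconv (κ / 2) (by positivity)).add (hconvT (κ / 2) (by positivity))).add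
    (hT (c / 4) (by positivity))).add
      (tendstoZeroInProb_expansion hf hγ (c / 4) (by positivity))
  simp only [add_zero] at h3
  obtain ⟨n, hlt, hn1⟩ := ((h3.eventually_lt_const one_pos).and (eventually_ge_atTop 1)).exists
  have := isProbabilityMeasure_sampleLaw hf n
  have hn0 : (0 : ℝ) < n := by exact_mod_cast hn1
  refine absurd hlt (not_lt.mpr ?_)
  refine le_trans ?_ (add_le_add_left (add_le_add_left (measure_union_le _ _) _) _)
  refine le_trans ?_ (add_le_add_left (measure_union_le _ _) _)
  refine le_trans ?_ (measure_union_le _ _)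
  refine (measure_univ (μ := sampleLaw f₀ n)).symm.le.trans (measure_mono_ae ?_)
  filter_upwards [ae_exists_inBin_sample hf n (numBins_pos n)] with y ⟨J, hJ⟩ _
  by_contra hcon
  have hcon' : y ∉ (({y | ENNReal.ofReal (κ / 2) ≤ dBL (posteriorLaw (haarSeries γ) b n 1 y
      (√(n : ℝ)) (psiHatProj f₀ (haarSeries γ) (numBins n) n y)) (limitLaw f₀ (haarSeries γ))} ∪
      {y | ENNReal.ofReal (κ / 2) ≤ dBL (posteriorLaw (haarSeries γ) b n 1 y
        (√(n : ℝ)) (T n y)) (limitLaw f₀ (haarSeries γ))}) ∪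
      {y | c / 4 ≤ |√(n : ℝ) * (T n y - psiHat f₀ (haarSeries γ) n y)|}) ∪
      {y | c / 4 ≤ |√(n : ℝ) * (psiHatProj f₀ (haarSeries γ) (numBins n) n y -
        psiHat f₀ (haarSeries γ) n y - bias f₀ γ n)|} := hcon
  simp only [Set.mem_union, Set.mem_ofPred_eq, not_or, not_le] at hcon'
  obtain ⟨⟨⟨hc1, hc2⟩, hc3⟩, hc4⟩ := hcon'
  set θ := √(n : ℝ) * (psiHatProj f₀ (haarSeries γ) (numBins n) n y - T n y) with hθdef
  -- The bias contributes at least `c`, and each of the two errors costs at most `c/4`.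
  have hθ : c / 2 ≤ θ := by
    have h5 := hbias n hn1
    have h6 := (abs_lt.mp hc3).2
    have h7 := (abs_lt.mp hc4).1
    have e : θ = √(n : ℝ) * (psiHatProj f₀ (haarSeries γ) (numBins n) n y -
        psiHat f₀ (haarSeries γ) n y - bias f₀ γ n) -
        √(n : ℝ) * (T n y - psiHat f₀ (haarSeries γ) n y) + √(n : ℝ) * bias f₀ γ n := by
      rw [hθdef]
      ring
    rw [e]
    linarith
  rw [posteriorLaw_eq hγ hn1 hJ b one_pos] at hc1 hc2
  have hD : IsProbabilityMeasure (dirichlet fun j => (n : ℝ) ^ (-b) + 1 * (count J j : ℝ)) :=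
    isProbabilityMeasure_dirichlet fun j => by positivity
  have hX : Measurable fun ω : Fin (numBins n) → ℝ => √(n : ℝ) *
      (∑ j, ω j * binAverage γ (numBins n) j -
        psiHatProj f₀ (haarSeries γ) (numBins n) n y) := by fun_prop
  have hP := Measure.isProbabilityMeasure_map (μ := dirichlet fun j => (n : ℝ) ^ (-b) +
    1 * (count J j : ℝ)) hX.aemeasurable
  have h8 := le_dBL_add_dBL_of_shift (μ := (dirichlet fun j => (n : ℝ) ^ (-b) +
    1 * (count J j : ℝ)).map fun ω => √(n : ℝ) *
      (∑ j, ω j * binAverage γ (numBins n) j -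
        psiHatProj f₀ (haarSeries γ) (numBins n) n y)) (ν := limitLaw f₀ (haarSeries γ)) hθ
  rw [Measure.map_map (by fun_prop) hX] at h8
  have e2 : ((fun x => x + θ) ∘ fun ω : Fin (numBins n) → ℝ => √(n : ℝ) *
      (∑ j, ω j * binAverage γ (numBins n) j -
        psiHatProj f₀ (haarSeries γ) (numBins n) n y)) = fun ω => √(n : ℝ) *
      (∑ j, ω j * binAverage γ (numBins n) j - T n y) := by
    funext ω
    simp only [Function.comp_apply, hθdef]
    ring
  rw [e2] at h8
  have h9 := ENNReal.add_lt_add hc1 hc2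
  rw [← ENNReal.ofReal_add (by positivity) (by positivity), add_halves] at h9
  exact absurd h8 (not_le.mpr h9)

end FracBvM

end

/-! ### The proposition. -/

open FracBvM in
theorem proposition2p6 (f₀ : ℝ → ℝ) (ρ γ b : ℝ)
    (hf₀ : IsDensity f₀) (hC1 : ContDiffOn ℝ 1 f₀ (Set.Icc 0 1))
    (hρ : 0 < ρ) (hderiv : ∀ x ∈ Set.Icc (0 : ℝ) 1, ρ < derivWithin f₀ (Set.Icc 0 1) x)
    (hγ : 0 < γ) (hγ' : γ ≤ 1 / 2) (hb : 1 / 6 < b) :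
    -- the usual posterior, centred at `ψ̂_{[K_n]}`
    (ConvWeaklyInProb (sampleLaw f₀)
        (fun n y => posteriorLaw (haarSeries γ) b n 1 y (√(n : ℝ))
          (psiHatProj f₀ (haarSeries γ) (numBins n) n y))
        (limitLaw f₀ (haarSeries γ)) ∧
      -- the expansion `ψ̂_{[K_n]} - ψ̂ = F₀(ψ̃_{[K_n]}) + o_P(1/√n)`
      IsLittleOP (sampleLaw f₀)
        (fun n y => psiHatProj f₀ (haarSeries γ) (numBins n) n y - psiHat f₀ (haarSeries γ) n y
          - integ f₀ (proj (numBins n) (influence f₀ (haarSeries γ))))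
        (fun n => 1 / √(n : ℝ)) ∧
      -- the bias does not vanish, and diverges if `γ < 1/2`
      (∃ c : ℝ, 0 < c ∧ ∀ n : ℕ, 1 ≤ n →
        c ≤ |√(n : ℝ) * integ f₀ (proj (numBins n) (influence f₀ (haarSeries γ)))|) ∧
      (γ < 1 / 2 →
        Tendsto (fun n : ℕ =>
          |√(n : ℝ) * integ f₀ (proj (numBins n) (influence f₀ (haarSeries γ)))|) atTop atTop) ∧
      -- the BvM theorem fails, whichever linear efficient centring `T` is used (e.g. `T = ψ̂`)
      (∀ T : ∀ n : ℕ, (Fin n → ℝ) → ℝ,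
        IsLittleOP (sampleLaw f₀) (fun n y => T n y - psiHat f₀ (haarSeries γ) n y)
          (fun n => 1 / √(n : ℝ)) →
        ¬ ConvWeaklyInProb (sampleLaw f₀)
            (fun n y => posteriorLaw (haarSeries γ) b n 1 y (√(n : ℝ)) (T n y))
            (limitLaw f₀ (haarSeries γ)))) ∧
    -- the `α_n`-posterior with `α_n = n^{-x}`, centred at `ψ̂`
    (∀ x : ℝ, (1 - 2 * γ) / 3 < x → x < 2 / 3 →
      ConvWeaklyInProb (sampleLaw f₀)
        (fun n y => posteriorLaw (haarSeries γ) b n ((n : ℝ) ^ (-x)) y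
          (√((n : ℝ) * (n : ℝ) ^ (-x))) (psiHat f₀ (haarSeries γ) n y))
        (limitLaw f₀ (haarSeries γ))) := by
  obtain ⟨L, hs⟩ := exists_slopesIn hC1 hderiv
  have hL : 0 ≤ L := by
    have h := hs.2 0 1 le_rfl zero_le_one le_rfl
    linarith [h.1, h.2]
  have hlow := fun n (hn : 1 ≤ n) => le_sqrt_mul_bias hf₀ hγ hρ.le hL hs hn
  have hexp := tendstoZeroInProb_expansion hf₀ hγ
  have hc : ∀ n : ℕ, 1 ≤ n → ρ / 4 ≤ √(n : ℝ) * bias f₀ γ n := fun n hn => by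
    refine le_trans ?_ (hlow n hn)
    -- Here `γ ≤ 1/2` makes the exponent nonnegative.
    have h1 : 1 ≤ (n : ℝ) ^ ((1 - 2 * γ) / 6) :=
      Real.one_le_rpow (by exact_mod_cast hn) (by linarith)
    nlinarith
  have hconv : ConvWeaklyInProb (sampleLaw f₀)
        (fun n y => posteriorLaw (haarSeries γ) b n 1 y (√(n : ℝ))
          (psiHatProj f₀ (haarSeries γ) (numBins n) n y))
        (limitLaw f₀ (haarSeries γ)) := by
    -- For `x = 0` the temperature is `1`, and with `m = ψ̂_{[K_n]}` the centring error is
    -- identically zero.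
    have h := convWeaklyInProb_posteriorLaw hf₀ hγ (x := 0) hb (by norm_num)
      (m := fun n y => psiHatProj f₀ (haarSeries γ) (numBins n) n y) (fun n hn => by
        filter_upwards [ae_exists_inBin_sample hf₀ n (numBins_pos n)] with y ⟨J, hJ⟩
        exact abs_psiHatProj_sub_psiHat_le hγ hn hJ) (fun ε hε => by simp [hε.not_ge])
    simpa using h
  refine ⟨⟨hconv, isLittleOP_inv_sqrt_iff.mpr hexp, ⟨ρ / 4, by positivity, fun n hn =>
    (hc n hn).trans (le_abs_self _)⟩, fun hγ2 => ?_, fun T hT => ?_⟩, fun x hx1 hx2 => ?_⟩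
  · have h1 : Tendsto (fun n : ℕ => (n : ℝ) ^ ((1 - 2 * γ) / 6) * (ρ / 4)) atTop atTop :=
      (tendsto_rpow_natCast_atTop (by linarith)).atTop_mul_const (by positivity)
    refine tendsto_atTop_mono' _ ?_ h1
    filter_upwards [eventually_ge_atTop 1] with n hn
    exact (hlow n hn).trans (le_abs_self _)
  · exact not_convWeaklyInProb_of_bias hf₀ hγ (by positivity) hc hconv
      (isLittleOP_inv_sqrt_iff.mp hT)
  · refine convWeaklyInProb_posteriorLaw hf₀ hγ hb hx2 (fun n hn => ae_of_all _ fun y => ?_) ?_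
    · simpa using oscBound_nonneg hγ n
    -- The exponent is that of the bias on the scale `√(nα_n)`; it is negative exactly when `x >
    -- (1-2γ)/3`.
    · have hr : Tendsto (fun n : ℕ => (n : ℝ) ^ ((1 - x) / 2 - (1 + γ) / 3) *
          ((1 / 2 : ℝ) ^ (-(1 + γ)) * (L / 2))) atTop (𝓝 0) := by
        simpa using (tendsto_rpow_natCast_zero
          (e := (1 - x) / 2 - (1 + γ) / 3) (by linarith)).mul_const
            ((1 / 2 : ℝ) ^ (-(1 + γ)) * (L / 2))
      refine hexp.of_le one_pos hr ?_
      filter_upwards [eventually_ge_atTop 1] with n hn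
      refine ae_of_all _ fun y => ?_
      have hn1 : (1 : ℝ) ≤ n := by exact_mod_cast hn
      have hn0 : (0 : ℝ) < n := by linarith
      -- Since `γ ≤ 1/2` forces `x > 0`, tempering shrinks the scale, and the expansion at scale
      -- `√n` controls the stochastic part.
      have hle : √((n : ℝ) * (n : ℝ) ^ (-x)) ≤ √(n : ℝ) := by
        refine Real.sqrt_le_sqrt (mul_le_of_le_one_right hn0.le ?_)
        exact Real.rpow_le_one_of_one_le_of_nonpos hn1 (by linarith)
      have hsq : √((n : ℝ) * (n : ℝ) ^ (-x)) = (n : ℝ) ^ ((1 - x) / 2) := by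
        rw [← Real.rpow_one_add' hn0.le (by linarith), Real.sqrt_eq_rpow, ← Real.rpow_mul hn0.le]
        congr 1
        ring
      set D := psiHatProj f₀ (haarSeries γ) (numBins n) n y - psiHat f₀ (haarSeries γ) n y
      have e : √((n : ℝ) * (n : ℝ) ^ (-x)) * D = √((n : ℝ) * (n : ℝ) ^ (-x)) *
          (D - bias f₀ γ n) + √((n : ℝ) * (n : ℝ) ^ (-x)) * bias f₀ γ n := by ring
      rw [e]
      refine (abs_add_le _ _).trans (add_le_add ?_ ?_)
      · rw [one_mul, abs_mul, abs_mul, abs_of_nonneg (Real.sqrt_nonneg _),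
          abs_of_nonneg (Real.sqrt_nonneg _)]
        gcongr
      · rw [abs_of_nonneg (mul_nonneg (Real.sqrt_nonneg _) (bias_nonneg hf₀ hγ hρ.le hL hs n)),
          hsq, sub_eq_add_neg ((1 - x) / 2), Real.rpow_add hn0, mul_assoc, ← neg_div]
        exact mul_le_mul_of_nonneg_left (bias_le hf₀ hγ hρ.le hL hs hn) (by positivity)
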